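/- Let $0<R_1<R_2$. Consider the Sturm--Liouville problem $$-(rV')'=\mu\, rV\qquad (R_1<r<R_2)$$ with either a separated boundary condition $$m_{11}V(R_1)+m_{12}(rV')(R_1)=0,\qquad m_{21}V(R_2)+m_{22}(rV')(R_2)=0,$$ where $m_{ij}\in\mathbb R$, $(m_{11},m_{12})\ne(0,0)$, $(m_{21},m_{22})\neq(0,0)$, or a coupled boundary condition $$\begin{pmatrix}V\\ rV'\end{pmatrix}(R_1)=K\begin{pmatrix}V\\ rV'\end{pmatrix}(R_2),\qquad K\in SL_2(\mathbb R).$$ (1) Every eigenvalue $\mu$ is real and geometrically simple or double. All but finitely many eigenvalues are positive, and the positive ones form an infinite sequence $\mu=\zeta_j^2$, $0<\zeta_1\le\zeta_2\le\cdots$ (each eigenvalue repeated according to its multiplicity), with linearly independent real eigenfunctions $V_1,V_2,\dots$ such that, for each $z>0$, the $V_j$ with $\zeta_j=z$ form a basis of the eigenspace of $\mu=z^2$. Now let $\zeta_j$ and $V_j$ ($j=1,2,\dots$) be as in (1) or, more generally, let $\zeta_j$ be any real numbers and $V_j$ any real solutions of the boundary value problem with $\mu=\zeta_j^2$. (2)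 If the boundary condition is the Dirichlet condition $V(R_1)=V(R_2)=0$, then $x\mapsto V_j(|x|)$ belongs to $H^1_0(\mathcal R)\cap H^\infty(\mathcal R)$, where $\mathcal R=\{x\in\mathbb R^2: R_1<|x|<R_2\}$ and $H^\infty=\bigcap_k H^k$. For $\eta\in\mathbb R$ let $\lambda_j=\lambda_j(\eta)$ be a real number with $\lambda_j^2=\zeta_j^2+\eta^2$. For $x\in\mathbb R^3$ put $r=\sqrt{x_1^2+x_2^2}$, and let $\Omega=\{x\in\mathbb R^3: R_1<r<R_2\}$. (3) For all $\alpha,\beta,\eta\in\mathbb R$ the function $\Psi_j=\alpha V_j(r)\sin(\eta x_3)+\beta V_j(r)\cos(\eta x_3)$ is smooth in $\Omega$ and satisfies $-\Delta\Psi_j=\lambda_j^2\Psi_j$ there. (4) Let $A=(0,0,a)$ with $a\ne0$, and for a scalar function $\Psi$ put $U_\lambda[\Psi]=\lambda(A\times\nabla)\Psi+\{(A\times\nabla)\times\nabla\}\Psi$. Every element of $$\mathbb Z_E=\bigcup_{j\ge1}\bigcup_{\eta\in\mathbb R}Z^e_{j\eta},\qquad Z^e_{j\eta}=\mathrm{span}\big\{U_{\lambda_j}[V_j(r)\sin(\eta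 x_3)],\;U_{\lambda_j}[V_j(r)\cos(\eta x_3)]\big\},$$ is, with a suitable smooth pressure $P$, a smooth solution in $\Omega$ of the static Euler equations $(u\cdot\nabla)u+\nabla P=0$, $\nabla\cdot u=0$. (5) Let moreover $\nu>0$. Every element of $$\mathbb Z_{NS}=\bigcup_{j\ge1}\bigcup_{\eta\in\mathbb R}Z^{ns}_{j\eta},\qquad Z^{ns}_{j\eta}=\mathrm{span}\big\{e^{-\nu\lambda_j^2t}U_{\lambda_j}[V_j(r)\sin(\eta x_3)],\;e^{-\nu\lambda_j^2t}U_{\lambda_j}[V_j(r)\cos(\eta x_3)]\big\},$$ is, with a suitable smooth pressure $P$, a smooth solution for $t\in\mathbb R$, $x\in\Omega$ of the Navier--Stokes equations $u_t-\nu\Delta u+(u\cdot\nabla)u+\nabla P=0$, $\nabla\cdot u=0$. -/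

import Mathlib

open Set Filter Topology MeasureTheory
open scoped ContDiff Matrix

namespace AnnulusFlow

noncomputable section

/-! ### The Sturm–Liouville problem on `[R₁, R₂]` -/

/-- Self-adjoint boundary conditions for `-(r V')' = μ r V`: separated ones, with coefficients
`m₁₁, m₁₂, m₂₁, m₂₂`, and coupled ones, with a real matrix `K` of determinant one. -/
inductive BoundaryCondition where
  | separated (m₁₁ m₁₂ m₂₁ m₂₂ : ℝ) (h₁ : (m₁₁, m₁₂) ≠ (0, 0)) (h₂ : (m₂₁, m₂₂) ≠ (0, 0))
  | coupled (K : Matrix.SpecialLinearGroup (Fin 2) ℝ)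

/-- The Dirichlet condition `V(R₁) = V(R₂) = 0`. -/
def BoundaryCondition.dirichlet : BoundaryCondition :=
  .separated 1 0 1 0 (by simp) (by simp)

/-- The condition on the boundary data `Y₁ = (V, rV')(R₁)` and `Y₂ = (V, rV')(R₂)`. -/
def BoundaryCondition.Holds {𝕜 : Type} [RCLike 𝕜] :
    BoundaryCondition → (Fin 2 → 𝕜) → (Fin 2 → 𝕜) → Prop
  | .separated m₁₁ m₁₂ m₂₁ m₂₂ _ _, Y₁, Y₂ =>
      (m₁₁ : 𝕜) * Y₁ 0 + (m₁₂ : 𝕜) * Y₁ 1 = 0 ∧ (m₂₁ : 𝕜) * Y₂ 0 + (m₂₂ : 𝕜) * Y₂ 1 = 0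
  | .coupled K, Y₁, Y₂ => Y₁ = (K.1.map fun x : ℝ => (x : 𝕜)) *ᵥ Y₂

theorem BoundaryCondition.Holds.zero {𝕜 : Type} [RCLike 𝕜] (bc : BoundaryCondition) :
    bc.Holds (0 : Fin 2 → 𝕜) 0 := by
  cases bc <;> simp [BoundaryCondition.Holds]

theorem BoundaryCondition.Holds.add {𝕜 : Type} [RCLike 𝕜] {bc : BoundaryCondition}
    {Y₁ Y₂ Z₁ Z₂ : Fin 2 → 𝕜} (hY : bc.Holds Y₁ Y₂) (hZ : bc.Holds Z₁ Z₂) :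
    bc.Holds (Y₁ + Z₁) (Y₂ + Z₂) := by
  cases bc with
  | separated a b c d _ _ =>
    obtain ⟨h1, h2⟩ := hY
    obtain ⟨h3, h4⟩ := hZ
    constructor <;> simp only [Pi.add_apply]
    · linear_combination h1 + h3
    · linear_combination h2 + h4
  | coupled K =>
    simp only [BoundaryCondition.Holds] at *
    rw [hY, hZ, Matrix.mulVec_add]

theorem BoundaryCondition.Holds.smul {𝕜 : Type} [RCLike 𝕜] {bc : BoundaryCondition}
    {Y₁ Y₂ : Fin 2 → 𝕜} (c : 𝕜) (hY : bc.Holds Y₁ Y₂) : bc.Holds (c • Y₁) (c • Y₂) := by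
  cases bc with
  | separated m n p q _ _ =>
    obtain ⟨h1, h2⟩ := hY
    constructor <;> simp only [Pi.smul_apply, smul_eq_mul]
    · linear_combination c * h1
    · linear_combination c * h2
  | coupled K =>
    simp only [BoundaryCondition.Holds] at *
    rw [hY, Matrix.mulVec_smul]

/-- The quasi-derivative `r V'(r)` on `[R₁, R₂]` (one-sided derivatives at the end points). -/
def quasiDeriv {𝕜 : Type} [RCLike 𝕜] (R₁ R₂ : ℝ) (V : ℝ → 𝕜) (r : ℝ) : 𝕜 :=
  (r : 𝕜) * derivWithin V (Icc R₁ R₂) r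

/-- The boundary data `(V(r), rV'(r))`. -/
def bdryData {𝕜 : Type} [RCLike 𝕜] (R₁ R₂ : ℝ) (V : ℝ → 𝕜) (r : ℝ) : Fin 2 → 𝕜 :=
  ![V r, quasiDeriv R₁ R₂ V r]

/-- `V` solves `-(r V')' = μ r V` on `[R₁, R₂]` with the boundary condition `bc`. A function on
`[R₁, R₂]` is represented by its extension by zero to `ℝ`, so that it is determined by its values
on `[R₁, R₂]`. -/
structure IsSLSolution {𝕜 : Type} [RCLike 𝕜] (R₁ R₂ : ℝ) (bc : BoundaryCondition) (μ : 𝕜)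
    (V : ℝ → 𝕜) : Prop where
  eq_zero_outside : ∀ r, r ∉ Icc R₁ R₂ → V r = 0
  differentiableOn : DifferentiableOn ℝ V (Icc R₁ R₂)
  differentiableOn_quasiDeriv : DifferentiableOn ℝ (quasiDeriv R₁ R₂ V) (Icc R₁ R₂)
  equation : ∀ r ∈ Icc R₁ R₂,
    -derivWithin (quasiDeriv R₁ R₂ V) (Icc R₁ R₂) r = μ * (r : 𝕜) * V r
  boundary : bc.Holds (bdryData R₁ R₂ V R₁) (bdryData R₁ R₂ V R₂)

theorem quasiDeriv_add {𝕜 : Type} [RCLike 𝕜] {R₁ R₂ : ℝ} {V W : ℝ → 𝕜}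
    (hV : DifferentiableOn ℝ V (Icc R₁ R₂)) (hW : DifferentiableOn ℝ W (Icc R₁ R₂))
    {r : ℝ} (hr : r ∈ Icc R₁ R₂) :
    quasiDeriv R₁ R₂ (V + W) r = (quasiDeriv R₁ R₂ V + quasiDeriv R₁ R₂ W) r := by
  simp only [quasiDeriv, Pi.add_apply]
  rw [derivWithin_add (hV r hr) (hW r hr)]
  ring

theorem quasiDeriv_smul {𝕜 : Type} [RCLike 𝕜] {R₁ R₂ : ℝ} {V : ℝ → 𝕜} (c : 𝕜)
    (r : ℝ) : quasiDeriv R₁ R₂ (c • V) r = (c • quasiDeriv R₁ R₂ V) r := by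
  simp only [quasiDeriv, Pi.smul_apply, smul_eq_mul]
  rw [derivWithin_const_smul_field]
  simp only [smul_eq_mul]
  ring

/-- The solution space of the boundary value problem; `μ` is an eigenvalue iff it is non-zero, and
its dimension is the geometric multiplicity of `μ`. -/
def eigenspace {𝕜 : Type} [RCLike 𝕜] (R₁ R₂ : ℝ) (hR : R₁ < R₂) (bc : BoundaryCondition) (μ : 𝕜) :
    Submodule 𝕜 (ℝ → 𝕜) where
  carrier := {V | IsSLSolution R₁ R₂ bc μ V}
  zero_mem' := by
    have hq : quasiDeriv R₁ R₂ (0 : ℝ → 𝕜) = 0 := by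
      funext r; simp [quasiDeriv]
    have hb : ∀ r, bdryData R₁ R₂ (0 : ℝ → 𝕜) r = 0 := by
      intro r; funext i; fin_cases i <;> simp [bdryData, hq]
    refine ⟨fun _ _ => rfl, differentiableOn_const _, ?_, ?_, ?_⟩
    · rw [hq]; exact differentiableOn_const _
    · intro r _; rw [hq]; simp
    · rw [hb, hb]; exact .zero bc
  add_mem' := by
    rintro V W hV hW
    have hq : EqOn (quasiDeriv R₁ R₂ (V + W)) (quasiDeriv R₁ R₂ V + quasiDeriv R₁ R₂ W)
        (Icc R₁ R₂) := fun r hr => quasiDeriv_add hV.differentiableOn hW.differentiableOn hr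
    have hb : ∀ r ∈ Icc R₁ R₂,
        bdryData R₁ R₂ (V + W) r = bdryData R₁ R₂ V r + bdryData R₁ R₂ W r := by
      intro r hr; funext i; fin_cases i <;> simp [bdryData, hq hr]
    refine ⟨fun r hr => ?_, hV.differentiableOn.add hW.differentiableOn, ?_, ?_, ?_⟩
    · simp [hV.eq_zero_outside r hr, hW.eq_zero_outside r hr]
    · exact (hV.differentiableOn_quasiDeriv.add hW.differentiableOn_quasiDeriv).congr hq
    · intro r hr
      rw [derivWithin_congr hq (hq hr), derivWithin_add (hV.differentiableOn_quasiDeriv r hr)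
        (hW.differentiableOn_quasiDeriv r hr)]
      have h1 := hV.equation r hr
      have h2 := hW.equation r hr
      simp only [Pi.add_apply]
      linear_combination h1 + h2
    · rw [hb _ (left_mem_Icc.2 hR.le), hb _ (right_mem_Icc.2 hR.le)]
      exact hV.boundary.add hW.boundary
  smul_mem' := by
    rintro c V hV
    have hq : quasiDeriv R₁ R₂ (c • V) = c • quasiDeriv R₁ R₂ V :=
      funext fun r => quasiDeriv_smul c r
    have hb : ∀ r, bdryData R₁ R₂ (c • V) r = c • bdryData R₁ R₂ V r := by
      intro r; funext i; fin_cases i <;> simp [bdryData, hq]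
    refine ⟨fun r hr => ?_, hV.differentiableOn.const_smul c, ?_, ?_, ?_⟩
    · simp [hV.eq_zero_outside r hr]
    · rw [hq]; exact hV.differentiableOn_quasiDeriv.const_smul c
    · intro r hr
      rw [hq, derivWithin_const_smul_field]
      have h1 := hV.equation r hr
      simp only [Pi.smul_apply, smul_eq_mul]
      linear_combination c * h1
    · rw [hb, hb]; exact hV.boundary.smul c

/-- `(ζ j, V j)` lists, in non-decreasing order and repeated according to multiplicity, all `ζ > 0`
such that `ζ ^ 2` is an eigenvalue, together with eigenfunctions: for each `z > 0` the functions
`V j` with `ζ j = z` form a basis of the eigenspace of `z ^ 2`. -/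
structure IsEigenEnumeration (R₁ R₂ : ℝ) (hR : R₁ < R₂) (bc : BoundaryCondition)
    (ζ : ℕ → ℝ) (V : ℕ → ℝ → ℝ) : Prop where
  pos : ∀ j, 0 < ζ j
  monotone : Monotone ζ
  linearIndependent : LinearIndependent ℝ V
  span_eq : ∀ z : ℝ, 0 < z →
    Submodule.span ℝ (V '' {j | ζ j = z}) = eigenspace R₁ R₂ hR bc (z ^ 2)

/-! ### Partial derivatives and Sobolev spaces -/

/-- The partial derivative `∂ᵢ f`. -/
def pd {n : ℕ} (i : Fin n) (f : (Fin n → ℝ) → ℝ) (x : Fin n → ℝ) : ℝ :=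
  fderiv ℝ f x (Pi.single i 1)

/-- The iterated partial derivative along a list of coordinate directions. -/
def iterPd {n : ℕ} (l : List (Fin n)) (f : (Fin n → ℝ) → ℝ) : (Fin n → ℝ) → ℝ :=
  l.foldr pd f

/-- `φ ∈ C_c^∞(Ω)`. -/
def IsTestFunction {n : ℕ} (Ω : Set (Fin n → ℝ)) (φ : (Fin n → ℝ) → ℝ) : Prop :=
  ContDiff ℝ ∞ φ ∧ HasCompactSupport φ ∧ tsupport φ ⊆ Ω

/-- `f ∈ L²(Ω)`. -/
def MemL2 {n : ℕ} (Ω : Set (Fin n → ℝ)) (f : (Fin n → ℝ) → ℝ) : Prop :=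
  MemLp f 2 (volume.restrict Ω)

/-- `g ∈ L²(Ω)` is the weak derivative of `f` on `Ω` along the list `l` of directions. -/
def IsWeakDeriv {n : ℕ} (Ω : Set (Fin n → ℝ)) (l : List (Fin n)) (f g : (Fin n → ℝ) → ℝ) : Prop :=
  MemL2 Ω g ∧ ∀ φ, IsTestFunction Ω φ →
    ∫ x in Ω, f x * iterPd l φ x = (-1) ^ l.length * ∫ x in Ω, g x * φ x

/-- `f ∈ H^k(Ω)`. -/
def MemH {n : ℕ} (Ω : Set (Fin n → ℝ)) (k : ℕ) (f : (Fin n → ℝ) → ℝ) : Prop :=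
  MemL2 Ω f ∧ ∀ l : List (Fin n), l.length ≤ k → ∃ g, IsWeakDeriv Ω l f g

/-- `f ∈ H^∞(Ω)`, the intersection of all `H^k(Ω)`. -/
def MemHInfty {n : ℕ} (Ω : Set (Fin n → ℝ)) (f : (Fin n → ℝ) → ℝ) : Prop :=
  ∀ k : ℕ, MemH Ω k f

/-- `f ∈ H^1_0(Ω)`, the closure of `C_c^∞(Ω)` in `H^1(Ω)`. -/
def MemH10 {n : ℕ} (Ω : Set (Fin n → ℝ)) (f : (Fin n → ℝ) → ℝ) : Prop :=
  MemL2 Ω f ∧ ∃ g : Fin n → (Fin n → ℝ) → ℝ, (∀ i, IsWeakDeriv Ω [i] f (g i)) ∧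
    ∃ φ : ℕ → (Fin n → ℝ) → ℝ, (∀ k, IsTestFunction Ω (φ k)) ∧
      Tendsto (fun k => eLpNorm (φ k - f) 2 (volume.restrict Ω)) atTop (𝓝 0) ∧
      ∀ i, Tendsto (fun k => eLpNorm (pd i (φ k) - g i) 2 (volume.restrict Ω)) atTop (𝓝 0)

/-- The ring `{R₁ < r < R₂}` in the plane. -/
def planeRing (R₁ R₂ : ℝ) : Set (Fin 2 → ℝ) :=
  {x | R₁ < √(x 0 ^ 2 + x 1 ^ 2) ∧ √(x 0 ^ 2 + x 1 ^ 2) < R₂}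

/-- The radial function `x ↦ V(|x|)` in the plane. -/
def planeRadial (V : ℝ → ℝ) (x : Fin 2 → ℝ) : ℝ := V √(x 0 ^ 2 + x 1 ^ 2)

/-! ### Fluid equations in three dimensions -/

/-- The distance `r` to the `x₃`-axis. The coordinates `x₁, x₂, x₃` are `x 0, x 1, x 2`. -/
def cylRadius (x : Fin 3 → ℝ) : ℝ := √(x 0 ^ 2 + x 1 ^ 2)

/-- The domain `{R₁ < r < R₂}` in space. -/
def cylShell (R₁ R₂ : ℝ) : Set (Fin 3 → ℝ) := {x | R₁ < cylRadius x ∧ cylRadius x < R₂}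

/-- The Laplacian. -/
def lap (f : (Fin 3 → ℝ) → ℝ) (x : Fin 3 → ℝ) : ℝ := ∑ i, pd i (pd i f) x

/-- `(A × ∇) f`. -/
def crossGrad (A : Fin 3 → ℝ) (f : (Fin 3 → ℝ) → ℝ) (x : Fin 3 → ℝ) : Fin 3 → ℝ :=
  A ⨯₃ (fun i => pd i f x)

/-- `{(A × ∇) × ∇} f`. -/
def crossGradCross (A : Fin 3 → ℝ) (f : (Fin 3 → ℝ) → ℝ) (x : Fin 3 → ℝ) : Fin 3 → ℝ :=
  ![crossGrad A (pd 2 f) x 1 - crossGrad A (pd 1 f) x 2,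
    crossGrad A (pd 0 f) x 2 - crossGrad A (pd 2 f) x 0,
    crossGrad A (pd 1 f) x 0 - crossGrad A (pd 0 f) x 1]

/-- The divergence. -/
def divergence (u : (Fin 3 → ℝ) → Fin 3 → ℝ) (x : Fin 3 → ℝ) : ℝ :=
  ∑ i, pd i (fun y => u y i) x

/-- The `i`-th component of `(u · ∇) u`. -/
def convection (u : (Fin 3 → ℝ) → Fin 3 → ℝ) (x : Fin 3 → ℝ) (i : Fin 3) : ℝ :=
  ∑ j, u x j * pd j (fun y => u y i) x

/-- `u` is, with some pressure `P`, a smooth solution of the static Euler equations on `Ω`. -/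
def IsStaticEulerSolution (Ω : Set (Fin 3 → ℝ)) (u : (Fin 3 → ℝ) → Fin 3 → ℝ) : Prop :=
  ContDiffOn ℝ ∞ u Ω ∧ ∃ P : (Fin 3 → ℝ) → ℝ, ContDiffOn ℝ ∞ P Ω ∧
    ∀ x ∈ Ω, (∀ i, convection u x i + pd i P x = 0) ∧ divergence u x = 0

/-- `u` is, with some pressure `P`, a smooth solution of the Navier–Stokes equations with
viscosity `ν` on `Ω`, for all times. -/
def IsNavierStokesSolution (ν : ℝ) (Ω : Set (Fin 3 → ℝ)) (u : ℝ → (Fin 3 → ℝ) → Fin 3 → ℝ) :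
    Prop :=
  ContDiffOn ℝ ∞ (fun p : ℝ × (Fin 3 → ℝ) => u p.1 p.2) (univ ×ˢ Ω) ∧
    ∃ P : ℝ → (Fin 3 → ℝ) → ℝ,
      ContDiffOn ℝ ∞ (fun p : ℝ × (Fin 3 → ℝ) => P p.1 p.2) (univ ×ˢ Ω) ∧
      ∀ t : ℝ, ∀ x ∈ Ω,
        (∀ i, deriv (fun s => u s x i) t - ν * lap (fun y => u t y i) x
          + convection (u t) x i + pd i (P t) x = 0) ∧
        divergence (u t) x = 0

/-! ### The solution classes -/

/-- `V(r) sin(η x₃)`. -/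
def psiSin (V : ℝ → ℝ) (η : ℝ) (x : Fin 3 → ℝ) : ℝ := V (cylRadius x) * Real.sin (η * x 2)

/-- `V(r) cos(η x₃)`. -/
def psiCos (V : ℝ → ℝ) (η : ℝ) (x : Fin 3 → ℝ) : ℝ := V (cylRadius x) * Real.cos (η * x 2)

/-- `lam (A × ∇) Ψ + {(A × ∇) × ∇} Ψ`. -/
def eulerField (A : Fin 3 → ℝ) (lam : ℝ) (Ψ : (Fin 3 → ℝ) → ℝ) (x : Fin 3 → ℝ) : Fin 3 → ℝ :=
  lam • crossGrad A Ψ x + crossGradCross A Ψ x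

/-- `lam e^{-ν lam² t} (A × ∇) Ψ + e^{-ν lam² t} {(A × ∇) × ∇} Ψ`. -/
def nsField (ν : ℝ) (A : Fin 3 → ℝ) (lam : ℝ) (Ψ : (Fin 3 → ℝ) → ℝ) (t : ℝ) (x : Fin 3 → ℝ) :
    Fin 3 → ℝ :=
  (lam * Real.exp (-ν * lam ^ 2 * t)) • crossGrad A Ψ x
    + Real.exp (-ν * lam ^ 2 * t) • crossGradCross A Ψ x

/-- The linear space `Z^e_{jη}`, for `V = V_j` and `lam = λ_j`. -/
def eulerSpace (A : Fin 3 → ℝ) (V : ℝ → ℝ) (lam η : ℝ) :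
    Submodule ℝ ((Fin 3 → ℝ) → Fin 3 → ℝ) :=
  Submodule.span ℝ {eulerField A lam (psiSin V η), eulerField A lam (psiCos V η)}

/-- The linear space `Z^{ns}_{jη}`, for `V = V_j` and `lam = λ_j`. -/
def nsSpace (ν : ℝ) (A : Fin 3 → ℝ) (V : ℝ → ℝ) (lam η : ℝ) :
    Submodule ℝ (ℝ → (Fin 3 → ℝ) → Fin 3 → ℝ) :=
  Submodule.span ℝ {nsField ν A lam (psiSin V η), nsField ν A lam (psiCos V η)}

/-- The class `Z_E`, the union of all `Z^e_{jη}`; `lam j η` is the number `λ_j` belonging to `η`. -/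
def eulerClass (A : Fin 3 → ℝ) (V : ℕ → ℝ → ℝ) (lam : ℕ → ℝ → ℝ) :
    Set ((Fin 3 → ℝ) → Fin 3 → ℝ) :=
  ⋃ j : ℕ, ⋃ η : ℝ, (eulerSpace A (V j) (lam j η) η : Set ((Fin 3 → ℝ) → Fin 3 → ℝ))

/-- The class `Z_NS`, the union of all `Z^{ns}_{jη}`. -/
def nsClass (ν : ℝ) (A : Fin 3 → ℝ) (V : ℕ → ℝ → ℝ) (lam : ℕ → ℝ → ℝ) :
    Set (ℝ → (Fin 3 → ℝ) → Fin 3 → ℝ) :=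
  ⋃ j : ℕ, ⋃ η : ℝ, (nsSpace ν A (V j) (lam j η) η : Set (ℝ → (Fin 3 → ℝ) → Fin 3 → ℝ))

end

end AnnulusFlow

open AnnulusFlow

/-! With `t = log (r / R₁)` the operator `r d/dr` becomes `d/dt`, and the equation becomes `v'' = -μ
q v` with `q = r²`. Its solutions are power series in `-μ`, jointly continuous in `(μ, t)` and
smooth in `t`. The Wronskian of two solutions is constant, so a solution is determined by its data
at `R₁`; hence multiplicities are at most two.

Spectrum: both kinds of boundary condition cancel the boundary terms in Lagrange's identity.
Eigenvalues are therefore real, and eigenfunctions of different eigenvalues are orthogonal with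
weight `r`. An energy estimate bounds the eigenvalues below (`exists_lower_bound`), and compactness
of normalized data together with orthogonality excludes accumulation points
(`finite_eigenvalues_Icc`). For `μ = k²` the vector `v' + i k v` turns with angular speed at least
`k * min 1 q`, so its end position meets every direction for arbitrarily large `k`
(`exists_end_direction`). For separated conditions this already gives eigenvalues. For coupled ones
it gives parameters where the monodromy matrix is triangular with trace at least `2`, and others
with trace at most `-2`; in between the trace equals `2`, and then `1` is an eigenvalue of that
matrix. A locally finite unbounded set with finite multiplicities can be listed in order, and
orthogonality makes the listed eigenfunctions independent.

Regularity: `V r = h (r ^ 2)` on `[R₁, R₂]` with `h` smooth and compactly supported, so radial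
functions extend smoothly to the whole space. Under the Dirichlet condition cut-offs of `h` near the
end points converge in `H¹`.

Fluids: if `-ΔΨ = λ²Ψ` and `w = A × ∇Ψ`, then `U = λ w - curl w` satisfies `div U = 0` and `curl U =
-λ U`. For such a Beltrami field the convection term is the gradient of `|U|² / 2`, and the factor
`exp (-ν λ² t)` balances viscosity. The Beltrami equation is linear for fixed `λ`, so linear
combinations are covered. -/

/-! ### The equation `v'' = -μ q v` on the line -/

namespace LinearODE

noncomputable section

/-- Coefficients of the expansion in powers of `-μ` of the solution of `v'' = -μ q v` with
`v(0) = c₀`, `v'(0) = c₁`. -/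
def coeff (q : ℝ → ℝ) (c₀ c₁ : ℝ) : ℕ → ℝ → ℝ
  | 0, t => c₀ + c₁ * t
  | n + 1, t => ∫ s in (0 : ℝ)..t, ∫ u in (0 : ℝ)..s, q u * coeff q c₀ c₁ n u

/-- The derivatives of the coefficients `coeff`. -/
def coeffDeriv (q : ℝ → ℝ) (c₀ c₁ : ℝ) : ℕ → ℝ → ℝ
  | 0, _ => c₁
  | n + 1, t => ∫ u in (0 : ℝ)..t, q u * coeff q c₀ c₁ n u

variable {q : ℝ → ℝ} {c₀ c₁ : ℝ}

theorem continuous_coeff (hq : Continuous q) (n : ℕ) : Continuous (coeff q c₀ c₁ n) := by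
  induction n with
  | zero => exact continuous_const.add (continuous_const.mul continuous_id)
  | succ n ih =>
    have h1 : Continuous fun s : ℝ => ∫ u in (0 : ℝ)..s, q u * coeff q c₀ c₁ n u :=
      intervalIntegral.continuous_primitive (fun a b => (hq.mul ih).intervalIntegrable a b) 0
    exact intervalIntegral.continuous_primitive (fun a b => h1.intervalIntegrable a b) 0

theorem continuous_coeffDeriv (hq : Continuous q) (n : ℕ) :
    Continuous (coeffDeriv q c₀ c₁ n) := by
  cases n with
  | zero => exact continuous_const
  | succ n =>
    exact intervalIntegral.continuous_primitive
      (fun a b => (hq.mul (continuous_coeff hq n)).intervalIntegrable a b) 0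

theorem hasDerivAt_coeff (hq : Continuous q) (n : ℕ) (t : ℝ) :
    HasDerivAt (coeff q c₀ c₁ n) (coeffDeriv q c₀ c₁ n t) t := by
  cases n with
  | zero =>
    have := ((hasDerivAt_id t).const_mul c₁).const_add c₀
    simpa [coeff, coeffDeriv] using this
  | succ n =>
    exact intervalIntegral.integral_hasDerivAt_right
      ((continuous_coeffDeriv (c₀ := c₀) (c₁ := c₁) hq (n + 1)).intervalIntegrable _ _)
      ((continuous_coeffDeriv hq (n + 1)).stronglyMeasurableAtFilter _ _)
      (continuous_coeffDeriv hq (n + 1)).continuousAt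

/-- The second derivatives of the coefficients `coeff`. -/
def coeffDeriv₂ (q : ℝ → ℝ) (c₀ c₁ : ℝ) : ℕ → ℝ → ℝ
  | 0, _ => 0
  | n + 1, t => q t * coeff q c₀ c₁ n t

theorem hasDerivAt_coeffDeriv (hq : Continuous q) (n : ℕ) (t : ℝ) :
    HasDerivAt (coeffDeriv q c₀ c₁ n) (coeffDeriv₂ q c₀ c₁ n t) t := by
  cases n with
  | zero => exact hasDerivAt_const t c₁
  | succ n =>
    have h : Continuous fun u => q u * coeff q c₀ c₁ n u := hq.mul (continuous_coeff hq n)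
    exact intervalIntegral.integral_hasDerivAt_right (h.intervalIntegrable _ _)
      (h.stronglyMeasurableAtFilter _ _) h.continuousAt

theorem abs_integral_le_of_abs_le_pow {f : ℝ → ℝ} {B : ℝ} {n : ℕ} {t : ℝ}
    (hf : ∀ u, |u| ≤ |t| → |f u| ≤ B * |u| ^ n) :
    |∫ u in (0 : ℝ)..t, f u| ≤ B * |t| ^ (n + 1) / (n + 1) := by
  have hcont : Continuous fun u : ℝ => B * |u| ^ n := by fun_prop
  have h1 : ‖∫ u in (0 : ℝ)..t, f u‖ ≤ |∫ u in (0 : ℝ)..t, B * |u| ^ n| := by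
    refine intervalIntegral.norm_integral_le_abs_of_norm_le ?_ (hcont.intervalIntegrable _ _)
    refine (ae_restrict_iff' measurableSet_uIoc).2 (ae_of_all _ fun u hu => hf u ?_)
    simp only [uIoc, mem_Ioc] at hu
    rcases le_total 0 t with h | h
    · rw [min_eq_left h, max_eq_right h] at hu
      rw [abs_of_pos hu.1, abs_of_nonneg h]; exact hu.2
    · rw [min_eq_right h, max_eq_left h] at hu
      rw [abs_of_nonpos hu.2, abs_of_nonpos h]; linarith [hu.1]
  have hB : ∀ u, |u| ≤ |t| → 0 ≤ B * |u| ^ n := fun u hu => (abs_nonneg _).trans (hf u hu)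
  have h2 : |∫ u in (0 : ℝ)..t, B * |u| ^ n| = B * |t| ^ (n + 1) / (n + 1) := by
    have h3 := integral_pow_abs_sub_uIoc (a := 0) (b := t) (n := n)
    simp only [sub_zero] at h3
    rw [intervalIntegral.abs_intervalIntegral_eq, integral_const_mul, h3, abs_of_nonneg, mul_div_assoc]
    have h4 := hB t le_rfl
    rw [show B * (|t| ^ (n + 1) / (n + 1)) = (B * |t| ^ n) * (|t| / (n + 1)) by ring]
    positivity
  exact h1.trans_eq h2

theorem abs_coeffDeriv_succ_le_aux {T Q C : ℝ} (hQ0 : 0 ≤ Q)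
    (hQ : ∀ u, |u| ≤ T → |q u| ≤ Q) {n : ℕ}
    (ih : ∀ t, |t| ≤ T → |coeff q c₀ c₁ n t| ≤ C * (Q * T) ^ n / n.factorial * |t| ^ n)
    {t : ℝ} (ht : |t| ≤ T) :
    |coeffDeriv q c₀ c₁ (n + 1) t| ≤
      C * Q * (Q * T) ^ n / (n + 1).factorial * |t| ^ (n + 1) := by
  have h := abs_integral_le_of_abs_le_pow (f := fun u => q u * coeff q c₀ c₁ n u)
    (B := Q * (C * (Q * T) ^ n / n.factorial)) (n := n) (t := t) (fun u hu => by
      rw [abs_mul, mul_assoc]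
      exact mul_le_mul (hQ u (hu.trans ht)) (ih u (hu.trans ht)) (abs_nonneg _) hQ0)
  refine h.trans_eq ?_
  rw [Nat.factorial_succ]
  push_cast
  field_simp

/-- Each coefficient is a double integral of the previous one. The inner integration supplies the
next factor of the factorial; of the outer one only the crude `|t| / (n + 2) ≤ T` is kept, which
still leaves an exponential majorant. -/
theorem abs_coeff_le_aux {T Q C : ℝ} (hT : 1 ≤ T) (hQ0 : 0 ≤ Q)
    (hQ : ∀ u, |u| ≤ T → |q u| ≤ Q) (hC : |c₀| + |c₁| * T ≤ C) (n : ℕ) : ∀ t, |t| ≤ T →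
    |coeff q c₀ c₁ n t| ≤ C * (Q * T) ^ n / n.factorial * |t| ^ n := by
  have hC0 : 0 ≤ C := le_trans (by positivity) hC
  induction n with
  | zero =>
    intro t ht
    simp only [coeff, pow_zero, Nat.factorial_zero, Nat.cast_one, div_one, mul_one]
    calc |c₀ + c₁ * t| ≤ |c₀| + |c₁| * |t| := by rw [← abs_mul]; exact abs_add_le _ _
      _ ≤ |c₀| + |c₁| * T := by gcongr
      _ ≤ C := hC
  | succ n ih =>
    intro t ht
    have h := abs_integral_le_of_abs_le_pow (f := coeffDeriv q c₀ c₁ (n + 1))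
      (B := C * Q * (Q * T) ^ n / (n + 1).factorial) (n := n + 1) (t := t) (fun u hu =>
        abs_coeffDeriv_succ_le_aux hQ0 hQ ih (hu.trans ht))
    refine h.trans ?_
    rw [pow_succ |t| (n + 1)]
    have h2 : |t| / ((n + 1 : ℕ) + 1 : ℝ) ≤ T := by
      rw [div_le_iff₀ (by positivity)]
      push_cast
      nlinarith [abs_nonneg t]
    calc C * Q * (Q * T) ^ n / (n + 1).factorial * (|t| ^ (n + 1) * |t|) / ((n + 1 : ℕ) + 1)
        = C * Q * (Q * T) ^ n / (n + 1).factorial * |t| ^ (n + 1) * (|t| / ((n + 1 : ℕ) + 1)) := by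
          ring
      _ ≤ C * Q * (Q * T) ^ n / (n + 1).factorial * |t| ^ (n + 1) * T := by gcongr
      _ = _ := by ring

theorem abs_coeff_le {T Q C : ℝ} (hT : 1 ≤ T) (hQ0 : 0 ≤ Q)
    (hQ : ∀ u, |u| ≤ T → |q u| ≤ Q) (hC : |c₀| + |c₁| * T ≤ C) (n : ℕ) {t : ℝ} (ht : |t| ≤ T) :
    |coeff q c₀ c₁ n t| ≤ C * ((Q * T ^ 2) ^ n / n.factorial) := by
  have hC0 : 0 ≤ C := le_trans (by positivity) hC
  refine (abs_coeff_le_aux hT hQ0 hQ hC n t ht).trans ?_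
  calc C * (Q * T) ^ n / n.factorial * |t| ^ n ≤ C * (Q * T) ^ n / n.factorial * T ^ n := by gcongr
    _ = _ := by ring

theorem abs_coeffDeriv_le {T Q C : ℝ} (hT : 1 ≤ T) (hQ0 : 0 ≤ Q)
    (hQ : ∀ u, |u| ≤ T → |q u| ≤ Q) (hC : |c₀| + |c₁| * T ≤ C) (n : ℕ) {t : ℝ} (ht : |t| ≤ T) :
    |coeffDeriv q c₀ c₁ n t| ≤ C * ((Q * T ^ 2) ^ n / n.factorial) := by
  have hC0 : 0 ≤ C := le_trans (by positivity) hC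
  cases n with
  | zero =>
    simp only [coeffDeriv, pow_zero, Nat.factorial_zero, Nat.cast_one, div_one, mul_one]
    nlinarith [abs_nonneg c₀, abs_nonneg c₁]
  | succ n =>
    refine (abs_coeffDeriv_succ_le_aux hQ0 hQ
      (abs_coeff_le_aux hT hQ0 hQ hC n) ht).trans ?_
    calc C * Q * (Q * T) ^ n / (n + 1).factorial * |t| ^ (n + 1)
        ≤ C * Q * (Q * T) ^ n / (n + 1).factorial * T ^ (n + 1) := by gcongr
      _ ≤ C * Q * (Q * T) ^ n / (n + 1).factorial * T ^ (n + 1) * T := by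
          refine le_mul_of_one_le_right (by positivity) hT
      _ = _ := by ring

/-- The solution of `v'' = -μ q v` with `v(0) = c₀`, `v'(0) = c₁`. -/
def sol (q : ℝ → ℝ) (c₀ c₁ μ t : ℝ) : ℝ := ∑' n, (-μ) ^ n * coeff q c₀ c₁ n t

/-- The derivative of `sol`. -/
def solDeriv (q : ℝ → ℝ) (c₀ c₁ μ t : ℝ) : ℝ := ∑' n, (-μ) ^ n * coeffDeriv q c₀ c₁ n t

theorem exists_bounds (hq : Continuous q) (c₀ c₁ T₀ : ℝ) : ∃ T Q C : ℝ, T₀ < T ∧ 1 ≤ T ∧ 0 ≤ Q ∧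
    (∀ u, |u| ≤ T → |q u| ≤ Q) ∧ |c₀| + |c₁| * T ≤ C := by
  obtain ⟨Q, hQ⟩ := (isCompact_Icc (a := -(|T₀| + 1)) (b := |T₀| + 1)).exists_bound_of_continuousOn
    hq.continuousOn
  refine ⟨|T₀| + 1, Q, _, by linarith [le_abs_self T₀], by linarith [abs_nonneg T₀], ?_,
    fun u hu => hQ u (abs_le.1 hu), le_rfl⟩
  exact (norm_nonneg _).trans (hQ 0 ⟨by linarith [abs_nonneg T₀], by linarith [abs_nonneg T₀]⟩)

theorem summable_bound (M K C : ℝ) : Summable fun n : ℕ => M ^ n * (C * (K ^ n / n.factorial)) := by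
  have := (Real.summable_pow_div_factorial (M * K)).mul_left C
  refine this.congr fun n => ?_
  rw [mul_pow]; ring

theorem abs_neg_pow_mul_le {μ M x b : ℝ} {n : ℕ} (hμ : |μ| ≤ M) (hx : |x| ≤ b) :
    ‖(-μ) ^ n * x‖ ≤ M ^ n * b := by
  rw [Real.norm_eq_abs, abs_mul, abs_pow, abs_neg]
  have : 0 ≤ M := (abs_nonneg _).trans hμ
  gcongr

theorem hasDerivAt_sol (hq : Continuous q) (c₀ c₁ μ t : ℝ) :
    HasDerivAt (sol q c₀ c₁ μ) (solDeriv q c₀ c₁ μ t) t := by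
  obtain ⟨T, Q, C, hT0, hT, hQ0, hQ, hC⟩ := exists_bounds hq c₀ c₁ |t|
  have hmem : ∀ u ∈ Ioo (-T) T, |u| ≤ T := fun u hu => (abs_lt.2 hu).le
  exact hasDerivAt_tsum_of_isPreconnected (summable_bound |μ| (Q * T ^ 2) C) isOpen_Ioo
    isPreconnected_Ioo (fun n u _ => (hasDerivAt_coeff hq n u).const_mul _)
    (fun n u hu => abs_neg_pow_mul_le le_rfl (abs_coeffDeriv_le hT hQ0 hQ hC n (hmem u hu)))
    (abs_lt.1 hT0) (Summable.of_norm_bounded (summable_bound |μ| (Q * T ^ 2) C)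
      (fun n => abs_neg_pow_mul_le le_rfl (abs_coeff_le hT hQ0 hQ hC n hT0.le))) (abs_lt.1 hT0)

/-- Differentiating twice termwise turns the coefficient of index `n + 1` into `q` times the one of
index `n`: the series reproduces itself, shifted by one, with the factor `-μ q`. -/
theorem hasDerivAt_solDeriv (hq : Continuous q) (c₀ c₁ μ t : ℝ) :
    HasDerivAt (solDeriv q c₀ c₁ μ) (-μ * q t * sol q c₀ c₁ μ t) t := by
  obtain ⟨T, Q, C, hT0, hT, hQ0, hQ, hC⟩ := exists_bounds hq c₀ c₁ |t|
  have hmem : ∀ u ∈ Ioo (-T) T, |u| ≤ T := fun u hu => (abs_lt.2 hu).le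
  have hs := summable_bound |μ| (Q * T ^ 2) C
  -- The first term is affine, so its second derivative and its majorant are zero; the others are
  -- `|μ| Q` times the shifted majorant.
  let b : ℕ → ℝ := fun n => Nat.casesOn n 0
    fun n => |μ| * Q * (|μ| ^ n * (C * ((Q * T ^ 2) ^ n / n.factorial)))
  have hb : Summable b := (summable_nat_add_iff 1).1 (hs.mul_left (|μ| * Q))
  have hbound : ∀ n, ∀ u ∈ Ioo (-T) T, ‖(-μ) ^ n * coeffDeriv₂ q c₀ c₁ n u‖ ≤ b n := by
    intro n u hu
    cases n with
    | zero => simp [coeffDeriv₂, b]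
    | succ n =>
      have h1 := abs_neg_pow_mul_le (n := n) le_rfl (μ := μ)
        (abs_coeff_le hT hQ0 hQ hC n (hmem u hu))
      simp only [coeffDeriv₂, b]
      rw [show (-μ) ^ (n + 1) * (q u * coeff q c₀ c₁ n u)
        = (-μ * q u) * ((-μ) ^ n * coeff q c₀ c₁ n u) by ring, norm_mul, norm_mul, norm_neg]
      refine mul_le_mul ?_ h1 (norm_nonneg _) (by positivity)
      exact mul_le_mul_of_nonneg_left (hQ u (hmem u hu)) (abs_nonneg _)
  have hd := hasDerivAt_tsum_of_isPreconnected hb isOpen_Ioo isPreconnected_Ioo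
    (fun n u _ => (hasDerivAt_coeffDeriv (c₀ := c₀) (c₁ := c₁) hq n u).const_mul ((-μ) ^ n))
    hbound (abs_lt.1 hT0) (Summable.of_norm_bounded hs
      (fun n => abs_neg_pow_mul_le le_rfl (abs_coeffDeriv_le hT hQ0 hQ hC n hT0.le)))
    (abs_lt.1 hT0)
  refine hd.congr_deriv ?_
  rw [Summable.tsum_eq_zero_add (Summable.of_norm_bounded hb fun n => hbound n t (abs_lt.1 hT0)),
    sol, ← tsum_mul_left]
  simp only [coeffDeriv₂, mul_zero, zero_add]
  refine tsum_congr fun n => by ring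

/-- The Weierstrass test applies on an open box around `(μ, t)`, with `|μ| + 1` bounding the
parameter. -/
theorem continuous_uncurry_of_bound {a : ℕ → ℝ → ℝ} (ha : ∀ n, Continuous (a n))
    (hbd : ∀ T₀, ∃ T K C : ℝ, T₀ < T ∧ ∀ n t, |t| ≤ T → |a n t| ≤ C * (K ^ n / n.factorial)) :
    Continuous fun p : ℝ × ℝ => ∑' n, (-p.1) ^ n * a n p.2 := by
  rw [continuous_iff_continuousAt]
  rintro ⟨μ, t⟩
  obtain ⟨T, K, C, hT, hb⟩ := hbd |t|
  have hopen : IsOpen {p : ℝ × ℝ | |p.1| < |μ| + 1 ∧ |p.2| < T} :=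
    (isOpen_lt (continuous_abs.comp continuous_fst) continuous_const).inter
      (isOpen_lt (continuous_abs.comp continuous_snd) continuous_const)
  have hc : ContinuousOn (fun p : ℝ × ℝ => ∑' n, (-p.1) ^ n * a n p.2)
      {p : ℝ × ℝ | |p.1| < |μ| + 1 ∧ |p.2| < T} := by
    refine continuousOn_tsum (fun n => ?_) (summable_bound (|μ| + 1) K C) ?_
    · have := ha n; fun_prop
    · rintro n ⟨m, s⟩ ⟨h1, h2⟩
      exact abs_neg_pow_mul_le h1.le (hb n s h2.le)
  exact hc.continuousAt (hopen.mem_nhds ⟨by linarith, hT⟩)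

theorem continuous_sol (hq : Continuous q) (c₀ c₁ : ℝ) :
    Continuous fun p : ℝ × ℝ => sol q c₀ c₁ p.1 p.2 := by
  refine continuous_uncurry_of_bound (continuous_coeff hq) fun T₀ => ?_
  obtain ⟨T, Q, C, hT0, hT, hQ0, hQ, hC⟩ := exists_bounds hq c₀ c₁ T₀
  exact ⟨T, Q * T ^ 2, C, hT0, fun n t ht => abs_coeff_le hT hQ0 hQ hC n ht⟩

theorem continuous_solDeriv (hq : Continuous q) (c₀ c₁ : ℝ) :
    Continuous fun p : ℝ × ℝ => solDeriv q c₀ c₁ p.1 p.2 := by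
  refine continuous_uncurry_of_bound (continuous_coeffDeriv hq) fun T₀ => ?_
  obtain ⟨T, Q, C, hT0, hT, hQ0, hQ, hC⟩ := exists_bounds hq c₀ c₁ T₀
  exact ⟨T, Q * T ^ 2, C, hT0, fun n t ht => abs_coeffDeriv_le hT hQ0 hQ hC n ht⟩

theorem sol_zero (q : ℝ → ℝ) (c₀ c₁ μ : ℝ) : sol q c₀ c₁ μ 0 = c₀ := by
  rw [sol, tsum_eq_single 0]
  · simp [coeff]
  · intro n hn
    obtain ⟨m, rfl⟩ := Nat.exists_eq_succ_of_ne_zero hn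
    simp [coeff]

theorem solDeriv_zero (q : ℝ → ℝ) (c₀ c₁ μ : ℝ) : solDeriv q c₀ c₁ μ 0 = c₁ := by
  rw [solDeriv, tsum_eq_single 0]
  · simp [coeffDeriv]
  · intro n hn
    obtain ⟨m, rfl⟩ := Nat.exists_eq_succ_of_ne_zero hn
    simp [coeffDeriv]

/-- `sol` and `solDeriv` are bootstrapped together, since the derivative of each is expressed by the
other. -/
theorem contDiff_sol (hq : ContDiff ℝ ∞ q) (c₀ c₁ μ : ℝ) : ContDiff ℝ ∞ (sol q c₀ c₁ μ) := by
  have hd1 : deriv (sol q c₀ c₁ μ) = solDeriv q c₀ c₁ μ :=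
    funext fun t => (hasDerivAt_sol hq.continuous c₀ c₁ μ t).deriv
  have hd2 : deriv (solDeriv q c₀ c₁ μ) = fun t => -μ * q t * sol q c₀ c₁ μ t :=
    funext fun t => (hasDerivAt_solDeriv hq.continuous c₀ c₁ μ t).deriv
  have hdiff1 : Differentiable ℝ (sol q c₀ c₁ μ) :=
    fun t => (hasDerivAt_sol hq.continuous c₀ c₁ μ t).differentiableAt
  have hdiff2 : Differentiable ℝ (solDeriv q c₀ c₁ μ) :=
    fun t => (hasDerivAt_solDeriv hq.continuous c₀ c₁ μ t).differentiableAt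
  have key : ∀ n : ℕ, ContDiff ℝ n (sol q c₀ c₁ μ) ∧ ContDiff ℝ n (solDeriv q c₀ c₁ μ) := by
    intro n
    induction n with
    | zero =>
      exact ⟨contDiff_zero.2 hdiff1.continuous, contDiff_zero.2 hdiff2.continuous⟩
    | succ n ih =>
      have hqn : ContDiff ℝ n q := hq.of_le (by exact_mod_cast le_top)
      push_cast
      refine ⟨contDiff_succ_iff_deriv.2 ⟨hdiff1, by simp, ?_⟩,
        contDiff_succ_iff_deriv.2 ⟨hdiff2, by simp, ?_⟩⟩
      · rw [hd1]; exact ih.2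
      · rw [hd2]; exact (contDiff_const.mul hqn).mul ih.1
  exact contDiff_infty.2 fun n => (key n).1

end

end LinearODE

/-! ### Wronskians, orthogonality and the dimension of eigenspaces -/

namespace AnnulusFlow

noncomputable section

/-- The first order system `V' = W / r`, `W' = -μ r V` on `[R₁, R₂]`. -/
def IsSLPair {𝕜 : Type} [RCLike 𝕜] (R₁ R₂ : ℝ) (μ : 𝕜) (V W : ℝ → 𝕜) : Prop :=
  ∀ r ∈ Icc R₁ R₂, HasDerivWithinAt V (W r / (r : 𝕜)) (Icc R₁ R₂) r ∧
    HasDerivWithinAt W (-(μ * (r : 𝕜) * V r)) (Icc R₁ R₂) r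

section generic

variable {𝕜 : Type} [RCLike 𝕜] {R₁ R₂ : ℝ} {μ lam : 𝕜} {V W V' W' : ℝ → 𝕜}

theorem IsSLSolution.isSLPair {bc : BoundaryCondition} (hR₁ : 0 < R₁)
    (h : IsSLSolution R₁ R₂ bc μ V) : IsSLPair R₁ R₂ μ V (quasiDeriv R₁ R₂ V) := by
  intro r hr
  have hr0 : (r : 𝕜) ≠ 0 := by exact_mod_cast (hR₁.trans_le hr.1).ne'
  constructor
  · have h1 := (h.differentiableOn r hr).hasDerivWithinAt
    rwa [quasiDeriv, mul_div_cancel_left₀ _ hr0]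
  · have h1 := (h.differentiableOn_quasiDeriv r hr).hasDerivWithinAt
    rwa [← h.equation r hr, neg_neg]

theorem IsSLPair.continuousOn_left (h : IsSLPair R₁ R₂ μ V W) : ContinuousOn V (Icc R₁ R₂) :=
  fun r hr => (h r hr).1.continuousWithinAt

theorem IsSLPair.continuousOn_right (h : IsSLPair R₁ R₂ μ V W) : ContinuousOn W (Icc R₁ R₂) :=
  fun r hr => (h r hr).2.continuousWithinAt

theorem IsSLPair.star (h : IsSLPair R₁ R₂ μ V W) :
    IsSLPair R₁ R₂ (starRingEnd 𝕜 μ) (fun r => starRingEnd 𝕜 (V r))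
      (fun r => starRingEnd 𝕜 (W r)) := by
  intro r hr
  have h1 := (h r hr).1.star
  have h2 := (h r hr).2.star
  constructor
  · refine h1.congr_deriv ?_
    simp [RCLike.star_def]
  · refine h2.congr_deriv ?_
    simp [RCLike.star_def, mul_comm, mul_left_comm]

/-- Lagrange's identity: the two terms `W W' / r` cancel. -/
theorem IsSLPair.hasDerivWithinAt_wronskian (h : IsSLPair R₁ R₂ μ V W)
    (h' : IsSLPair R₁ R₂ lam V' W') {r : ℝ} (hr : r ∈ Icc R₁ R₂) :
    HasDerivWithinAt (fun s => V s * W' s - W s * V' s)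
      ((μ - lam) * ((r : 𝕜) * (V r * V' r))) (Icc R₁ R₂) r := by
  have := ((h r hr).1.mul (h' r hr).2).sub ((h r hr).2.mul (h' r hr).1)
  refine this.congr_deriv ?_
  ring

theorem integral_eq_sub_of_hasDerivWithinAt_Icc {f f' : ℝ → 𝕜} (hR : R₁ ≤ R₂)
    (hf : ∀ r ∈ Icc R₁ R₂, HasDerivWithinAt f (f' r) (Icc R₁ R₂) r)
    (hf' : ContinuousOn f' (Icc R₁ R₂)) : ∫ r in R₁..R₂, f' r = f R₂ - f R₁ :=
  intervalIntegral.integral_eq_sub_of_hasDerivAt_of_le hR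
    (fun r hr => (hf r hr).continuousWithinAt)
    (fun r hr => (hf r (Ioo_subset_Icc_self hr)).hasDerivAt (Icc_mem_nhds hr.1 hr.2))
    (hf'.intervalIntegrable_of_Icc hR)

theorem IsSLPair.integral_mul (hR : R₁ ≤ R₂) (h : IsSLPair R₁ R₂ μ V W)
    (h' : IsSLPair R₁ R₂ lam V' W') :
    (μ - lam) * ∫ r in R₁..R₂, (r : 𝕜) * (V r * V' r)
      = (V R₂ * W' R₂ - W R₂ * V' R₂) - (V R₁ * W' R₁ - W R₁ * V' R₁) := by
  rw [← intervalIntegral.integral_const_mul]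
  refine integral_eq_sub_of_hasDerivWithinAt_Icc (f := fun s => V s * W' s - W s * V' s) hR
    (fun r hr => h.hasDerivWithinAt_wronskian h' hr) ?_
  have hc : ContinuousOn (fun r : ℝ => (r : 𝕜)) (Icc R₁ R₂) :=
    RCLike.continuous_ofReal.continuousOn
  exact continuousOn_const.mul (hc.mul (h.continuousOn_left.mul h'.continuousOn_left))

/-- The Wronskian is the area form on boundary data. A matrix of determinant one preserves it; a
separated condition confines both vectors to one line at each end, where the form vanishes. -/
theorem BoundaryCondition.Holds.wronskian_eq {bc : BoundaryCondition} {Y₁ Y₂ Z₁ Z₂ : Fin 2 → 𝕜}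
    (hY : bc.Holds Y₁ Y₂) (hZ : bc.Holds Z₁ Z₂) :
    Y₁ 0 * Z₁ 1 - Y₁ 1 * Z₁ 0 = Y₂ 0 * Z₂ 1 - Y₂ 1 * Z₂ 0 := by
  cases bc with
  | separated a b c d h1 h2 =>
    obtain ⟨hY1, hY2⟩ := hY
    obtain ⟨hZ1, hZ2⟩ := hZ
    have key : ∀ (a b : ℝ) (x y z w : 𝕜), (a, b) ≠ (0, 0) → (a : 𝕜) * x + (b : 𝕜) * y = 0 →
        (a : 𝕜) * z + (b : 𝕜) * w = 0 → x * w - y * z = 0 := by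
      intro a b x y z w hab hxy hzw
      by_cases ha : a = 0
      · have hb : (b : 𝕜) ≠ 0 := by
          intro hb; exact hab (by rw [ha, RCLike.ofReal_eq_zero.1 hb])
        apply mul_left_cancel₀ hb
        linear_combination x * hzw - z * hxy
      · have ha : (a : 𝕜) ≠ 0 := by exact_mod_cast ha
        apply mul_left_cancel₀ ha
        linear_combination w * hxy - y * hzw
    rw [key a b _ _ _ _ h1 hY1 hZ1, key c d _ _ _ _ h2 hY2 hZ2]
  | coupled K =>
    have hdet : (K.1 0 0 : 𝕜) * K.1 1 1 - (K.1 0 1 : 𝕜) * K.1 1 0 = 1 := by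
      have := K.2
      rw [Matrix.det_fin_two] at this
      exact_mod_cast this
    simp only [BoundaryCondition.Holds] at hY hZ
    rw [hY, hZ]
    simp only [Matrix.mulVec, dotProduct, Fin.sum_univ_two, Matrix.map_apply]
    linear_combination (Y₂ 0 * Z₂ 1 - Y₂ 1 * Z₂ 0) * hdet

theorem BoundaryCondition.Holds.star {bc : BoundaryCondition} {Y₁ Y₂ : Fin 2 → 𝕜}
    (hY : bc.Holds Y₁ Y₂) :
    bc.Holds (fun i => starRingEnd 𝕜 (Y₁ i)) (fun i => starRingEnd 𝕜 (Y₂ i)) := by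
  cases bc with
  | separated a b c d h1 h2 =>
    obtain ⟨hY1, hY2⟩ := hY
    have h1 := congrArg (starRingEnd 𝕜) hY1
    have h2 := congrArg (starRingEnd 𝕜) hY2
    simp only [map_add, map_mul, RCLike.conj_ofReal, map_zero] at h1 h2
    exact ⟨h1, h2⟩
  | coupled K =>
    simp only [BoundaryCondition.Holds] at hY ⊢
    funext i
    rw [hY]
    simp [Matrix.mulVec, dotProduct, Fin.sum_univ_two, Matrix.map_apply]

/-- The boundary coefficients are real, so conjugating `V'` keeps the boundary condition, and the
boundary terms of Lagrange's identity cancel. Taking `V' = V` gives reality of eigenvalues; distinct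
real eigenvalues give orthogonality with weight `r`. -/
theorem IsSLSolution.integral_mul_star {bc : BoundaryCondition} (hR₁ : 0 < R₁) (hR : R₁ < R₂)
    (hV : IsSLSolution R₁ R₂ bc μ V) (hV' : IsSLSolution R₁ R₂ bc lam V') :
    (μ - starRingEnd 𝕜 lam) * ∫ r in R₁..R₂, (r : 𝕜) * (V r * starRingEnd 𝕜 (V' r)) = 0 := by
  rw [(hV.isSLPair hR₁).integral_mul hR.le (hV'.isSLPair hR₁).star]
  have := hV.boundary.wronskian_eq hV'.boundary.star
  simp only [bdryData, Matrix.cons_val_zero, Matrix.cons_val_one] at this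
  rw [this, sub_self]

theorem IsSLSolution.eq_zero_of_integral {bc : BoundaryCondition} (hR₁ : 0 < R₁) (hR : R₁ < R₂)
    (hV : IsSLSolution R₁ R₂ bc μ V)
    (h : ∫ r in R₁..R₂, (r : 𝕜) * (V r * starRingEnd 𝕜 (V r)) = 0) : V = 0 := by
  have hc := (hV.isSLPair hR₁).continuousOn_left
  have h1 : ∫ r in R₁..R₂, (r : 𝕜) * (V r * starRingEnd 𝕜 (V r))
      = ((∫ r in R₁..R₂, r * ‖V r‖ ^ 2 : ℝ) : 𝕜) := by
    rw [← RCLike.intervalIntegral_ofReal]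
    refine intervalIntegral.integral_congr fun r _ => ?_
    simp only [RCLike.mul_conj]
    push_cast
    rfl
  rw [h1, RCLike.ofReal_eq_zero] at h
  by_contra hne
  obtain ⟨r, hr⟩ : ∃ r, V r ≠ 0 := by
    by_contra hcon
    push Not at hcon
    exact hne (funext hcon)
  have hrm : r ∈ Icc R₁ R₂ := by
    by_contra hcon
    exact hr (hV.eq_zero_outside r hcon)
  refine (intervalIntegral.integral_pos hR (f := fun r => r * ‖V r‖ ^ 2)
    (continuousOn_id.mul (hc.norm.pow 2)) (fun x hx => ?_) ⟨r, hrm, ?_⟩).ne' h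
  · have : 0 < x := hR₁.trans hx.1
    positivity
  · have : 0 < r := hR₁.trans_le hrm.1
    positivity

theorem eigenvalue_im_eq_zero {bc : BoundaryCondition} (hR₁ : 0 < R₁) (hR : R₁ < R₂) {μ : ℂ}
    (h : eigenspace R₁ R₂ hR bc μ ≠ ⊥) : μ.im = 0 := by
  obtain ⟨V, hV, hne⟩ := Submodule.exists_mem_ne_zero_of_ne_bot h
  have hV : IsSLSolution R₁ R₂ bc μ V := hV
  rcases mul_eq_zero.1 (hV.integral_mul_star hR₁ hR hV) with h1 | h1
  · exact Complex.conj_eq_iff_im.1 (sub_eq_zero.1 h1).symm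
  · exact absurd (hV.eq_zero_of_integral hR₁ hR h1) hne

end generic

/-! ### Fundamental solutions -/

/-- The weight `r²` in the variable `t = log (r / R₁)`. -/
def logWeight (R₁ t : ℝ) : ℝ := R₁ ^ 2 * Real.exp (2 * t)

theorem contDiff_logWeight (R₁ : ℝ) : ContDiff ℝ ∞ (logWeight R₁) := by
  unfold logWeight; fun_prop

/-- The solution of `-(r V')' = μ r V` with `V(R₁) = c₀`, `(r V')(R₁) = c₁`. -/
def radSol (R₁ c₀ c₁ μ r : ℝ) : ℝ := LinearODE.sol (logWeight R₁) c₀ c₁ μ (Real.log (r / R₁))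

/-- The quasi-derivative of `radSol`. -/
def radSolDeriv (R₁ c₀ c₁ μ r : ℝ) : ℝ :=
  LinearODE.solDeriv (logWeight R₁) c₀ c₁ μ (Real.log (r / R₁))

variable {R₁ R₂ : ℝ}

theorem hasDerivAt_log_div (hR₁ : 0 < R₁) {r : ℝ} (hr : 0 < r) :
    HasDerivAt (fun s => Real.log (s / R₁)) r⁻¹ r := by
  have := ((hasDerivAt_id r).div_const R₁).log (by simp only [id]; positivity)
  refine this.congr_deriv ?_
  simp only [id]
  field_simp

theorem hasDerivAt_radSol (hR₁ : 0 < R₁) (c₀ c₁ μ : ℝ) {r : ℝ} (hr : 0 < r) :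
    HasDerivAt (radSol R₁ c₀ c₁ μ) (radSolDeriv R₁ c₀ c₁ μ r / r) r :=
  (LinearODE.hasDerivAt_sol (contDiff_logWeight R₁).continuous c₀ c₁ μ _).comp r
    (hasDerivAt_log_div hR₁ hr)

theorem logWeight_log (hR₁ : 0 < R₁) {r : ℝ} (hr : 0 < r) :
    logWeight R₁ (Real.log (r / R₁)) = r ^ 2 := by
  have h : Real.exp (2 * Real.log (r / R₁)) = (r / R₁) ^ 2 := by
    rw [two_mul, Real.exp_add, Real.exp_log (by positivity)]; ring
  rw [logWeight, h]
  field_simp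

theorem hasDerivAt_radSolDeriv (hR₁ : 0 < R₁) (c₀ c₁ μ : ℝ) {r : ℝ} (hr : 0 < r) :
    HasDerivAt (radSolDeriv R₁ c₀ c₁ μ) (-(μ * r * radSol R₁ c₀ c₁ μ r)) r := by
  have := (LinearODE.hasDerivAt_solDeriv (contDiff_logWeight R₁).continuous c₀ c₁ μ
    (Real.log (r / R₁))).comp r (hasDerivAt_log_div hR₁ hr)
  refine this.congr_deriv ?_
  rw [logWeight_log hR₁ hr, radSol]
  field_simp

theorem isSLPair_radSol (hR₁ : 0 < R₁) (c₀ c₁ μ : ℝ) :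
    IsSLPair R₁ R₂ μ (radSol R₁ c₀ c₁ μ) (radSolDeriv R₁ c₀ c₁ μ) := fun _ hr =>
  ⟨(hasDerivAt_radSol hR₁ c₀ c₁ μ (hR₁.trans_le hr.1)).hasDerivWithinAt,
    (hasDerivAt_radSolDeriv hR₁ c₀ c₁ μ (hR₁.trans_le hr.1)).hasDerivWithinAt⟩

theorem radSol_left (hR₁ : 0 < R₁) (c₀ c₁ μ : ℝ) : radSol R₁ c₀ c₁ μ R₁ = c₀ := by
  rw [radSol, div_self hR₁.ne', Real.log_one, LinearODE.sol_zero]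

theorem radSolDeriv_left (hR₁ : 0 < R₁) (c₀ c₁ μ : ℝ) : radSolDeriv R₁ c₀ c₁ μ R₁ = c₁ := by
  rw [radSolDeriv, div_self hR₁.ne', Real.log_one, LinearODE.solDeriv_zero]

theorem IsSLPair.wronskian_eq_left {μ : ℝ} {V W V' W' : ℝ → ℝ} (h : IsSLPair R₁ R₂ μ V W)
    (h' : IsSLPair R₁ R₂ μ V' W') {r : ℝ} (hr : r ∈ Icc R₁ R₂) :
    V r * W' r - W r * V' r = V R₁ * W' R₁ - W R₁ * V' R₁ := by
  refine constant_of_derivWithin_zero (f := fun s => V s * W' s - W s * V' s)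
    (fun s hs => (h.hasDerivWithinAt_wronskian h' hs).differentiableWithinAt) (fun s hs => ?_) r hr
  have hlt : R₁ < R₂ := hs.1.trans_lt hs.2
  rw [(h.hasDerivWithinAt_wronskian h' (Ico_subset_Icc_self hs)).derivWithin
    (uniqueDiffOn_Icc hlt s (Ico_subset_Icc_self hs))]
  simp

theorem radSol_wronskian (hR₁ : 0 < R₁) (μ : ℝ) {r : ℝ} (hr : R₁ ≤ r) :
    radSol R₁ 1 0 μ r * radSolDeriv R₁ 0 1 μ r - radSolDeriv R₁ 1 0 μ r * radSol R₁ 0 1 μ r = 1 := by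
  rw [(isSLPair_radSol (R₂ := r) hR₁ 1 0 μ).wronskian_eq_left (isSLPair_radSol hR₁ 0 1 μ)
    (right_mem_Icc.2 hr)]
  simp [radSol_left hR₁, radSolDeriv_left hR₁]

/-- The constant Wronskians with the two fundamental solutions are linear equations for `V r` and `W
r` of determinant one, solved by Cramer's rule. This serves as uniqueness for the initial value
problem. -/
theorem IsSLPair.eq_radSol {μ : ℝ} {V W : ℝ → ℝ} (hR₁ : 0 < R₁) (h : IsSLPair R₁ R₂ μ V W)
    {r : ℝ} (hr : r ∈ Icc R₁ R₂) :
    V r = V R₁ * radSol R₁ 1 0 μ r + W R₁ * radSol R₁ 0 1 μ r ∧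
    W r = V R₁ * radSolDeriv R₁ 1 0 μ r + W R₁ * radSolDeriv R₁ 0 1 μ r := by
  have h1 := h.wronskian_eq_left (isSLPair_radSol hR₁ 1 0 μ) hr
  have h2 := h.wronskian_eq_left (isSLPair_radSol hR₁ 0 1 μ) hr
  have h3 := radSol_wronskian hR₁ μ hr.1
  simp only [radSol_left hR₁, radSolDeriv_left hR₁] at h1 h2
  constructor
  · linear_combination (-V r) * h3 + radSol R₁ 1 0 μ r * h2 - radSol R₁ 0 1 μ r * h1
  · linear_combination (-W r) * h3 + radSolDeriv R₁ 1 0 μ r * h2 - radSolDeriv R₁ 0 1 μ r * h1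

theorem IsSLSolution.eq_radSol {bc : BoundaryCondition} {μ : ℝ} {V : ℝ → ℝ} (hR₁ : 0 < R₁)
    (h : IsSLSolution R₁ R₂ bc μ V) {r : ℝ} (hr : r ∈ Icc R₁ R₂) :
    V r = V R₁ * radSol R₁ 1 0 μ r + quasiDeriv R₁ R₂ V R₁ * radSol R₁ 0 1 μ r :=
  ((h.isSLPair hR₁).eq_radSol hR₁ hr).1

theorem IsSLSolution.eq_zero {bc : BoundaryCondition} {μ : ℝ} {V : ℝ → ℝ} (hR₁ : 0 < R₁)
    (h : IsSLSolution R₁ R₂ bc μ V) (h0 : V R₁ = 0) (h1 : quasiDeriv R₁ R₂ V R₁ = 0) : V = 0 := by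
  funext r
  by_cases hr : r ∈ Icc R₁ R₂
  · rw [h.eq_radSol hR₁ hr, h0, h1]; simp
  · exact h.eq_zero_outside r hr

/-- The indicator is the extension by zero that `IsSLSolution` demands; derivatives are taken within
`[R₁, R₂]`, so the jumps at the end points are harmless. -/
theorem IsSLPair.indicator_mem_eigenspace {bc : BoundaryCondition} {μ : ℝ} {V W : ℝ → ℝ}
    (hR₁ : 0 < R₁) (hR : R₁ < R₂) (h : IsSLPair R₁ R₂ μ V W)
    (hbc : bc.Holds ![V R₁, W R₁] ![V R₂, W R₂]) :
    (Icc R₁ R₂).indicator V ∈ eigenspace R₁ R₂ hR bc μ := by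
  have hE : EqOn ((Icc R₁ R₂).indicator V) V (Icc R₁ R₂) := fun r hr => indicator_of_mem hr V
  have hd : ∀ r ∈ Icc R₁ R₂, HasDerivWithinAt ((Icc R₁ R₂).indicator V) (W r / r) (Icc R₁ R₂) r :=
    fun r hr => (h r hr).1.congr hE (hE hr)
  have hu := uniqueDiffOn_Icc hR
  have hq : EqOn (quasiDeriv R₁ R₂ ((Icc R₁ R₂).indicator V)) W (Icc R₁ R₂) := by
    intro r hr
    have hr0 : r ≠ 0 := (hR₁.trans_le hr.1).ne'
    rw [quasiDeriv, (hd r hr).derivWithin (hu r hr)]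
    simp only [RCLike.ofReal_real_eq_id, id]
    field_simp
  have hqd : ∀ r ∈ Icc R₁ R₂, HasDerivWithinAt (quasiDeriv R₁ R₂ ((Icc R₁ R₂).indicator V))
      (-(μ * r * V r)) (Icc R₁ R₂) r := fun r hr => (h r hr).2.congr hq (hq hr)
  refine ⟨fun r hr => indicator_of_notMem hr V, fun r hr => (hd r hr).differentiableWithinAt,
    fun r hr => (hqd r hr).differentiableWithinAt, fun r hr => ?_, ?_⟩
  · rw [(hqd r hr).derivWithin (hu r hr), hE hr]
    simp
  · have h1 := left_mem_Icc.2 hR.le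
    have h2 := right_mem_Icc.2 hR.le
    simpa only [bdryData, hE h1, hE h2, hq h1, hq h2] using hbc

/-- `μ` is an eigenvalue if some non-zero initial data give a solution with the boundary
condition. -/
theorem eigenspace_ne_bot {bc : BoundaryCondition} {μ c₀ c₁ : ℝ} (hR₁ : 0 < R₁) (hR : R₁ < R₂)
    (hc : c₀ ≠ 0 ∨ c₁ ≠ 0)
    (hbc : bc.Holds ![c₀, c₁] ![radSol R₁ c₀ c₁ μ R₂, radSolDeriv R₁ c₀ c₁ μ R₂]) :
    eigenspace R₁ R₂ hR bc μ ≠ ⊥ := by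
  intro hbot
  have hpair := isSLPair_radSol (R₂ := R₂) hR₁ c₀ c₁ μ
  have hmem := hpair.indicator_mem_eigenspace (bc := bc) hR₁ hR
    (by rwa [radSol_left hR₁, radSolDeriv_left hR₁])
  rw [hbot, Submodule.mem_bot] at hmem
  have hV : ∀ r ∈ Icc R₁ R₂, radSol R₁ c₀ c₁ μ r = 0 := fun r hr => by
    have := congrFun hmem r
    rwa [indicator_of_mem hr] at this
  have h1 := left_mem_Icc.2 hR.le
  rcases hc with hc | hc
  · exact hc (by rw [← radSol_left hR₁ c₀ c₁ μ]; exact hV _ h1)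
  -- A solution vanishing on the interval has one-sided derivative zero at `R₁`, but that derivative
  -- is `c₁ / R₁`.
  · have hz : HasDerivWithinAt (radSol R₁ c₀ c₁ μ) 0 (Icc R₁ R₂) R₁ :=
      (hasDerivWithinAt_const R₁ _ (0 : ℝ)).congr hV (hV _ h1)
    have he := (uniqueDiffOn_Icc hR R₁ h1).eq_deriv _ (hpair R₁ h1).1 hz
    rw [radSolDeriv_left hR₁] at he
    simp only [RCLike.ofReal_real_eq_id, id, div_eq_zero_iff, hR₁.ne', or_false] at he
    exact hc he

/-- The boundary data at `R₁` as a linear map on the eigenspace. -/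
def leftData (hR : R₁ < R₂) (bc : BoundaryCondition) (μ : ℝ) :
    eigenspace R₁ R₂ hR bc μ →ₗ[ℝ] ℝ × ℝ where
  toFun V := (V.1 R₁, quasiDeriv R₁ R₂ V.1 R₁)
  map_add' V W := by
    ext
    · rfl
    · exact quasiDeriv_add V.2.differentiableOn W.2.differentiableOn (left_mem_Icc.2 hR.le)
  map_smul' c V := by
    ext
    · rfl
    · exact quasiDeriv_smul c R₁

/-- The eigenspace embeds in the plane of initial data, whence finite dimension and multiplicity at
most two. -/
theorem leftData_injective (hR₁ : 0 < R₁) (hR : R₁ < R₂) (bc : BoundaryCondition) (μ : ℝ) :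
    Function.Injective (leftData hR bc μ) := by
  refine (injective_iff_map_eq_zero _).2 fun V hV => ?_
  have h1 := congrArg Prod.fst hV
  have h2 := congrArg Prod.snd hV
  exact Subtype.ext (IsSLSolution.eq_zero hR₁ V.2 h1 h2)

theorem finiteDimensional_eigenspace (hR₁ : 0 < R₁) (hR : R₁ < R₂) (bc : BoundaryCondition)
    (μ : ℝ) : FiniteDimensional ℝ (eigenspace R₁ R₂ hR bc μ) :=
  FiniteDimensional.of_injective _ (leftData_injective hR₁ hR bc μ)

theorem finrank_eigenspace_le (hR₁ : 0 < R₁) (hR : R₁ < R₂) (bc : BoundaryCondition) (μ : ℝ) :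
    Module.finrank ℝ (eigenspace R₁ R₂ hR bc μ) ≤ 2 := by
  have := LinearMap.finrank_le_finrank_of_injective (leftData_injective hR₁ hR bc μ)
  simpa using this

theorem finrank_eigenspace_pos (hR₁ : 0 < R₁) (hR : R₁ < R₂) {bc : BoundaryCondition} {μ : ℝ}
    (h : eigenspace R₁ R₂ hR bc μ ≠ ⊥) : 0 < Module.finrank ℝ (eigenspace R₁ R₂ hR bc μ) := by
  have := finiteDimensional_eigenspace hR₁ hR bc μ
  have := Submodule.nontrivial_iff_ne_bot.2 h
  exact Module.finrank_pos

/-! ### Eigenvalues are bounded below and locally finite -/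

/-- The left side is the boundary term of the energy identity. Either boundary condition turns it
into a quadratic form in the two end values of `V` alone. -/
theorem BoundaryCondition.exists_form_bound (bc : BoundaryCondition) :
    ∃ C : ℝ, ∀ Y₁ Y₂ : Fin 2 → ℝ, bc.Holds Y₁ Y₂ →
      Y₂ 0 * Y₂ 1 - Y₁ 0 * Y₁ 1 ≤ C * (Y₁ 0 ^ 2 + Y₂ 0 ^ 2) := by
  cases bc with
  | separated a b c d h1 h2 =>
    -- If `b = 0` the condition forces `x = 0`, so the value of `a / 0` does not matter.
    have key : ∀ (a b x y : ℝ), (a, b) ≠ (0, 0) → a * x + b * y = 0 →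
        x * y = -(a / b) * x ^ 2 := by
      intro a b x y hab h
      by_cases hb : b = 0
      · have ha : a ≠ 0 := fun ha => hab (by rw [ha, hb])
        have hx : x = 0 := by
          subst hb
          simpa [ha] using h
        simp [hx]
      · have hy : y = -(a / b) * x := by
          field_simp
          linear_combination h
        rw [hy]; ring
    refine ⟨|a / b| + |c / d|, fun Y₁ Y₂ hY => ?_⟩
    obtain ⟨hY1, hY2⟩ := hY
    rw [key a b _ _ h1 hY1, key c d _ _ h2 hY2]
    nlinarith [mul_nonneg (abs_nonneg (a / b)) (sq_nonneg (Y₂ 0)),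
      mul_nonneg (abs_nonneg (c / d)) (sq_nonneg (Y₁ 0)),
      mul_nonneg (sub_nonneg.2 (le_abs_self (a / b))) (sq_nonneg (Y₁ 0)),
      mul_nonneg (sub_nonneg.2 (neg_abs_le (c / d))) (sq_nonneg (Y₂ 0))]
  | coupled K =>
    have hdet := K.2
    rw [Matrix.det_fin_two] at hdet
    obtain ⟨a, ha⟩ : ∃ a, K.1 0 0 = a := ⟨_, rfl⟩
    obtain ⟨b, hb⟩ : ∃ b, K.1 0 1 = b := ⟨_, rfl⟩
    obtain ⟨c, hc⟩ : ∃ c, K.1 1 0 = c := ⟨_, rfl⟩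
    obtain ⟨d, hd⟩ : ∃ d, K.1 1 1 = d := ⟨_, rfl⟩
    rw [ha, hb, hc, hd] at hdet
    have hform : ∀ Y₁ Y₂ : Fin 2 → ℝ, (BoundaryCondition.coupled K).Holds Y₁ Y₂ →
        Y₁ 0 = a * Y₂ 0 + b * Y₂ 1 ∧ Y₁ 1 = c * Y₂ 0 + d * Y₂ 1 := by
      intro Y₁ Y₂ h
      simp only [BoundaryCondition.Holds] at h
      rw [h]
      simp [Matrix.mulVec, dotProduct, Fin.sum_univ_two, Matrix.map_apply, ha, hb, hc, hd]
    -- For `b = 0` one has `a d = 1`, and the products `Y₂ 0 * Y₂ 1` cancel. For `b ≠ 0` the first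
    -- row yields `Y₂ 1`, and then the second yields `Y₁ 1`, from the end values.
    by_cases hb0 : b = 0
    · refine ⟨|a * c|, fun Y₁ Y₂ hY => ?_⟩
      obtain ⟨h0, h1⟩ := hform _ _ hY
      have : Y₂ 0 * Y₂ 1 - Y₁ 0 * Y₁ 1 = -(a * c) * Y₂ 0 ^ 2 := by
        rw [h0, h1]
        subst hb0
        linear_combination (-(Y₂ 0 * Y₂ 1)) * hdet
      rw [this]
      nlinarith [mul_nonneg (abs_nonneg (a * c)) (sq_nonneg (Y₁ 0)),
        mul_nonneg (sub_nonneg.2 (neg_abs_le (a * c))) (sq_nonneg (Y₂ 0))]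
    · refine ⟨|1 / b| + |a / b| + |d / b|, fun Y₁ Y₂ hY => ?_⟩
      obtain ⟨h0, h1⟩ := hform _ _ hY
      have : Y₂ 0 * Y₂ 1 - Y₁ 0 * Y₁ 1
          = 2 * (1 / b) * (Y₁ 0 * Y₂ 0) - (a / b) * Y₂ 0 ^ 2 - (d / b) * Y₁ 0 ^ 2 := by
        have h2 : Y₂ 1 = (Y₁ 0 - a * Y₂ 0) / b := by
          rw [h0]; field_simp; ring
        rw [h1, h2]
        field_simp
        linear_combination Y₁ 0 * Y₂ 0 * hdet
      rw [this]
      have e1 : 2 * (1 / b) * (Y₁ 0 * Y₂ 0) ≤ |1 / b| * (Y₁ 0 ^ 2 + Y₂ 0 ^ 2) := by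
        refine (le_abs_self _).trans ?_
        rw [mul_comm 2, mul_assoc, abs_mul]
        refine mul_le_mul_of_nonneg_left ?_ (abs_nonneg _)
        rw [abs_le]
        constructor <;> nlinarith [sq_nonneg (Y₁ 0 + Y₂ 0), sq_nonneg (Y₁ 0 - Y₂ 0)]
      nlinarith [mul_nonneg (abs_nonneg (a / b)) (sq_nonneg (Y₁ 0)),
        mul_nonneg (abs_nonneg (d / b)) (sq_nonneg (Y₂ 0)),
        mul_nonneg (sub_nonneg.2 (neg_abs_le (a / b))) (sq_nonneg (Y₂ 0)),
        mul_nonneg (sub_nonneg.2 (neg_abs_le (d / b))) (sq_nonneg (Y₁ 0))]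

/-- Let `ell` be affine from `-1` to `1`. By the form bound, `V W - C ell V²` does not increase from
`R₁` to `R₂`. Completing the square in `W` shows that its derivative is at least `V²` as soon as `μ
R₁ < -(2|C| / D + C² / R₁ + 1)`, so for such `μ` only `V = 0` remains. -/
theorem exists_lower_bound (hR₁ : 0 < R₁) (hR : R₁ < R₂) (bc : BoundaryCondition) :
    ∃ M : ℝ, ∀ μ : ℝ, eigenspace R₁ R₂ hR bc μ ≠ ⊥ → M ≤ μ := by
  obtain ⟨C, hC⟩ := bc.exists_form_bound
  set D := R₂ - R₁ with hD
  have hD0 : 0 < D := sub_pos.2 hR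
  refine ⟨-(2 * |C| / D + C ^ 2 / R₁ + 1) / R₁, fun μ hμ => ?_⟩
  by_contra hlt
  rw [not_le, lt_div_iff₀ hR₁] at hlt
  obtain ⟨V, hV, hne⟩ := Submodule.exists_mem_ne_zero_of_ne_bot hμ
  have hV : IsSLSolution R₁ R₂ bc μ V := hV
  have hp := hV.isSLPair hR₁
  set W := quasiDeriv R₁ R₂ V with hW
  have hp' : ∀ r ∈ Icc R₁ R₂, HasDerivWithinAt V (W r / r) (Icc R₁ R₂) r ∧
    HasDerivWithinAt W (-(μ * r * V r)) (Icc R₁ R₂) r := hp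
  have hbd := hC _ _ hV.boundary
  simp only [bdryData, Matrix.cons_val_zero, Matrix.cons_val_one, ← hW] at hbd
  have hcV := hp.continuousOn_left
  have hcW := hp.continuousOn_right
  let ell : ℝ → ℝ := fun r => (2 * r - R₁ - R₂) / D
  let G' : ℝ → ℝ := fun r => (W r / r * W r + V r * (-(μ * r * V r)))
    - C * (2 / D * V r ^ 2 + ell r * (2 * V r * (W r / r)))
  have hG : ∀ r ∈ Icc R₁ R₂, HasDerivWithinAt (fun r => V r * W r - C * (ell r * V r ^ 2))
      (G' r) (Icc R₁ R₂) r := by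
    intro r hr
    obtain ⟨h1, h2⟩ := hp' r hr
    have h3 : HasDerivWithinAt ell (2 / D) (Icc R₁ R₂) r := by
      have := (((hasDerivAt_id r).const_mul 2).sub_const R₁).sub_const R₂ |>.div_const D
      exact (this.congr_deriv (by simp)).hasDerivWithinAt
    refine ((h1.mul h2).sub ((h3.mul (h1.pow 2)).const_mul C)).congr_deriv ?_
    simp only [G']
    norm_num
  have hinv : ContinuousOn (fun r : ℝ => r⁻¹) (Icc R₁ R₂) :=
    continuousOn_inv₀.mono fun r hr => (hR₁.trans_le hr.1).ne'
  have hG'c : ContinuousOn G' (Icc R₁ R₂) := by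
    simp only [G', ell, div_eq_mul_inv (W _)]
    fun_prop
  have hlow : ∀ r ∈ Icc R₁ R₂, V r ^ 2 ≤ G' r := by
    intro r hr
    have hr0 : 0 < r := hR₁.trans_le hr.1
    have hell : ell r ^ 2 ≤ 1 := by
      rw [sq_le_one_iff_abs_le_one, abs_le]
      simp only [ell]
      rw [le_div_iff₀ hD0, div_le_iff₀ hD0]
      constructor <;> linarith [hr.1, hr.2]
    have e1 : G' r = (W r - C * ell r * V r) ^ 2 / r + V r ^ 2 * (-(μ * r) - 2 * C / D
        - C ^ 2 * ell r ^ 2 / r) := by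
      simp only [G']
      field_simp
      ring
    have e2 : C ^ 2 * ell r ^ 2 / r ≤ C ^ 2 / R₁ := by
      calc C ^ 2 * ell r ^ 2 / r ≤ C ^ 2 * 1 / R₁ := by
            gcongr
            exact hr.1
        _ = _ := by ring
    have e3 : 2 * C / D ≤ 2 * |C| / D := by gcongr; exact le_abs_self C
    have e4 : μ * r ≤ μ * R₁ := by
      have : μ ≤ 0 := by
        have : 0 ≤ 2 * |C| / D + C ^ 2 / R₁ + 1 := by positivity
        by_contra hcon
        nlinarith [mul_pos (not_le.1 hcon) hR₁]
      nlinarith [hr.1]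
    have e5 : 1 ≤ -(μ * r) - 2 * C / D - C ^ 2 * ell r ^ 2 / r := by linarith
    have e6 : 0 ≤ (W r - C * ell r * V r) ^ 2 / r := by positivity
    rw [e1]
    nlinarith [sq_nonneg (V r)]
  have hint := integral_eq_sub_of_hasDerivWithinAt_Icc hR.le hG hG'c
  have hl1 : ell R₁ = -1 := by simp only [ell]; field_simp; ring
  have hl2 : ell R₂ = 1 := by simp only [ell]; field_simp; ring
  obtain ⟨r, hr⟩ : ∃ r, V r ≠ 0 := by
    by_contra hcon
    push Not at hcon
    exact hne (funext hcon)
  have hrm : r ∈ Icc R₁ R₂ := by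
    by_contra hcon
    exact hr (hV.eq_zero_outside r hcon)
  have hpos : 0 < ∫ r in R₁..R₂, G' r :=
    intervalIntegral.integral_pos hR hG'c
      (fun x hx => (sq_nonneg _).trans (hlow x (Ioc_subset_Icc_self hx)))
      ⟨r, hrm, (by positivity : 0 < V r ^ 2).trans_le (hlow r hrm)⟩
  rw [hint] at hpos
  simp only [hl1, hl2] at hpos
  linarith

end

end AnnulusFlow

/-! ### Discreteness of the spectrum by compactness -/

namespace AnnulusFlow

noncomputable section

variable {R₁ R₂ : ℝ}

/-- The solution with parameter `p.1` and initial data `p.2`, continued by a constant to the left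
of `R₁`. -/
def dataSol (R₁ : ℝ) (p : ℝ × ℝ × ℝ) (r : ℝ) : ℝ :=
  p.2.1 * radSol R₁ 1 0 p.1 (max r R₁) + p.2.2 * radSol R₁ 0 1 p.1 (max r R₁)

/-- The maximum keeps the argument of the logarithm positive, so continuity holds on the whole
plane. -/
theorem continuous_radSol_max (hR₁ : 0 < R₁) (c₀ c₁ : ℝ) :
    Continuous fun x : ℝ × ℝ => radSol R₁ c₀ c₁ x.1 (max x.2 R₁) := by
  have h : Continuous fun x : ℝ × ℝ => Real.log (max x.2 R₁ / R₁) := by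
    refine Continuous.log (by fun_prop) fun x => ?_
    have : 0 < max x.2 R₁ := lt_max_of_lt_right hR₁
    positivity
  exact (LinearODE.continuous_sol (contDiff_logWeight R₁).continuous c₀ c₁).comp
    (continuous_fst.prodMk h)

theorem continuous_dataSol (hR₁ : 0 < R₁) :
    Continuous fun x : (ℝ × ℝ × ℝ) × ℝ => dataSol R₁ x.1 x.2 := by
  unfold dataSol
  have h : ∀ c₀ c₁ : ℝ, Continuous fun x : (ℝ × ℝ × ℝ) × ℝ =>
      radSol R₁ c₀ c₁ x.1.1 (max x.2 R₁) := fun c₀ c₁ =>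
    (continuous_radSol_max hR₁ c₀ c₁).comp (f := fun x : (ℝ × ℝ × ℝ) × ℝ => (x.1.1, x.2))
      (by fun_prop)
  exact (continuous_snd.fst.comp continuous_fst |>.mul (h 1 0)).add
    ((continuous_snd.snd.comp continuous_fst).mul (h 0 1))

theorem exists_normalized_solution (hR₁ : 0 < R₁) (hR : R₁ < R₂) {bc : BoundaryCondition} {μ : ℝ}
    (h : eigenspace R₁ R₂ hR bc μ ≠ ⊥) : ∃ c : ℝ × ℝ, ‖c‖ = 1 ∧ ∃ V : ℝ → ℝ,
      IsSLSolution R₁ R₂ bc μ V ∧ ∀ r ∈ Icc R₁ R₂, V r = dataSol R₁ (μ, c) r := by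
  obtain ⟨V, hV, hne⟩ := Submodule.exists_mem_ne_zero_of_ne_bot h
  have hd : leftData hR bc μ ⟨V, hV⟩ ≠ 0 := by
    rw [Ne, map_eq_zero_iff _ (leftData_injective hR₁ hR bc μ)]
    exact fun h => hne (congrArg Subtype.val h)
  let V' : eigenspace R₁ R₂ hR bc μ := ‖leftData hR bc μ ⟨V, hV⟩‖⁻¹ • ⟨V, hV⟩
  refine ⟨leftData hR bc μ V', ?_, V'.1, V'.2, fun r hr => ?_⟩
  · rw [map_smul, norm_smul, norm_inv, norm_norm, inv_mul_cancel₀ (norm_ne_zero_iff.2 hd)]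
  · have hs : IsSLSolution R₁ R₂ bc μ V'.1 := V'.2
    rw [hs.eq_radSol hR₁ hr, dataSol, max_eq_left hr.1]
    rfl

/-- Infinitely many eigenvalues in `[a, b]`, paired with initial data of norm one, accumulate at
some `p` in a compact set. The weighted inner product `B` of the generated solutions is continuous
and positive at `(p, p)`, hence positive for two nearby distinct eigenvalues, against orthogonality.
-/
theorem finite_eigenvalues_Icc (hR₁ : 0 < R₁) (hR : R₁ < R₂) (bc : BoundaryCondition) (a b : ℝ) :
    {μ : ℝ | μ ∈ Icc a b ∧ eigenspace R₁ R₂ hR bc μ ≠ ⊥}.Finite := by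
  by_contra hinf
  set S := {μ : ℝ | μ ∈ Icc a b ∧ eigenspace R₁ R₂ hR bc μ ≠ ⊥} with hS
  have hch : ∀ μ : ℝ, ∃ c : ℝ × ℝ, μ ∈ S → ‖c‖ = 1 ∧ ∃ V : ℝ → ℝ,
      IsSLSolution R₁ R₂ bc μ V ∧ ∀ r ∈ Icc R₁ R₂, V r = dataSol R₁ (μ, c) r := by
    intro μ
    by_cases hμ : μ ∈ S
    · obtain ⟨c, hc⟩ := exists_normalized_solution hR₁ hR hμ.2
      exact ⟨c, fun _ => hc⟩
    · exact ⟨0, fun h => absurd h hμ⟩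
  choose g hg using hch
  have hPinf : ((fun μ => (μ, g μ)) '' S).Infinite := by
    refine (infinite_image_iff ?_).2 hinf
    intro x _ y _ hxy
    exact congrArg Prod.fst hxy
  have hcomp : IsCompact (Icc a b ×ˢ Metric.sphere (0 : ℝ × ℝ) 1) :=
    isCompact_Icc.prod (isCompact_sphere _ _)
  obtain ⟨p, hp, hacc⟩ := hPinf.exists_accPt_of_subset_isCompact hcomp (by
    rintro _ ⟨μ, hμ, rfl⟩
    exact ⟨hμ.1, by simpa using (hg μ hμ).1⟩)
  let B : (ℝ × ℝ × ℝ) × (ℝ × ℝ × ℝ) → ℝ := fun x =>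
    ∫ r in R₁..R₂, r * (dataSol R₁ x.1 r * dataSol R₁ x.2 r)
  have hBc : Continuous B := by
    refine intervalIntegral.continuous_parametric_intervalIntegral_of_continuous'
      (f := fun (x : (ℝ × ℝ × ℝ) × (ℝ × ℝ × ℝ)) r => r * (dataSol R₁ x.1 r * dataSol R₁ x.2 r)) ?_
      R₁ R₂
    refine continuous_snd.mul (Continuous.mul ?_ ?_)
    · exact (continuous_dataSol hR₁).comp
        (f := fun x : ((ℝ × ℝ × ℝ) × (ℝ × ℝ × ℝ)) × ℝ => (x.1.1, x.2)) (by fun_prop)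
    · exact (continuous_dataSol hR₁).comp
        (f := fun x : ((ℝ × ℝ × ℝ) × (ℝ × ℝ × ℝ)) × ℝ => (x.1.2, x.2)) (by fun_prop)
  -- The limit data still have norm one, so they generate a non-zero solution. Whether `p` satisfies
  -- the boundary condition is irrelevant.
  have hBpos : 0 < B (p, p) := by
    have hc1 : Continuous fun r => dataSol R₁ p r :=
      (continuous_dataSol hR₁).comp (continuous_const.prodMk continuous_id)
    have hnn : ∀ r ∈ Icc R₁ R₂, 0 ≤ r * (dataSol R₁ p r * dataSol R₁ p r) := fun r hr =>
      mul_nonneg (hR₁.le.trans hr.1) (mul_self_nonneg _)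
    refine intervalIntegral.integral_pos hR (by fun_prop)
      (fun r hr => hnn r (Ioc_subset_Icc_self hr)) ?_
    by_contra hcon
    push Not at hcon
    have hz : ∀ r ∈ Icc R₁ R₂, dataSol R₁ p r = 0 := fun r hr => by
      have h1 := le_antisymm (hcon r hr) (hnn r hr)
      rcases mul_eq_zero.1 h1 with h2 | h2
      · exact absurd h2 (hR₁.trans_le hr.1).ne'
      · exact mul_self_eq_zero.1 h2
    have h1 := left_mem_Icc.2 hR.le
    have hd : HasDerivWithinAt (fun r => p.2.1 * radSol R₁ 1 0 p.1 r + p.2.2 * radSol R₁ 0 1 p.1 r)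
        (p.2.1 * (radSolDeriv R₁ 1 0 p.1 R₁ / R₁) + p.2.2 * (radSolDeriv R₁ 0 1 p.1 R₁ / R₁))
        (Icc R₁ R₂) R₁ :=
      (((hasDerivAt_radSol hR₁ 1 0 p.1 hR₁).const_mul _).add
        ((hasDerivAt_radSol hR₁ 0 1 p.1 hR₁).const_mul _)).hasDerivWithinAt
    have heq : ∀ r ∈ Icc R₁ R₂,
        p.2.1 * radSol R₁ 1 0 p.1 r + p.2.2 * radSol R₁ 0 1 p.1 r = 0 := fun r hr => by
      have := hz r hr
      rwa [dataSol, max_eq_left hr.1] at this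
    have hd0 := (hasDerivWithinAt_const R₁ (Icc R₁ R₂) (0 : ℝ)).congr heq (heq _ h1)
    have e1 := (uniqueDiffOn_Icc hR R₁ h1).eq_deriv _ hd hd0
    have e2 := heq R₁ h1
    simp only [radSol_left hR₁, radSolDeriv_left hR₁, mul_one, mul_zero, add_zero, zero_div,
      zero_add, mul_eq_zero, div_eq_zero_iff, one_ne_zero, hR₁.ne', or_false] at e1 e2
    have h3 : ‖p.2‖ = 1 := by simpa using hp.2
    have h4 : p.2 = 0 := Prod.ext e2 e1
    rw [h4, norm_zero] at h3
    exact zero_ne_one h3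
  have hnhds : {x | 0 < B x} ∈ 𝓝 (p, p) :=
    (isOpen_lt continuous_const hBc).mem_nhds hBpos
  rw [nhds_prod_eq, mem_prod_same_iff] at hnhds
  obtain ⟨U, hU, hUB⟩ := hnhds
  rw [accPt_iff_nhds] at hacc
  obtain ⟨x, ⟨hxU, μ, hμ, rfl⟩, hxp⟩ := hacc U hU
  -- Removing the first point from the neighbourhood gives a second one. Both lie on the graph of
  -- `g`, so distinct points have distinct eigenvalues.
  obtain ⟨y, ⟨⟨hyU, hyx⟩, lam, hlam, rfl⟩, -⟩ := hacc (U ∩ {(μ, g μ)}ᶜ)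
    (inter_mem hU (isOpen_compl_singleton.mem_nhds (Ne.symm hxp)))
  have hne : μ ≠ lam := by
    rintro rfl
    exact hyx rfl
  have hB : 0 < B ((μ, g μ), (lam, g lam)) := hUB (mk_mem_prod hxU hyU)
  obtain ⟨V, hV, hVe⟩ := (hg μ hμ).2
  obtain ⟨V', hV', hVe'⟩ := (hg lam hlam).2
  have horth := hV.integral_mul_star hR₁ hR hV'
  rcases mul_eq_zero.1 horth with h | h
  · exact hne (sub_eq_zero.1 h)
  · refine hB.ne' ?_
    rw [← h]
    refine intervalIntegral.integral_congr fun r hr => ?_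
    rw [uIcc_of_le hR.le] at hr
    simp only [← hVe r hr, ← hVe' r hr]
    simp

theorem finite_nonpos_eigenvalues (hR₁ : 0 < R₁) (hR : R₁ < R₂) (bc : BoundaryCondition) :
    {μ : ℝ | μ ≤ 0 ∧ eigenspace R₁ R₂ hR bc μ ≠ ⊥}.Finite := by
  obtain ⟨M, hM⟩ := exists_lower_bound hR₁ hR bc
  exact (finite_eigenvalues_Icc hR₁ hR bc M 0).subset fun μ hμ => ⟨⟨hM μ hμ.2, hμ.1⟩, hμ.2⟩

/-! ### Rotation of solutions for large eigenvalue parameter -/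

/-- `z` times the exponential of minus the integral has derivative zero. The imaginary part of the
integral measures the change of argument without a choice of branch. -/
theorem eq_mul_exp_integral {z z' : ℝ → ℂ} (hz : ∀ t, HasDerivAt z (z' t) t)
    (hz' : Continuous z') (hne : ∀ t, z t ≠ 0) (t : ℝ) :
    z t = z 0 * Complex.exp (∫ s in (0 : ℝ)..t, z' s / z s) := by
  have hc : Continuous fun s => z' s / z s :=
    hz'.div (continuous_iff_continuousAt.2 fun t => (hz t).continuousAt) hne
  have hI : ∀ t, HasDerivAt (fun t => ∫ s in (0 : ℝ)..t, z' s / z s) (z' t / z t) t := fun t =>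
    intervalIntegral.integral_hasDerivAt_right (hc.intervalIntegrable _ _)
      (hc.stronglyMeasurableAtFilter _ _) hc.continuousAt
  have hd : ∀ t, HasDerivAt (fun t => z t * Complex.exp (-∫ s in (0 : ℝ)..t, z' s / z s)) 0 t := by
    intro t
    refine ((hz t).mul (hI t).neg.cexp).congr_deriv ?_
    field_simp [hne t]
    ring
  have hconst := is_const_of_deriv_eq_zero (fun t => (hd t).differentiableAt)
    (fun t => (hd t).deriv) t 0
  simp only [intervalIntegral.integral_same, neg_zero, Complex.exp_zero, mul_one] at hconst
  rw [← hconst, mul_assoc, ← Complex.exp_add, neg_add_cancel, Complex.exp_zero, mul_one]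

theorem sol_wronskian {q : ℝ → ℝ} (hq : Continuous q) (c₀ c₁ d₀ d₁ μ t : ℝ) :
    LinearODE.sol q c₀ c₁ μ t * LinearODE.solDeriv q d₀ d₁ μ t
      - LinearODE.solDeriv q c₀ c₁ μ t * LinearODE.sol q d₀ d₁ μ t = c₀ * d₁ - c₁ * d₀ := by
  have hd : ∀ t, HasDerivAt (fun t => LinearODE.sol q c₀ c₁ μ t * LinearODE.solDeriv q d₀ d₁ μ t
      - LinearODE.solDeriv q c₀ c₁ μ t * LinearODE.sol q d₀ d₁ μ t) 0 t := by
    intro t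
    refine (((LinearODE.hasDerivAt_sol hq c₀ c₁ μ t).mul
      (LinearODE.hasDerivAt_solDeriv hq d₀ d₁ μ t)).sub
      ((LinearODE.hasDerivAt_solDeriv hq c₀ c₁ μ t).mul
      (LinearODE.hasDerivAt_sol hq d₀ d₁ μ t))).congr_deriv ?_
    ring
  have := is_const_of_deriv_eq_zero (fun t => (hd t).differentiableAt) (fun t => (hd t).deriv) t 0
  simpa only [LinearODE.sol_zero, LinearODE.solDeriv_zero] using this

theorem mem_slitPlane_of {x y : ℝ} (h : y ≠ 0 ∨ 0 < x) : (⟨x, y⟩ : ℂ) ∈ Complex.slitPlane := by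
  rw [Complex.mem_slitPlane_iff]
  exact h.symm

/-- The vector `v' + i k v` for the solution `v` with `μ = k²`, `k = exp κ`. -/
def phase (q : ℝ → ℝ) (c₀ c₁ κ t : ℝ) : ℂ :=
  ⟨LinearODE.solDeriv q c₀ c₁ (Real.exp κ ^ 2) t,
    Real.exp κ * LinearODE.sol q c₀ c₁ (Real.exp κ ^ 2) t⟩

/-- The derivative of `phase`. -/
def phaseDeriv (q : ℝ → ℝ) (c₀ c₁ κ t : ℝ) : ℂ :=
  ⟨-(Real.exp κ ^ 2) * q t * LinearODE.sol q c₀ c₁ (Real.exp κ ^ 2) t,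
    Real.exp κ * LinearODE.solDeriv q c₀ c₁ (Real.exp κ ^ 2) t⟩

theorem continuous_complex_mk {X : Type*} [TopologicalSpace X] {f g : X → ℝ} (hf : Continuous f)
    (hg : Continuous g) : Continuous fun x => (⟨f x, g x⟩ : ℂ) := by
  simp only [Complex.mk_eq_add_mul_I]
  fun_prop

theorem hasDerivAt_phase {q : ℝ → ℝ} (hq : Continuous q) (c₀ c₁ κ t : ℝ) :
    HasDerivAt (phase q c₀ c₁ κ) (phaseDeriv q c₀ c₁ κ t) t := by
  have h1 := (LinearODE.hasDerivAt_solDeriv hq c₀ c₁ (Real.exp κ ^ 2) t).ofReal_comp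
  have h2 := ((LinearODE.hasDerivAt_sol hq c₀ c₁ (Real.exp κ ^ 2) t).const_mul
    (Real.exp κ)).ofReal_comp
  have h3 := h1.add (h2.mul_const Complex.I)
  have e : phase q c₀ c₁ κ = fun t => ((LinearODE.solDeriv q c₀ c₁ (Real.exp κ ^ 2) t : ℝ) : ℂ)
      + ((Real.exp κ * LinearODE.sol q c₀ c₁ (Real.exp κ ^ 2) t : ℝ) : ℂ) * Complex.I := by
    funext t; rw [phase, Complex.mk_eq_add_mul_I]
  rw [e, phaseDeriv, Complex.mk_eq_add_mul_I]
  exact h3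

theorem continuous_phase {q : ℝ → ℝ} (hq : Continuous q) (c₀ c₁ : ℝ) :
    Continuous fun x : ℝ × ℝ => phase q c₀ c₁ x.1 x.2 := by
  have h1 := (LinearODE.continuous_sol hq c₀ c₁).comp
    (f := fun x : ℝ × ℝ => (Real.exp x.1 ^ 2, x.2)) (by fun_prop)
  have h2 := (LinearODE.continuous_solDeriv hq c₀ c₁).comp
    (f := fun x : ℝ × ℝ => (Real.exp x.1 ^ 2, x.2)) (by fun_prop)
  exact continuous_complex_mk h2 ((by fun_prop : Continuous fun x : ℝ × ℝ => Real.exp x.1).mul h1)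

theorem continuous_phaseDeriv {q : ℝ → ℝ} (hq : Continuous q) (c₀ c₁ : ℝ) :
    Continuous fun x : ℝ × ℝ => phaseDeriv q c₀ c₁ x.1 x.2 := by
  have h1 := (LinearODE.continuous_sol hq c₀ c₁).comp
    (f := fun x : ℝ × ℝ => (Real.exp x.1 ^ 2, x.2)) (by fun_prop)
  have h2 := (LinearODE.continuous_solDeriv hq c₀ c₁).comp
    (f := fun x : ℝ × ℝ => (Real.exp x.1 ^ 2, x.2)) (by fun_prop)
  exact continuous_complex_mk
    ((by fun_prop : Continuous fun x : ℝ × ℝ => -(Real.exp x.1 ^ 2) * q x.2).mul h1)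
    ((by fun_prop : Continuous fun x : ℝ × ℝ => Real.exp x.1).mul h2)

theorem phase_ne_zero {q : ℝ → ℝ} (hq : Continuous q) {c₀ c₁ : ℝ} (hc : c₀ ≠ 0 ∨ c₁ ≠ 0)
    (κ t : ℝ) : phase q c₀ c₁ κ t ≠ 0 := by
  intro h
  have h1 := congrArg Complex.re h
  have h2 := congrArg Complex.im h
  have hk := (Real.exp_pos κ).ne'
  simp only [phase, Complex.zero_re, Complex.zero_im, mul_eq_zero, hk, false_or] at h1 h2
  -- The solution with rotated data `(-c₁, c₀)` has Wronskian `c₀² + c₁² > 0` with the given one, so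
  -- `v` and `v'` cannot vanish together.
  have hw := sol_wronskian hq c₀ c₁ (-c₁) c₀ (Real.exp κ ^ 2) t
  rw [h1, h2] at hw
  have : 0 < c₀ * c₀ + c₁ * c₁ := by
    rcases hc with h | h
    · nlinarith [mul_self_pos.2 h, mul_self_nonneg c₁]
    · nlinarith [mul_self_pos.2 h, mul_self_nonneg c₀]
  linarith

/-- With `k = exp κ` the angular speed is `k (v'² + q k² v²) / (v'² + k² v²)`, which is `k` times a
weighted mean of `1` and `q`. -/
theorem im_phaseDeriv_div_phase_ge {q : ℝ → ℝ} (hq : Continuous q) {c₀ c₁ m : ℝ}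
    (hc : c₀ ≠ 0 ∨ c₁ ≠ 0) (κ : ℝ) {t : ℝ} (hm1 : m ≤ 1) (hmq : m ≤ q t) :
    Real.exp κ * m ≤ (phaseDeriv q c₀ c₁ κ t / phase q c₀ c₁ κ t).im := by
  have hpos : 0 < Complex.normSq (phase q c₀ c₁ κ t) :=
    Complex.normSq_pos.2 (phase_ne_zero hq hc κ t)
  have hk := Real.exp_pos κ
  rw [Complex.div_im, ← sub_div, le_div_iff₀ hpos, Complex.normSq_apply]
  simp only [phase, phaseDeriv]
  generalize LinearODE.sol q c₀ c₁ (Real.exp κ ^ 2) t = v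
  generalize LinearODE.solDeriv q c₀ c₁ (Real.exp κ ^ 2) t = w
  generalize Real.exp κ = k at hk
  have h1 : 0 ≤ k * ((1 - m) * w ^ 2) :=
    mul_nonneg hk.le (mul_nonneg (by linarith) (sq_nonneg _))
  have h2 : 0 ≤ k * ((q t - m) * (k * v) ^ 2) :=
    mul_nonneg hk.le (mul_nonneg (by linarith) (sq_nonneg _))
  nlinarith

/-- For large `κ` the end vector `(v(ℓ), v'(ℓ))` points into every direction. -/
theorem exists_end_direction_aux {q : ℝ → ℝ} (hq : Continuous q) {m ℓ : ℝ} (hm : 0 < m)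
    (hm1 : m ≤ 1) (hℓ : 0 < ℓ) (hmq : ∀ t, 0 ≤ t → m ≤ q t) {c₀ c₁ p p' ε : ℝ}
    (hc : c₀ ≠ 0 ∨ 0 < c₁) (hp : p ≠ 0 ∨ 0 < p') (hε : ε = 1 ∨ ε = -1) (κ₀ : ℝ) :
    ∃ κ s : ℝ, κ₀ ≤ κ ∧ 0 < ε * s ∧ LinearODE.sol q c₀ c₁ (Real.exp κ ^ 2) ℓ = s * p' ∧
      LinearODE.solDeriv q c₀ c₁ (Real.exp κ ^ 2) ℓ = -(s * p) := by
  have hc' : c₀ ≠ 0 ∨ c₁ ≠ 0 := hc.imp id ne_of_gt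
  let I : ℝ → ℂ := fun κ => ∫ t in (0 : ℝ)..ℓ, phaseDeriv q c₀ c₁ κ t / phase q c₀ c₁ κ t
  have hquot : Continuous fun x : ℝ × ℝ => phaseDeriv q c₀ c₁ x.1 x.2 / phase q c₀ c₁ x.1 x.2 :=
    (continuous_phaseDeriv hq c₀ c₁).div (continuous_phase hq c₀ c₁)
      fun x => phase_ne_zero hq hc' x.1 x.2
  have hI : Continuous I :=
    intervalIntegral.continuous_parametric_intervalIntegral_of_continuous'
      (f := fun κ t => phaseDeriv q c₀ c₁ κ t / phase q c₀ c₁ κ t) hquot 0 ℓ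
  have hIm : ∀ κ, Real.exp κ * m * ℓ ≤ (I κ).im := by
    intro κ
    have hcont : Continuous fun t => phaseDeriv q c₀ c₁ κ t / phase q c₀ c₁ κ t :=
      hquot.comp (continuous_const.prodMk continuous_id)
    have e : (I κ).im = ∫ t in (0 : ℝ)..ℓ, (phaseDeriv q c₀ c₁ κ t / phase q c₀ c₁ κ t).im :=
      (Complex.imCLM.intervalIntegral_comp_comm (hcont.intervalIntegrable 0 ℓ)).symm
    have h := intervalIntegral.integral_mono_on (a := 0) (b := ℓ) hℓ.le
      (f := fun _ => Real.exp κ * m)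
      (g := fun t => (phaseDeriv q c₀ c₁ κ t / phase q c₀ c₁ κ t).im)
      (μ := volume) intervalIntegrable_const ((Complex.continuous_im.comp hcont).intervalIntegrable 0 ℓ)
      (fun t ht => im_phaseDeriv_div_phase_ge hq hc' κ hm1 (hmq t ht.1))
    rw [e]
    refine le_trans (le_of_eq ?_) h
    simp
    ring
  -- `z₀` is the phase at time `0`, and `d` is the target direction. The sign hypotheses keep both
  -- in the slit plane for every `κ`, so their principal logarithms depend continuously on `κ`.
  let z₀ : ℝ → ℂ := fun κ => ⟨c₁, Real.exp κ * c₀⟩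
  let d : ℝ → ℂ := fun κ => ⟨p', p / Real.exp κ⟩
  have hz₀ : ∀ κ, z₀ κ ∈ Complex.slitPlane := fun κ => mem_slitPlane_of
    (hc.imp (fun h => mul_ne_zero (Real.exp_pos κ).ne' h) id)
  have hd : ∀ κ, d κ ∈ Complex.slitPlane := fun κ => mem_slitPlane_of
    (hp.imp (fun h => div_ne_zero h (Real.exp_pos κ).ne') id)
  have hz₀c : Continuous z₀ := continuous_complex_mk (by fun_prop) (by fun_prop)
  have hdc : Continuous d := continuous_complex_mk (by fun_prop)
    (continuous_const.div Real.continuous_exp fun κ => (Real.exp_pos κ).ne')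
  -- `Z` is a continuous logarithm of the end phase divided by `d`. Its imaginary part is at least
  -- `exp κ * m * ℓ - 2π` and so tends to infinity.
  let Z : ℝ → ℂ := fun κ => Complex.log (z₀ κ) + I κ - Complex.log (d κ)
  have hZ : Continuous Z := ((hz₀c.clog hz₀).add hI).sub (hdc.clog hd)
  have hexp : ∀ κ, phase q c₀ c₁ κ ℓ = Complex.exp (Z κ) * d κ := by
    intro κ
    have h0 := Complex.slitPlane_ne_zero (hz₀ κ)
    have h1 := Complex.slitPlane_ne_zero (hd κ)
    have hphase0 : phase q c₀ c₁ κ 0 = z₀ κ := by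
      simp [phase, z₀, LinearODE.sol_zero, LinearODE.solDeriv_zero]
    rw [eq_mul_exp_integral (fun t => hasDerivAt_phase hq c₀ c₁ κ t)
      ((continuous_phaseDeriv hq c₀ c₁).comp (continuous_const.prodMk continuous_id))
      (fun t => phase_ne_zero hq hc' κ t) ℓ, hphase0]
    simp only [Z]
    rw [Complex.exp_sub, Complex.exp_add, Complex.exp_log h0, Complex.exp_log h1,
      div_mul_cancel₀ _ h1]
  have hZim : ∀ κ, Real.exp κ * m * ℓ - 2 * Real.pi ≤ (Z κ).im := by
    intro κ
    simp only [Z, Complex.sub_im, Complex.add_im, Complex.log_im]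
    linarith [hIm κ, Complex.neg_pi_lt_arg (z₀ κ), Complex.arg_le_pi (d κ)]
  have hlim : Tendsto (fun κ => (Z κ).im) atTop atTop := by
    refine tendsto_atTop_mono hZim (tendsto_atTop_add_const_right _ _ ?_)
    exact (Real.tendsto_exp_atTop.atTop_mul_const hm).atTop_mul_const hℓ
  -- At the angle `ε π / 2` modulo `2π` the end phase is `ρ ε i d` with `ρ > 0`, that is `v' + i k v
  -- = ρ ε i (p' + i p / k)`. Comparing parts gives `s = ρ ε / k`.
  obtain ⟨n, hn⟩ : ∃ n : ℕ, (Z κ₀).im ≤ ε * (Real.pi / 2) + n * (2 * Real.pi) := by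
    obtain ⟨n, hn⟩ := exists_nat_ge (((Z κ₀).im - ε * (Real.pi / 2)) / (2 * Real.pi))
    rw [div_le_iff₀ (by positivity)] at hn
    exact ⟨n, by linarith⟩
  obtain ⟨κ₁, hκ₁, hκ₀₁⟩ : ∃ κ₁, ε * (Real.pi / 2) + n * (2 * Real.pi) ≤ (Z κ₁).im ∧ κ₀ ≤ κ₁ :=
    ((hlim.eventually_ge_atTop _).and (eventually_ge_atTop κ₀)).exists
  obtain ⟨κ, hκ, hκe⟩ := intermediate_value_Icc hκ₀₁ (Complex.continuous_im.comp hZ).continuousOn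
    ⟨hn, hκ₁⟩
  simp only [Function.comp_apply] at hκe
  have hk := Real.exp_pos κ
  have hρ := Real.exp_pos (Z κ).re
  have hsin : Real.sin (Z κ).im = ε := by
    rw [hκe, Real.sin_add_nat_mul_two_pi]
    rcases hε with rfl | rfl <;> simp
  have hcos : Real.cos (Z κ).im = 0 := by
    rw [hκe, Real.cos_add_nat_mul_two_pi]
    rcases hε with rfl | rfl <;> simp
  have hre := congrArg Complex.re (hexp κ)
  have him := congrArg Complex.im (hexp κ)
  simp only [Complex.mul_re, Complex.mul_im, Complex.exp_re, Complex.exp_im, hsin, hcos, phase,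
    d] at hre him
  refine ⟨κ, Real.exp (Z κ).re * ε / Real.exp κ, hκ.1, ?_, ?_, ?_⟩
  · rcases hε with rfl | rfl
    · simp only [mul_one, one_mul]; positivity
    · rw [show -1 * (Real.exp (Z κ).re * -1 / Real.exp κ) = Real.exp (Z κ).re / Real.exp κ by ring]
      positivity
  · field_simp
    linear_combination him
  · rw [hre]; ring

/-- The slit-plane restriction on `(p, p')` is lifted by reversing the signs of `p`, `p'`, `ε` and
`s` together. The weight is at least `R₁²` for `t ≥ 0`, hence `m = min 1 (R₁ ^ 2)`. -/
theorem exists_end_direction (hR₁ : 0 < R₁) (hR : R₁ < R₂) {c₀ c₁ p p' ε : ℝ}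
    (hc : c₀ ≠ 0 ∨ 0 < c₁) (hp : p ≠ 0 ∨ p' ≠ 0) (hε : ε = 1 ∨ ε = -1) (N : ℝ) :
    ∃ k s : ℝ, N ≤ k ∧ 0 < k ∧ 0 < ε * s ∧ radSol R₁ c₀ c₁ (k ^ 2) R₂ = s * p' ∧
      radSolDeriv R₁ c₀ c₁ (k ^ 2) R₂ = -(s * p) := by
  have hq := (contDiff_logWeight R₁).continuous
  have hm : 0 < min 1 (R₁ ^ 2) := lt_min one_pos (by positivity)
  have hℓ : 0 < Real.log (R₂ / R₁) := Real.log_pos (by rwa [one_lt_div hR₁])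
  have hmq : ∀ t, 0 ≤ t → min 1 (R₁ ^ 2) ≤ logWeight R₁ t := fun t ht => by
    refine (min_le_right _ _).trans ?_
    exact le_mul_of_one_le_right (by positivity) (Real.one_le_exp (by linarith))
  have hN : N ≤ Real.exp (Real.log (max N 1)) := by
    rw [Real.exp_log (by positivity)]
    exact le_max_left _ _
  by_cases hpp : p ≠ 0 ∨ 0 < p'
  · obtain ⟨κ, s, h1, h2, h3, h4⟩ := exists_end_direction_aux hq hm (min_le_left _ _) hℓ hmq hc hpp hε
      (Real.log (max N 1))
    exact ⟨Real.exp κ, s, hN.trans (Real.exp_le_exp.2 h1), Real.exp_pos κ, h2, h3, h4⟩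
  · push Not at hpp
    obtain ⟨hp0, hp'⟩ := hpp
    have hp' : 0 < -p' := by
      rcases hp with h | h
      · exact absurd hp0 h
      · exact neg_pos.2 (lt_of_le_of_ne hp' h)
    obtain ⟨κ, s, h1, h2, h3, h4⟩ := exists_end_direction_aux (p := -p) (ε := -ε) hq hm
      (min_le_left _ _) hℓ hmq hc (Or.inr hp') (by rcases hε with rfl | rfl <;> simp)
      (Real.log (max N 1))
    refine ⟨Real.exp κ, -s, hN.trans (Real.exp_le_exp.2 h1), Real.exp_pos κ, by linarith, ?_, ?_⟩
    · rw [radSol, h3]; ring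
    · rw [radSolDeriv, h4]; ring

/-! ### Existence of infinitely many positive eigenvalues -/

/-- Start on the line of the left condition, oriented into the slit plane. The target `(m₂₁, m₂₂)`
makes the end data a multiple of `(m₂₂, -m₂₁)`, which spans the kernel of the right condition. -/
theorem exists_eigenvalue_separated (hR₁ : 0 < R₁) (hR : R₁ < R₂) {m₁₁ m₁₂ m₂₁ m₂₂ : ℝ}
    (h₁ : (m₁₁, m₁₂) ≠ (0, 0)) (h₂ : (m₂₁, m₂₂) ≠ (0, 0)) (N : ℝ) : ∃ k : ℝ, N ≤ k ∧ 0 < k ∧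
      eigenspace R₁ R₂ hR (.separated m₁₁ m₁₂ m₂₁ m₂₂ h₁ h₂) (k ^ 2) ≠ ⊥ := by
  obtain ⟨c₀, c₁, hc, hbc⟩ : ∃ c₀ c₁ : ℝ, (c₀ ≠ 0 ∨ 0 < c₁) ∧ m₁₁ * c₀ + m₁₂ * c₁ = 0 := by
    by_cases h : m₁₂ = 0
    · exact ⟨0, 1, Or.inr one_pos, by simp [h]⟩
    · exact ⟨-m₁₂, m₁₁, Or.inl (neg_ne_zero.2 h), by ring⟩
  have hp : m₂₁ ≠ 0 ∨ m₂₂ ≠ 0 := by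
    by_contra hcon
    push Not at hcon
    exact h₂ (by rw [hcon.1, hcon.2])
  obtain ⟨k, s, h1, h2, -, h3, h4⟩ := exists_end_direction hR₁ hR hc hp (Or.inl rfl) N
  refine ⟨k, h1, h2, eigenspace_ne_bot hR₁ hR (hc.imp id ne_of_gt) ⟨?_, ?_⟩⟩
  · simpa using hbc
  · simp only [Matrix.cons_val_zero, Matrix.cons_val_one, h3, h4, RCLike.ofReal_real_eq_id, id]
    ring

/-- The monodromy matrix of the boundary value problem with coupled boundary condition. -/
def monodromy (R₁ R₂ : ℝ) (K : Matrix (Fin 2) (Fin 2) ℝ) (μ : ℝ) : Matrix (Fin 2) (Fin 2) ℝ :=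
  K * !![radSol R₁ 1 0 μ R₂, radSol R₁ 0 1 μ R₂; radSolDeriv R₁ 1 0 μ R₂, radSolDeriv R₁ 0 1 μ R₂]

theorem det_monodromy (hR₁ : 0 < R₁) (hR : R₁ < R₂) (K : Matrix.SpecialLinearGroup (Fin 2) ℝ)
    (μ : ℝ) : (monodromy R₁ R₂ K.1 μ).det = 1 := by
  rw [monodromy, Matrix.det_mul, K.2, one_mul, Matrix.det_fin_two_of]
  linear_combination radSol_wronskian hR₁ μ hR.le

theorem radSol_eq_combination (hR₁ : 0 < R₁) (c₀ c₁ μ : ℝ) {r : ℝ} (hr : R₁ ≤ r) :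
    radSol R₁ c₀ c₁ μ r = c₀ * radSol R₁ 1 0 μ r + c₁ * radSol R₁ 0 1 μ r ∧
    radSolDeriv R₁ c₀ c₁ μ r = c₀ * radSolDeriv R₁ 1 0 μ r + c₁ * radSolDeriv R₁ 0 1 μ r := by
  have := (isSLPair_radSol (R₂ := r) hR₁ c₀ c₁ μ).eq_radSol hR₁ (right_mem_Icc.2 hr)
  rwa [radSol_left hR₁, radSolDeriv_left hR₁] at this

/-- For a 2×2 matrix `M` of determinant one, `det (M - 1) = 2 - tr M`. A vector fixed by the
monodromy matrix is the initial data of an eigenfunction. -/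
theorem eigenspace_coupled_ne_bot (hR₁ : 0 < R₁) (hR : R₁ < R₂)
    {K : Matrix.SpecialLinearGroup (Fin 2) ℝ} {μ : ℝ}
    (htr : (monodromy R₁ R₂ K.1 μ).trace = 2) : eigenspace R₁ R₂ hR (.coupled K) μ ≠ ⊥ := by
  have hdet := det_monodromy hR₁ hR K μ
  have h0 : (monodromy R₁ R₂ K.1 μ - 1).det = 0 := by
    rw [Matrix.trace_fin_two] at htr
    rw [Matrix.det_fin_two] at hdet
    rw [Matrix.det_fin_two]
    simp
    linear_combination hdet - htr
  obtain ⟨c, hc, hMc⟩ := Matrix.exists_mulVec_eq_zero_iff.2 h0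
  rw [Matrix.sub_mulVec, Matrix.one_mulVec, sub_eq_zero] at hMc
  refine eigenspace_ne_bot (c₀ := c 0) (c₁ := c 1) hR₁ hR ?_ ?_
  · by_contra hcon
    push Not at hcon
    exact hc (funext fun i => by fin_cases i; exacts [hcon.1, hcon.2])
  · have hc2 : ![c 0, c 1] = c := by
      funext i; fin_cases i <;> rfl
    obtain ⟨e1, e2⟩ := radSol_eq_combination hR₁ (c 0) (c 1) μ hR.le
    have hmap : K.1.map (fun x : ℝ => (RCLike.ofReal x : ℝ)) = K.1 := by
      ext i j; simp
    simp only [BoundaryCondition.Holds]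
    rw [hc2, hmap, e1, e2]
    conv_lhs => rw [← hMc]
    rw [monodromy, ← Matrix.mulVec_mulVec]
    congr 1
    funext i
    fin_cases i <;> simp [Matrix.mulVec, dotProduct, Fin.sum_univ_two, mul_comm]

theorem continuous_trace_monodromy (R₁ R₂ : ℝ) (K : Matrix (Fin 2) (Fin 2) ℝ) :
    Continuous fun μ => (monodromy R₁ R₂ K μ).trace := by
  have hq := (contDiff_logWeight R₁).continuous
  have h1 : ∀ c₀ c₁ : ℝ, Continuous fun μ => radSol R₁ c₀ c₁ μ R₂ := fun c₀ c₁ =>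
    (LinearODE.continuous_sol hq c₀ c₁).comp (continuous_id.prodMk continuous_const)
  have h2 : ∀ c₀ c₁ : ℝ, Continuous fun μ => radSolDeriv R₁ c₀ c₁ μ R₂ := fun c₀ c₁ =>
    (LinearODE.continuous_solDeriv hq c₀ c₁).comp (continuous_id.prodMk continuous_const)
  simp only [monodromy, Matrix.trace_fin_two, Matrix.mul_apply, Fin.sum_univ_two, Matrix.of_apply,
    Matrix.cons_val_zero, Matrix.cons_val_one]
  have := h1 1 0
  have := h1 0 1
  have := h2 1 0
  have := h2 0 1
  fun_prop

/-- Let `k` be such that the solution with data `(0, 1)` ends at `s (K₀₁, -K₀₀)`. The upper right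
entry of the monodromy matrix then vanishes and the lower right one is `-s`. Determinant one makes
the trace `-(s + 1 / s)`, of modulus at least `2` and of sign opposite to `s`; hence the direction
lemma is applied with `-ε`. -/
theorem exists_trace_monodromy (hR₁ : 0 < R₁) (hR : R₁ < R₂)
    (K : Matrix.SpecialLinearGroup (Fin 2) ℝ) {ε : ℝ} (hε : ε = 1 ∨ ε = -1) (N : ℝ) :
    ∃ k : ℝ, N ≤ k ∧ 2 ≤ ε * (monodromy R₁ R₂ K.1 (k ^ 2)).trace := by
  have hdetK := K.2
  rw [Matrix.det_fin_two] at hdetK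
  have hp : K.1 0 0 ≠ 0 ∨ K.1 0 1 ≠ 0 := by
    by_contra hcon
    push Not at hcon
    rw [hcon.1, hcon.2] at hdetK
    norm_num at hdetK
  obtain ⟨k, s, h1, -, hs, h3, h4⟩ := exists_end_direction (c₀ := 0) (c₁ := 1) (ε := -ε) hR₁ hR
    (Or.inr one_pos) hp (by rcases hε with rfl | rfl <;> simp) N
  refine ⟨k, h1, ?_⟩
  have hdet := det_monodromy hR₁ hR K (k ^ 2)
  have h01 : monodromy R₁ R₂ K.1 (k ^ 2) 0 1 = 0 := by
    simp [monodromy, Matrix.mul_apply, Fin.sum_univ_two, h3, h4]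
    ring
  have h11 : monodromy R₁ R₂ K.1 (k ^ 2) 1 1 = -s := by
    simp [monodromy, Matrix.mul_apply, Fin.sum_univ_two, h3, h4]
    linear_combination (-s) * hdetK
  rw [Matrix.det_fin_two, h01, h11] at hdet
  rw [Matrix.trace_fin_two, h11]
  generalize monodromy R₁ R₂ K.1 (k ^ 2) 0 0 = x at hdet
  rcases hε with rfl | rfl
  · by_contra hcon
    nlinarith [sq_nonneg (s + 1), mul_pos (neg_pos.2 (by linarith : s < 0)) (sub_pos.2 (not_le.1 hcon))]
  · by_contra hcon
    nlinarith [sq_nonneg (s - 1), mul_pos (by linarith : 0 < s) (sub_pos.2 (not_le.1 hcon))]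

theorem exists_eigenvalue_coupled (hR₁ : 0 < R₁) (hR : R₁ < R₂)
    (K : Matrix.SpecialLinearGroup (Fin 2) ℝ) (N : ℝ) : ∃ k : ℝ, N ≤ k ∧ 0 < k ∧
      eigenspace R₁ R₂ hR (.coupled K) (k ^ 2) ≠ ⊥ := by
  obtain ⟨a, ha, hta⟩ := exists_trace_monodromy hR₁ hR K (Or.inl rfl) (max N 1)
  obtain ⟨b, hb, htb⟩ := exists_trace_monodromy hR₁ hR K (Or.inr rfl) (max N 1)
  have hcont : Continuous fun k : ℝ => (monodromy R₁ R₂ K.1 (k ^ 2)).trace :=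
    (continuous_trace_monodromy R₁ R₂ K.1).comp (continuous_pow 2)
  have hmem : (2 : ℝ) ∈ uIcc (monodromy R₁ R₂ K.1 (b ^ 2)).trace
      (monodromy R₁ R₂ K.1 (a ^ 2)).trace := by
    rw [mem_uIcc]
    left
    constructor <;> linarith
  obtain ⟨k, hk, hke⟩ := intermediate_value_uIcc hcont.continuousOn hmem
  have hkN : max N 1 ≤ k := le_trans (le_min hb ha) hk.1
  refine ⟨k, (le_max_left _ _).trans hkN, ?_, eigenspace_coupled_ne_bot hR₁ hR hke⟩
  exact one_pos.trans_le ((le_max_right _ _).trans hkN)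

theorem exists_eigenvalue_ge (hR₁ : 0 < R₁) (hR : R₁ < R₂) (bc : BoundaryCondition) (N : ℝ) :
    ∃ k : ℝ, N ≤ k ∧ 0 < k ∧ eigenspace R₁ R₂ hR bc (k ^ 2) ≠ ⊥ := by
  cases bc with
  | separated m₁₁ m₁₂ m₂₁ m₂₂ h₁ h₂ => exact exists_eigenvalue_separated hR₁ hR h₁ h₂ N
  | coupled K => exact exists_eigenvalue_coupled hR₁ hR K N

end

end AnnulusFlow

/-! ### Enumeration of the positive eigenvalues -/

namespace AnnulusFlow

noncomputable section

variable {R₁ R₂ : ℝ}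

/-- Finite initial segments give a least element and make every element reachable from it by
finitely many successor steps. -/
theorem nonempty_orderIso_nat_of_finite_Iic {ι : Type*} [LinearOrder ι] [Nonempty ι] [NoMaxOrder ι]
    (h : ∀ b : ι, (Iic b).Finite) : Nonempty (ι ≃o ℕ) := by
  let _ : LocallyFiniteOrder ι :=
    LocallyFiniteOrder.ofFiniteIcc fun a b => (h b).subset Icc_subset_Iic_self
  let _ : SuccOrder ι := LinearLocallyFiniteOrder.succOrder ι
  let _ : PredOrder ι := LinearLocallyFiniteOrder.predOrder ι
  obtain ⟨x⟩ := ‹Nonempty ι›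
  obtain ⟨m, hm, hmin⟩ := exists_min_image (Iic x) id (h x) ⟨x, le_rfl⟩
  let _ : OrderBot ι :=
    { bot := m
      bot_le := fun y => (le_total y x).elim (fun hy => hmin y hy) fun hy => le_trans hm hy }
  exact ⟨orderIsoNatOfLinearSuccPredArch⟩

/-- The positive reals repeated according to a multiplicity function, in lexicographic order. -/
abbrev PosWithMult (n : ℝ → ℕ) : Type :=
  {x : ℝ ×ₗ ℕ // 0 < (ofLex x).1 ∧ (ofLex x).2 < n (ofLex x).1}

/-- An initial segment lies over finitely many `z`, each with the finite fibre `Iio (n z)`. -/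
theorem nonempty_orderIso_posWithMult {n : ℝ → ℕ} (hfin : ∀ b, {z | 0 < z ∧ z ≤ b ∧ n z ≠ 0}.Finite)
    (hunb : ∀ N, ∃ k, N ≤ k ∧ 0 < k ∧ n k ≠ 0) : Nonempty (PosWithMult n ≃o ℕ) := by
  have hex : ∀ N, ∃ x : PosWithMult n, N ≤ (ofLex x.1).1 := fun N => by
    obtain ⟨k, hk, h0, hn⟩ := hunb N
    exact ⟨⟨toLex (k, 0), h0, Nat.pos_of_ne_zero hn⟩, hk⟩
  have : Nonempty (PosWithMult n) := ⟨(hex 0).choose⟩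
  have : NoMaxOrder (PosWithMult n) := ⟨fun a => by
    obtain ⟨x, hx⟩ := hex ((ofLex a.1).1 + 1)
    refine ⟨x, ?_⟩
    rw [← Subtype.coe_lt_coe, Prod.Lex.lt_iff]
    left
    linarith⟩
  refine nonempty_orderIso_nat_of_finite_Iic fun b => ?_
  have hT : (⋃ z ∈ {z | 0 < z ∧ z ≤ (ofLex b.1).1 ∧ n z ≠ 0},
      (fun i => toLex (z, i)) '' Iio (n z)).Finite :=
    (hfin _).biUnion fun z _ => (finite_Iio _).image _
  refine Finite.of_finite_image (hT.subset ?_) Subtype.val_injective.injOn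
  rintro _ ⟨x, hx, rfl⟩
  rw [mem_Iic, ← Subtype.coe_le_coe, Prod.Lex.le_iff] at hx
  have hle : (ofLex x.1).1 ≤ (ofLex b.1).1 := hx.elim le_of_lt fun h => h.1.le
  refine mem_biUnion (x := (ofLex x.1).1) ⟨x.2.1, hle, fun h => ?_⟩ ⟨(ofLex x.1).2, x.2.2, rfl⟩
  have := x.2.2
  omega


/-- `V` is orthogonal to every summand, hence to the sum; lying in the sum, it is orthogonal to
itself. Continuity is carried through the induction because adding integrals requires integrability.
-/
theorem disjoint_eigenspace_iSup (hR₁ : 0 < R₁) (hR : R₁ < R₂) (bc : BoundaryCondition) {μ : ℝ}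
    {T : Set ℝ} (hμ : μ ∉ T) :
    Disjoint (eigenspace R₁ R₂ hR bc μ) (⨆ lam ∈ T, eigenspace R₁ R₂ hR bc lam) := by
  rw [Submodule.disjoint_def]
  intro V hV hsup
  have hV : IsSLSolution R₁ R₂ bc μ V := hV
  have key : ContinuousOn V (Icc R₁ R₂) ∧ ∫ r in R₁..R₂, r * (V r * V r) = 0 := by
    refine Submodule.iSup_induction' (fun lam => ⨆ _ : lam ∈ T, eigenspace R₁ R₂ hR bc lam)
      (motive := fun W _ => ContinuousOn W (Icc R₁ R₂) ∧ ∫ r in R₁..R₂, r * (V r * W r) = 0)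
      ?_ ?_ ?_ hsup
    · intro lam W hW
      by_cases hlam : lam ∈ T
      · simp only [hlam, iSup_pos] at hW
        have hW : IsSLSolution R₁ R₂ bc lam W := hW
        refine ⟨(hW.isSLPair hR₁).continuousOn_left, ?_⟩
        rcases mul_eq_zero.1 (hV.integral_mul_star hR₁ hR hW) with h | h
        · exact absurd (sub_eq_zero.1 h) fun h => hμ (by rw [h]; exact hlam)
        · exact h
      · simp only [hlam, iSup_false, Submodule.mem_bot] at hW
        subst hW
        exact ⟨continuousOn_const, by simp⟩
    · exact ⟨continuousOn_const, by simp⟩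
    · rintro W W' _ _ ⟨hW, hWi⟩ ⟨hW', hWi'⟩
      refine ⟨hW.add hW', ?_⟩
      have hcV := (hV.isSLPair hR₁).continuousOn_left
      have h1 : IntervalIntegrable (fun r => r * (V r * W r)) volume R₁ R₂ :=
        (continuousOn_id.mul (hcV.mul hW)).intervalIntegrable_of_Icc hR.le
      have h2 : IntervalIntegrable (fun r => r * (V r * W' r)) volume R₁ R₂ :=
        (continuousOn_id.mul (hcV.mul hW')).intervalIntegrable_of_Icc hR.le
      have h3 := intervalIntegral.integral_add h1 h2
      rw [hWi, hWi', add_zero] at h3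
      rw [← h3]
      refine intervalIntegral.integral_congr fun r _ => ?_
      simp only [Pi.add_apply]
      ring
  exact hV.eq_zero_of_integral hR₁ hR key.2

/-- Bases of the spaces `E z` are concatenated along the order isomorphism with `ℕ`. Disjointness
makes the union independent, and the indices over `z` exhaust the basis of `E z`. -/
theorem exists_enumeration_of_finrank {M : Type*} [AddCommGroup M] [Module ℝ M]
    (E : ℝ → Submodule ℝ M) (hfd : ∀ z, FiniteDimensional ℝ (E z))
    (hfin : ∀ b, {z | 0 < z ∧ z ≤ b ∧ E z ≠ ⊥}.Finite)
    (hunb : ∀ N, ∃ k, N ≤ k ∧ 0 < k ∧ E k ≠ ⊥)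
    (hdisj : ∀ (z : {z : ℝ // 0 < z}) (t : Set {z : ℝ // 0 < z}), z ∉ t →
      Disjoint (E z) (⨆ w ∈ t, E w)) :
    ∃ (ζ : ℕ → ℝ) (V : ℕ → M), (∀ j, 0 < ζ j) ∧ Monotone ζ ∧ LinearIndependent ℝ V ∧
      ∀ z, 0 < z → Submodule.span ℝ (V '' {j | ζ j = z}) = E z := by
  let n : ℝ → ℕ := fun z => Module.finrank ℝ (E z)
  have hn : ∀ z, n z ≠ 0 ↔ E z ≠ ⊥ := fun z => by
    have := hfd z
    simp only [n, Ne, Submodule.finrank_eq_zero]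
  obtain ⟨e⟩ := nonempty_orderIso_posWithMult (n := n) (by simpa only [hn] using hfin)
    (by simpa only [hn] using hunb)
  let f : ∀ z : {z : ℝ // 0 < z}, Fin (n z) → M := fun z i => (Module.finBasis ℝ (E z) i : M)
  let g : PosWithMult n → Σ z : {z : ℝ // 0 < z}, Fin (n z) := fun x =>
    ⟨⟨(ofLex x.1).1, x.2.1⟩, ⟨(ofLex x.1).2, x.2.2⟩⟩
  have hginj : Function.Injective g := by
    rintro ⟨x, hx⟩ ⟨y, hy⟩ hxy
    have h1 : (ofLex x).1 = (ofLex y).1 := congrArg (fun s => (s.1 : ℝ)) hxy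
    have h2 : (ofLex x).2 = (ofLex y).2 := congrArg (fun s => (s.2 : ℕ)) hxy
    exact Subtype.ext (ofLex.injective (Prod.ext h1 h2))
  have hspan : ∀ z, Submodule.span ℝ (range (f z)) = E z := by
    intro z
    have h1 : range (f z) = (E z).subtype '' range (Module.finBasis ℝ (E z)) := by
      rw [← range_comp]; rfl
    rw [h1, Submodule.span_image, (Module.finBasis ℝ (E z)).span_eq, Submodule.map_top,
      Submodule.range_subtype]
  have hli : LinearIndependent ℝ fun s : Σ z : {z : ℝ // 0 < z}, Fin (n z) => f s.1 s.2 := by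
    refine linearIndependent_iUnion_finite (fun z => ?_) fun z t _ hz => ?_
    · exact (Module.finBasis ℝ (E z)).linearIndependent.map' _ (E z).ker_subtype
    · simp only [hspan]
      exact hdisj z t hz
  clear_value f
  refine ⟨fun j => (ofLex (e.symm j).1).1, fun j => f (g (e.symm j)).1 (g (e.symm j)).2,
    fun j => (e.symm j).2.1, ?_, ?_, ?_⟩
  · intro i j hij
    have h := e.symm.monotone hij
    rw [← Subtype.coe_le_coe, Prod.Lex.le_iff] at h
    exact h.elim le_of_lt fun h => h.1.le
  · exact hli.comp (fun j => g (e.symm j)) (hginj.comp e.symm.injective)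
  · intro z hz
    rw [← hspan ⟨z, hz⟩]
    congr 1
    ext V
    constructor
    · rintro ⟨j, hj, rfl⟩
      have : (g (e.symm j)).1 = ⟨z, hz⟩ := Subtype.ext hj
      rw [← this]
      exact mem_range_self _
    · rintro ⟨i, rfl⟩
      have hs := e.symm_apply_apply ⟨toLex (z, (i : ℕ)), hz, i.2⟩
      refine ⟨e ⟨toLex (z, (i : ℕ)), hz, i.2⟩, ?_, ?_⟩
      · simp
      -- The type `Fin (n z)` depends on `z`, so the whole index is generalized and substituted
      -- instead of rewriting its components.
      · have : ∀ x, x = ⟨toLex (z, (i : ℕ)), hz, i.2⟩ → f (g x).1 (g x).2 = f ⟨z, hz⟩ i := by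
          rintro _ rfl
          rfl
        exact this _ hs

theorem exists_isEigenEnumeration (hR₁ : 0 < R₁) (hR : R₁ < R₂) (bc : BoundaryCondition) :
    ∃ (ζ : ℕ → ℝ) (V : ℕ → ℝ → ℝ), IsEigenEnumeration R₁ R₂ hR bc ζ V := by
  obtain ⟨ζ, V, h1, h2, h3, h4⟩ := exists_enumeration_of_finrank
    (fun z => eigenspace R₁ R₂ hR bc (z ^ 2)) (fun z => finiteDimensional_eigenspace hR₁ hR bc _)
    (fun b => Finite.of_finite_image (f := fun z => z ^ 2)
      ((finite_eigenvalues_Icc hR₁ hR bc 0 (b ^ 2)).subset (by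
        rintro _ ⟨z, ⟨hz, hzb, hn⟩, rfl⟩
        exact ⟨⟨sq_nonneg z, pow_le_pow_left₀ hz.le hzb 2⟩, hn⟩))
      fun x hx y hy hxy => (pow_left_inj₀ hx.1.le hy.1.le two_ne_zero).1 hxy)
    (exists_eigenvalue_ge hR₁ hR bc) (fun z t hz => by
      refine (disjoint_eigenspace_iSup hR₁ hR bc (μ := (z : ℝ) ^ 2)
        (T := (fun w : {z : ℝ // 0 < z} => (w : ℝ) ^ 2) '' t) ?_).mono_right ?_
      · rintro ⟨w, hw, hwz⟩
        have : w = z := Subtype.ext ((pow_left_inj₀ w.2.le z.2.le two_ne_zero).1 hwz)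
        exact hz (this ▸ hw)
      · rw [iSup_image])
  exact ⟨ζ, V, h1, h2, h3, h4⟩

end

end AnnulusFlow

/-! ### Smooth extension of radial eigenfunctions -/

namespace AnnulusFlow

noncomputable section

variable {R₁ R₂ : ℝ}

theorem contDiffAt_radSol_sqrt (hR₁ : 0 < R₁) (c₀ c₁ μ : ℝ) {s : ℝ} (hs : 0 < s) :
    ContDiffAt ℝ ∞ (fun s => radSol R₁ c₀ c₁ μ √s) s := by
  have h1 : ContDiffAt ℝ ∞ (fun s => Real.log (√s / R₁)) s :=
    ((contDiffAt_id.sqrt hs.ne').div_const R₁).log (by simp only [id]; positivity)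
  exact (LinearODE.contDiff_sol (contDiff_logWeight R₁) c₀ c₁ μ).contDiffAt.comp s h1

theorem hasDerivAt_radSol_sqrt (hR₁ : 0 < R₁) (c₀ c₁ μ : ℝ) {s : ℝ} (hs : 0 < s) :
    HasDerivAt (fun s => radSol R₁ c₀ c₁ μ √s) (radSolDeriv R₁ c₀ c₁ μ √s / (2 * s)) s := by
  have hq : 0 < √s := Real.sqrt_pos.2 hs
  refine ((hasDerivAt_radSol hR₁ c₀ c₁ μ hq).comp s (Real.hasDerivAt_sqrt hs.ne')).congr_deriv ?_
  have := Real.sq_sqrt hs.le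
  field_simp
  rw [this]

theorem hasDerivAt_radSolDeriv_sqrt (hR₁ : 0 < R₁) (c₀ c₁ μ : ℝ) {s : ℝ} (hs : 0 < s) :
    HasDerivAt (fun s => radSolDeriv R₁ c₀ c₁ μ √s) (-(μ / 2 * radSol R₁ c₀ c₁ μ √s)) s := by
  have hq : 0 < √s := Real.sqrt_pos.2 hs
  refine ((hasDerivAt_radSolDeriv hR₁ c₀ c₁ μ hq).comp s
    (Real.hasDerivAt_sqrt hs.ne')).congr_deriv ?_
  field_simp

/-- An eigenfunction is a smooth function of `r²`, with a smooth compactly supported extension. -/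
theorem IsSLSolution.exists_smooth_extension {bc : BoundaryCondition} {μ : ℝ} {V : ℝ → ℝ}
    (hR₁ : 0 < R₁) (hR : R₁ < R₂) (hV : IsSLSolution R₁ R₂ bc μ V) :
    ∃ h : ℝ → ℝ, ContDiff ℝ ∞ h ∧ HasCompactSupport h ∧ (∀ r ∈ Icc R₁ R₂, V r = h (r ^ 2)) ∧
      ∀ s ∈ Ioo (R₁ ^ 2) (R₂ ^ 2), 4 * deriv h s + 4 * s * deriv (deriv h) s = -μ * h s := by
  set c₀ := V R₁
  set c₁ := quasiDeriv R₁ R₂ V R₁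
  have hlt : R₁ ^ 2 < R₂ ^ 2 := pow_lt_pow_left₀ hR hR₁.le two_ne_zero
  have hsq : 0 < R₁ ^ 2 := by positivity
  -- The bump equals `1` on `[R₁², R₂²]` and its support begins at `R₁² / 2 > 0`, so `√s` and its
  -- logarithm are smooth wherever they matter.
  let χ : ContDiffBump ((R₁ ^ 2 + R₂ ^ 2) / 2) :=
    ⟨(R₂ ^ 2 - R₁ ^ 2) / 2, (R₂ ^ 2 - R₁ ^ 2) / 2 + R₁ ^ 2 / 2, by linarith, by linarith⟩
  have hχ1 : ∀ s ∈ Icc (R₁ ^ 2) (R₂ ^ 2), χ s = 1 := fun s hs => by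
    refine χ.one_of_mem_closedBall ?_
    rw [Metric.mem_closedBall, Real.dist_eq, abs_le]
    constructor <;> simp only [χ] <;> linarith [hs.1, hs.2]
  have hg := fun s (hs : 0 < s) => hasDerivAt_radSol_sqrt hR₁ c₀ c₁ μ hs
  let h : ℝ → ℝ := fun s => χ s * radSol R₁ c₀ c₁ μ √s
  have heq : ∀ s ∈ Icc (R₁ ^ 2) (R₂ ^ 2), h s = radSol R₁ c₀ c₁ μ √s := fun s hs => by
    simp only [h, hχ1 s hs, one_mul]
  refine ⟨h, ?_, χ.hasCompactSupport.mul_right, fun r hr => ?_, fun s hs => ?_⟩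
  · rw [contDiff_iff_contDiffAt]
    intro s
    by_cases hs : 0 < s
    · exact χ.contDiff.contDiffAt.mul (contDiffAt_radSol_sqrt hR₁ c₀ c₁ μ hs)
    · have hn : s ∉ tsupport χ := by
        rw [χ.tsupport_eq, Metric.mem_closedBall, Real.dist_eq, abs_le]
        simp only [χ]
        rintro ⟨h1, -⟩
        linarith
      have h0 : h =ᶠ[𝓝 s] fun _ => 0 := by
        filter_upwards [notMem_tsupport_iff_eventuallyEq.1 hn] with y hy
        simp only [h, hy, Pi.zero_apply, zero_mul]
      exact contDiffAt_const.congr_of_eventuallyEq h0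
  · have hr0 : 0 ≤ r := hR₁.le.trans hr.1
    rw [heq _ ⟨pow_le_pow_left₀ hR₁.le hr.1 2, pow_le_pow_left₀ hr0 hr.2 2⟩, Real.sqrt_sq hr0,
      (radSol_eq_combination hR₁ c₀ c₁ μ hr.1).1]
    exact hV.eq_radSol hR₁ hr
  · have hev : ∀ᶠ y in 𝓝 s, y ∈ Ioo (R₁ ^ 2) (R₂ ^ 2) := isOpen_Ioo.mem_nhds hs
    have hpos : ∀ y ∈ Ioo (R₁ ^ 2) (R₂ ^ 2), 0 < y := fun y hy => hsq.trans hy.1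
    -- In `s = r²` one has `r d/dr = 2 s d/ds`; one further derivative yields the equation for `h`.
    have hd : ∀ y ∈ Ioo (R₁ ^ 2) (R₂ ^ 2),
        deriv h y = radSolDeriv R₁ c₀ c₁ μ √y / (2 * y) := fun y hy => by
      have he : h =ᶠ[𝓝 y] fun s => radSol R₁ c₀ c₁ μ √s := by
        filter_upwards [isOpen_Ioo.mem_nhds hy] with z hz
        exact heq z (Ioo_subset_Icc_self hz)
      rw [he.deriv_eq, (hg y (hpos y hy)).deriv]
    have hq := (hasDerivAt_radSolDeriv_sqrt hR₁ c₀ c₁ μ (hpos s hs)).fun_div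
      ((hasDerivAt_id s).const_mul 2) (by have := hpos s hs; simp only [id]; positivity)
    have hd2 := (Filter.EventuallyEq.deriv_eq (hev.mono hd)).trans hq.deriv
    have hs0 := hpos s hs
    rw [hd2, hd s hs, heq s (Ioo_subset_Icc_self hs)]
    simp only [id]
    field_simp
    ring

end

/-! ### Partial derivatives of smooth functions and weak derivatives -/

noncomputable section

variable {n : ℕ}

theorem contDiff_pd {f : (Fin n → ℝ) → ℝ} (hf : ContDiff ℝ ∞ f) (i : Fin n) :
    ContDiff ℝ ∞ (pd i f) :=
  (hf.fderiv_right (m := ∞) (by simp)).clm_apply contDiff_const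

theorem tsupport_pd_subset (f : (Fin n → ℝ) → ℝ) (i : Fin n) : tsupport (pd i f) ⊆ tsupport f :=
  tsupport_fderiv_apply_subset ℝ _

theorem hasCompactSupport_pd {f : (Fin n → ℝ) → ℝ} (hf : HasCompactSupport f) (i : Fin n) :
    HasCompactSupport (pd i f) :=
  hf.of_isClosed_subset (isClosed_tsupport _) (tsupport_pd_subset f i)

theorem contDiff_iterPd {f : (Fin n → ℝ) → ℝ} (hf : ContDiff ℝ ∞ f) (l : List (Fin n)) :
    ContDiff ℝ ∞ (iterPd l f) := by
  induction l with
  | nil => exact hf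
  | cons i l ih => exact contDiff_pd ih i

theorem tsupport_iterPd_subset (f : (Fin n → ℝ) → ℝ) (l : List (Fin n)) :
    tsupport (iterPd l f) ⊆ tsupport f := by
  induction l with
  | nil => exact subset_rfl
  | cons i l ih => exact (tsupport_pd_subset _ i).trans ih

theorem hasCompactSupport_iterPd {f : (Fin n → ℝ) → ℝ} (hf : HasCompactSupport f)
    (l : List (Fin n)) : HasCompactSupport (iterPd l f) :=
  hf.of_isClosed_subset (isClosed_tsupport _) (tsupport_iterPd_subset f l)

/-- Integration by parts moves the outermost derivative first, so the list arrives reversed on `F`.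
-/
theorem integral_mul_iterPd {φ : (Fin n → ℝ) → ℝ} (hφ : ContDiff ℝ ∞ φ) (l : List (Fin n)) :
    ∀ {F : (Fin n → ℝ) → ℝ}, ContDiff ℝ ∞ F → HasCompactSupport F →
      ∫ x, F x * iterPd l φ x = (-1) ^ l.length * ∫ x, iterPd l.reverse F x * φ x := by
  induction l with
  | nil => intro F _ _; simp [iterPd]
  | cons i l ih =>
    intro F hF hFc
    have hl := contDiff_iterPd hφ l
    have h1 : ∫ x, F x * iterPd (i :: l) φ x = -∫ x, pd i F x * iterPd l φ x := by
      refine integral_mul_fderiv_eq_neg_fderiv_mul_of_integrable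
        (v := Pi.single i 1) ?_ ?_ ?_
        (fun x _ => hF.differentiable (by simp) x) (fun x _ => hl.differentiable (by simp) x)
      · exact ((contDiff_pd hF i).continuous.mul hl.continuous).integrable_of_hasCompactSupport
          (hasCompactSupport_pd hFc i).mul_right
      · exact (hF.continuous.mul (contDiff_pd hl i).continuous).integrable_of_hasCompactSupport
          hFc.mul_right
      · exact (hF.continuous.mul hl.continuous).integrable_of_hasCompactSupport hFc.mul_right
    rw [h1, ih (contDiff_pd hF i) (hasCompactSupport_pd hFc i)]
    have h2 : iterPd (i :: l).reverse F = iterPd l.reverse (pd i F) := by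
      simp [iterPd, List.foldr_append]
    rw [h2, List.length_cons, pow_succ]
    ring

theorem memL2_of_hasCompactSupport (Ω : Set (Fin n → ℝ)) {F : (Fin n → ℝ) → ℝ}
    (hF : Continuous F) (hFc : HasCompactSupport F) : MemL2 Ω F :=
  (hF.memLp_of_hasCompactSupport hFc).restrict Ω

/-- Test functions vanish off `Ω`, so all integrals extend to the whole space, where `F` has compact
support and no boundary terms occur. -/
theorem isWeakDeriv_of_smooth {Ω : Set (Fin n → ℝ)} (hΩ : IsOpen Ω) {f F : (Fin n → ℝ) → ℝ}
    (hF : ContDiff ℝ ∞ F) (hFc : HasCompactSupport F) (hfF : EqOn f F Ω) (l : List (Fin n)) :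
    IsWeakDeriv Ω l f (iterPd l.reverse F) := by
  refine ⟨memL2_of_hasCompactSupport Ω (contDiff_iterPd hF _).continuous
    (hasCompactSupport_iterPd hFc _), fun φ hφ => ?_⟩
  have h0 : ∀ (l : List (Fin n)) x, x ∉ Ω → iterPd l φ x = 0 := fun l x hx =>
    image_eq_zero_of_notMem_tsupport fun h => hx (hφ.2.2 (tsupport_iterPd_subset φ l h))
  rw [setIntegral_congr_fun hΩ.measurableSet (g := fun x => F x * iterPd l φ x)
      (fun x hx => by simp only [hfF hx]),
    setIntegral_eq_integral_of_forall_compl_eq_zero (fun x hx => by rw [h0 l x hx, mul_zero]),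
    setIntegral_eq_integral_of_forall_compl_eq_zero (fun x hx => by
      rw [show φ x = 0 from h0 [] x hx, mul_zero]), integral_mul_iterPd hφ.1 l hF hFc]

theorem memL2_congr {Ω : Set (Fin n → ℝ)} (hΩ : IsOpen Ω) {f F : (Fin n → ℝ) → ℝ}
    (hfF : EqOn f F Ω) (hF : MemL2 Ω F) : MemL2 Ω f :=
  (memLp_congr_ae (ae_restrict_of_forall_mem hΩ.measurableSet hfF)).2 hF

theorem memHInfty_of_smooth {Ω : Set (Fin n → ℝ)} (hΩ : IsOpen Ω) {f F : (Fin n → ℝ) → ℝ}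
    (hF : ContDiff ℝ ∞ F) (hFc : HasCompactSupport F) (hfF : EqOn f F Ω) : MemHInfty Ω f :=
  fun _ => ⟨memL2_congr hΩ hfF (memL2_of_hasCompactSupport Ω hF.continuous hFc),
    fun l _ => ⟨_, isWeakDeriv_of_smooth hΩ hF hFc hfF l⟩⟩

/-- Dominated convergence: a constant is an integrable majorant for a finite measure. -/
theorem tendsto_eLpNorm_zero_of_bounded {α : Type*} [MeasurableSpace α] {m : Measure α}
    [IsFiniteMeasure m] {f : ℕ → α → ℝ} {C : ℝ} (hf : ∀ k, AEStronglyMeasurable (f k) m)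
    (hC : ∀ k, ∀ᵐ x ∂m, |f k x| ≤ C) (hlim : ∀ᵐ x ∂m, ∀ᶠ k in atTop, f k x = 0) :
    Tendsto (fun k => eLpNorm (f k) 2 m) atTop (𝓝 0) := by
  have h1 : Tendsto (fun k => ∫⁻ x, ‖f k x‖ₑ ^ (2 : ℝ) ∂m) atTop (𝓝 (∫⁻ _, 0 ∂m)) := by
    refine tendsto_lintegral_of_dominated_convergence' (fun _ => ENNReal.ofReal C ^ (2 : ℝ))
      (fun k => (hf k).enorm.pow_const _) (fun k => ?_) ?_ ?_
    · filter_upwards [hC k] with x hx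
      gcongr
      rw [Real.enorm_eq_ofReal_abs]
      exact ENNReal.ofReal_le_ofReal hx
    · rw [lintegral_const]
      exact ENNReal.mul_ne_top (by simp) (measure_ne_top _ _)
    · filter_upwards [hlim] with x hx
      refine tendsto_const_nhds.congr' ?_
      filter_upwards [hx] with k hk
      simp [hk]
  have h2 : ∀ k, eLpNorm (f k) 2 m = (∫⁻ x, ‖f k x‖ₑ ^ (2 : ℝ) ∂m) ^ (1 / (2 : ℝ)) := fun k => by
    rw [eLpNorm_eq_lintegral_rpow_enorm_toReal (by simp) (by simp)]
    simp
  simp only [h2]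
  rw [lintegral_zero] at h1
  have h3 := (ENNReal.continuous_rpow_const (y := 1 / (2 : ℝ))).tendsto 0
  rw [ENNReal.zero_rpow_of_pos (by norm_num)] at h3
  exact h3.comp h1

end

/-! ### Truncation of functions vanishing at the end points -/

noncomputable section

/-- A smooth step, `0` for `t ≤ 1` and `1` for `2 ≤ t`. -/
def step (t : ℝ) : ℝ := Real.smoothTransition (t - 1)

theorem contDiff_step : ContDiff ℝ ∞ step :=
  Real.smoothTransition.contDiff.comp (contDiff_id.sub contDiff_const)

theorem step_eq_zero {t : ℝ} (ht : t ≤ 1) : step t = 0 :=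
  Real.smoothTransition.zero_of_nonpos (by linarith)

theorem step_eq_one {t : ℝ} (ht : 2 ≤ t) : step t = 1 :=
  Real.smoothTransition.one_of_one_le (by linarith)

theorem abs_step_le (t : ℝ) : |step t| ≤ 1 := by
  rw [step, abs_of_nonneg (Real.smoothTransition.nonneg _)]
  exact Real.smoothTransition.le_one _

/-- The derivative of `step` vanishes off `[1, 2]`. This scale-invariant bound is what controls the
derivatives of the truncations. -/
theorem exists_bound_mul_deriv_step : ∃ M : ℝ, ∀ t, |t * deriv step t| ≤ M := by
  have hc : Continuous fun t => t * deriv step t :=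
    continuous_id.mul (contDiff_step.continuous_deriv (by simp))
  obtain ⟨M, hM⟩ := (isCompact_Icc (a := (1 : ℝ)) (b := 2)).exists_bound_of_continuousOn
    hc.continuousOn
  have hM0 : 0 ≤ M := (norm_nonneg _).trans (hM 1 (by norm_num))
  refine ⟨M, fun t => ?_⟩
  by_cases ht : t ∈ Icc (1 : ℝ) 2
  · exact hM t ht
  · have h0 : deriv step t = 0 := by
      rw [mem_Icc, not_and_or, not_le, not_le] at ht
      rcases ht with ht | ht
      · have : step =ᶠ[𝓝 t] fun _ => 0 := by
          filter_upwards [isOpen_Iio.mem_nhds ht] with y hy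
          exact step_eq_zero (le_of_lt hy)
        rw [this.deriv_eq, deriv_const]
      · have : step =ᶠ[𝓝 t] fun _ => 1 := by
          filter_upwards [isOpen_Ioi.mem_nhds ht] with y hy
          exact step_eq_one (le_of_lt hy)
        rw [this.deriv_eq, deriv_const]
    rw [h0, mul_zero, abs_zero]
    exact hM0

/-- Truncation of `h` near the end points of `[A, B]`. -/
def trunc (A B : ℝ) (h : ℝ → ℝ) (k : ℕ) (s : ℝ) : ℝ :=
  step ((k + 1) * (s - A)) * step ((k + 1) * (B - s)) * h s

variable {A B : ℝ} {h : ℝ → ℝ}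

theorem contDiff_trunc (A B : ℝ) (hh : ContDiff ℝ ∞ h) (k : ℕ) : ContDiff ℝ ∞ (trunc A B h k) := by
  have h1 : ContDiff ℝ ∞ fun s : ℝ => step (((k : ℝ) + 1) * (s - A)) :=
    contDiff_step.comp (by fun_prop)
  have h2 : ContDiff ℝ ∞ fun s : ℝ => step (((k : ℝ) + 1) * (B - s)) :=
    contDiff_step.comp (by fun_prop)
  exact (h1.mul h2).mul hh

theorem trunc_ne_zero {k : ℕ} {s : ℝ} (hs : trunc A B h k s ≠ 0) :
    A + 1 / ((k : ℝ) + 1) ≤ s ∧ s ≤ B - 1 / ((k : ℝ) + 1) := by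
  have hk : (0 : ℝ) < k + 1 := by positivity
  constructor
  · by_contra hcon
    refine hs ?_
    rw [trunc, step_eq_zero, zero_mul, zero_mul]
    rw [not_le, ← sub_lt_iff_lt_add', lt_div_iff₀ hk] at hcon
    linarith
  · by_contra hcon
    refine hs ?_
    rw [trunc, step_eq_zero (t := _ * (B - s)), mul_zero, zero_mul]
    rw [not_le, sub_lt_comm, lt_div_iff₀ hk] at hcon
    linarith

theorem eventually_trunc_eq {s : ℝ} (hs : s ∈ Ioo A B) :
    ∀ᶠ k : ℕ in atTop, trunc A B h k =ᶠ[𝓝 s] h := by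
  obtain ⟨k₀, hk₀⟩ := exists_nat_gt (max (2 / (s - A)) (2 / (B - s)))
  have hA : 0 < s - A := sub_pos.2 hs.1
  have hB : 0 < B - s := sub_pos.2 hs.2
  filter_upwards [eventually_ge_atTop k₀] with k hk
  have hk' : (k₀ : ℝ) ≤ k := by exact_mod_cast hk
  have h1 : 2 < ((k : ℝ) + 1) * (s - A) := by
    have := (le_max_left _ _).trans_lt hk₀
    rw [div_lt_iff₀ hA] at this
    nlinarith
  have h2 : 2 < ((k : ℝ) + 1) * (B - s) := by
    have := (le_max_right _ _).trans_lt hk₀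
    rw [div_lt_iff₀ hB] at this
    nlinarith
  have o1 : ∀ᶠ y in 𝓝 s, 2 < ((k : ℝ) + 1) * (y - A) :=
    (isOpen_lt continuous_const (by fun_prop)).mem_nhds h1
  have o2 : ∀ᶠ y in 𝓝 s, 2 < ((k : ℝ) + 1) * (B - y) :=
    (isOpen_lt continuous_const (by fun_prop)).mem_nhds h2
  filter_upwards [o1, o2] with y hy1 hy2
  rw [trunc, step_eq_one hy1.le, step_eq_one hy2.le, one_mul, one_mul]

theorem abs_trunc_le (k : ℕ) (s : ℝ) : |trunc A B h k s| ≤ |h s| := by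
  rw [trunc, abs_mul, abs_mul]
  have h1 := abs_step_le ((k + 1) * (s - A))
  have h2 := abs_step_le ((k + 1) * (B - s))
  calc _ ≤ 1 * 1 * |h s| := by gcongr
    _ = |h s| := by ring

/-- Differentiating a cut-off costs a factor `k + 1`, but `h` vanishes at the end point, so `|h s| ≤
L |s - A|`. With `u = (k + 1)(s - A)` the product is at most `L |u * deriv step u| ≤ L M`, uniformly
in `k`; likewise at `B`. -/
theorem exists_bound_deriv_trunc (hh : ContDiff ℝ ∞ h) (hc : HasCompactSupport h) (hA : h A = 0)
    (hB : h B = 0) : ∃ C : ℝ, ∀ k s, |deriv (trunc A B h k) s| ≤ C := by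
  obtain ⟨M, hM⟩ := exists_bound_mul_deriv_step
  obtain ⟨L, hL⟩ := hc.deriv.exists_bound_of_continuous (hh.continuous_deriv (by simp))
  have hL0 : 0 ≤ L := (norm_nonneg _).trans (hL 0)
  have hlip : ∀ x y, |h y - h x| ≤ L * |y - x| := fun x y =>
    convex_univ.norm_image_sub_le_of_norm_deriv_le
      (fun z _ => (hh.differentiable (by simp)).differentiableAt) (fun z _ => hL z)
      (mem_univ x) (mem_univ y)
  have hhA : ∀ s, |h s| ≤ L * |s - A| := fun s => by simpa [hA] using hlip A s
  have hhB : ∀ s, |h s| ≤ L * |B - s| := fun s => by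
    rw [abs_sub_comm]; simpa [hB] using hlip B s
  refine ⟨M * L + M * L + L, fun k s => ?_⟩
  have hstep : ∀ t, HasDerivAt step (deriv step t) t := fun t =>
    (contDiff_step.differentiable (by simp)).differentiableAt.hasDerivAt
  set u := ((k : ℝ) + 1) * (s - A) with hu
  set w := ((k : ℝ) + 1) * (B - s) with hw
  have hk : (0 : ℝ) < k + 1 := by positivity
  have d1 : HasDerivAt (fun s => step (((k : ℝ) + 1) * (s - A))) (deriv step u * (k + 1)) s := by
    refine ((hstep u).comp s (((hasDerivAt_id s).sub_const A).const_mul ((k : ℝ) + 1))).congr_deriv ?_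
    ring
  have d2 : HasDerivAt (fun s => step (((k : ℝ) + 1) * (B - s))) (-(deriv step w * (k + 1))) s := by
    refine ((hstep w).comp s (((hasDerivAt_id s).const_sub B).const_mul ((k : ℝ) + 1))).congr_deriv ?_
    ring
  have d3 : HasDerivAt h (deriv h s) s := (hh.differentiable (by simp)).differentiableAt.hasDerivAt
  have hd : deriv (trunc A B h k) s = deriv step u * (k + 1) * h s * step w
      - deriv step w * (k + 1) * h s * step u + step u * step w * deriv h s := by
    refine (((d1.mul d2).mul d3).congr_deriv ?_).deriv
    simp only [Pi.mul_apply, ← hu, ← hw]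
    ring
  have b1 : |deriv step u * (k + 1) * h s| ≤ M * L := by
    calc |deriv step u * (k + 1) * h s| = |deriv step u| * (k + 1) * |h s| := by
          rw [abs_mul, abs_mul, abs_of_pos hk]
      _ ≤ |deriv step u| * (k + 1) * (L * |s - A|) := by gcongr; exact hhA s
      _ = |u * deriv step u| * L := by rw [abs_mul, hu, abs_mul, abs_of_pos hk]; ring
      _ ≤ M * L := by gcongr; exact hM u
  have b2 : |deriv step w * (k + 1) * h s| ≤ M * L := by
    calc |deriv step w * (k + 1) * h s| = |deriv step w| * (k + 1) * |h s| := by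
          rw [abs_mul, abs_mul, abs_of_pos hk]
      _ ≤ |deriv step w| * (k + 1) * (L * |B - s|) := by gcongr; exact hhB s
      _ = |w * deriv step w| * L := by rw [abs_mul, hw, abs_mul, abs_of_pos hk]; ring
      _ ≤ M * L := by gcongr; exact hM w
  have hML : 0 ≤ M * L := (abs_nonneg _).trans b1
  have hu1 := abs_step_le u
  have hw1 := abs_step_le w
  have t1 : |deriv step u * (k + 1) * h s * step w| ≤ M * L * 1 := by
    rw [abs_mul]; gcongr
  have t2 : |deriv step w * (k + 1) * h s * step u| ≤ M * L * 1 := by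
    rw [abs_mul]; gcongr
  have t3 : |step u * step w * deriv h s| ≤ 1 * 1 * L := by
    rw [abs_mul, abs_mul]; gcongr; exact hL s
  rw [hd]
  refine (abs_add_le _ _).trans ?_
  have := abs_sub (deriv step u * (k + 1) * h s * step w) (deriv step w * (k + 1) * h s * step u)
  linarith

end

/-! ### Radial functions in the plane -/

noncomputable section

variable {R₁ R₂ : ℝ}

theorem contDiff_sqNorm : ContDiff ℝ ∞ fun x : Fin 2 → ℝ => x 0 ^ 2 + x 1 ^ 2 := by fun_prop

theorem pd_comp_sqNorm {k : ℝ → ℝ} (hk : Differentiable ℝ k) (i : Fin 2) (x : Fin 2 → ℝ) :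
    pd i (fun x : Fin 2 → ℝ => k (x 0 ^ 2 + x 1 ^ 2)) x
      = deriv k (x 0 ^ 2 + x 1 ^ 2) * (2 * x i) := by
  have h0 : ∀ j : Fin 2, HasFDerivAt (fun x : Fin 2 → ℝ => x j)
      (ContinuousLinearMap.proj (R := ℝ) (φ := fun _ : Fin 2 => ℝ) j) x := fun j => hasFDerivAt_apply j x
  have h1 := ((h0 0).pow 2).add ((h0 1).pow 2)
  have h2 := hk.differentiableAt.hasDerivAt.comp_hasFDerivAt x h1
  have h3 : fderiv ℝ (fun x : Fin 2 → ℝ => k (x 0 ^ 2 + x 1 ^ 2)) x = _ := h2.fderiv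
  rw [pd, h3]
  fin_cases i <;> simp

theorem isOpen_planeRing (R₁ R₂ : ℝ) : IsOpen (planeRing R₁ R₂) :=
  isOpen_Ioo.preimage (by fun_prop : Continuous fun x : Fin 2 → ℝ => √(x 0 ^ 2 + x 1 ^ 2))

theorem mem_planeRing_iff (hR₁ : 0 < R₁) (hR : R₁ < R₂) (x : Fin 2 → ℝ) :
    x ∈ planeRing R₁ R₂ ↔ x 0 ^ 2 + x 1 ^ 2 ∈ Ioo (R₁ ^ 2) (R₂ ^ 2) := by
  rw [planeRing, mem_ofPred_eq, Real.lt_sqrt hR₁.le, Real.sqrt_lt' (hR₁.trans hR), mem_Ioo]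

theorem isCompact_sqNorm_le (C : ℝ) : IsCompact {x : Fin 2 → ℝ | x 0 ^ 2 + x 1 ^ 2 ≤ C} := by
  refine Metric.isCompact_of_isClosed_isBounded (isClosed_le (by fun_prop) continuous_const) ?_
  refine (Metric.isBounded_closedBall (x := (0 : Fin 2 → ℝ)) (r := √C)).subset fun x hx => ?_
  rw [mem_closedBall_zero_iff, pi_norm_le_iff_of_nonneg (Real.sqrt_nonneg _)]
  intro i
  refine Real.abs_le_sqrt ?_
  have hx : x 0 ^ 2 + x 1 ^ 2 ≤ C := hx
  fin_cases i
  · simp only [Fin.zero_eta]; nlinarith [sq_nonneg (x 1)]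
  · simp only [Fin.mk_one]; nlinarith [sq_nonneg (x 0)]

theorem hasCompactSupport_comp_sqNorm {k : ℝ → ℝ} (hk : HasCompactSupport k) :
    HasCompactSupport fun x : Fin 2 → ℝ => k (x 0 ^ 2 + x 1 ^ 2) := by
  obtain ⟨C, hC⟩ := hk.isCompact.isBounded.bddAbove
  refine HasCompactSupport.intro (isCompact_sqNorm_le C) fun x hx => ?_
  exact image_eq_zero_of_notMem_tsupport fun h => hx (hC h)

theorem eqOn_planeRadial {V h : ℝ → ℝ} (hV : ∀ r ∈ Icc R₁ R₂, V r = h (r ^ 2)) :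
    EqOn (planeRadial V) (fun x => h (x 0 ^ 2 + x 1 ^ 2)) (planeRing R₁ R₂) := by
  intro x hx
  simp only [planeRadial]
  rw [hV _ ⟨hx.1.le, hx.2.le⟩, Real.sq_sqrt (by positivity)]

/-- The truncations composed with `|x|²` are test functions. Near each point of the ring they
eventually agree with the limit, and they and their gradients are uniformly bounded there, so
dominated convergence gives convergence in `H¹`. -/
theorem memH10_comp_sqNorm (hR₁ : 0 < R₁) (hR : R₁ < R₂) {f : (Fin 2 → ℝ) → ℝ} {h : ℝ → ℝ}
    (hh : ContDiff ℝ ∞ h) (hc : HasCompactSupport h) (hA : h (R₁ ^ 2) = 0) (hB : h (R₂ ^ 2) = 0)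
    (hf : EqOn f (fun x => h (x 0 ^ 2 + x 1 ^ 2)) (planeRing R₁ R₂)) :
    MemH10 (planeRing R₁ R₂) f := by
  set Ω := planeRing R₁ R₂ with hΩdef
  have hΩ : IsOpen Ω := isOpen_planeRing R₁ R₂
  have hmem := mem_planeRing_iff hR₁ hR
  set F : (Fin 2 → ℝ) → ℝ := fun x => h (x 0 ^ 2 + x 1 ^ 2) with hFdef
  have hF : ContDiff ℝ ∞ F := hh.comp contDiff_sqNorm
  have hFc : HasCompactSupport F := hasCompactSupport_comp_sqNorm hc
  have : IsFiniteMeasure (volume.restrict Ω) := by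
    refine ⟨?_⟩
    rw [Measure.restrict_apply_univ]
    refine (measure_mono fun x hx => ?_).trans_lt (isCompact_sqNorm_le (R₂ ^ 2)).measure_lt_top
    exact ((hmem x).1 hx).2.le
  let φ : ℕ → (Fin 2 → ℝ) → ℝ := fun k x => trunc (R₁ ^ 2) (R₂ ^ 2) h k (x 0 ^ 2 + x 1 ^ 2)
  have hφ : ∀ k, ContDiff ℝ ∞ (φ k) := fun k => (contDiff_trunc _ _ hh k).comp contDiff_sqNorm
  have hpdφ : ∀ k i x, pd i (φ k) x
      = deriv (trunc (R₁ ^ 2) (R₂ ^ 2) h k) (x 0 ^ 2 + x 1 ^ 2) * (2 * x i) := fun k i x =>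
    pd_comp_sqNorm ((contDiff_trunc _ _ hh k).differentiable (by simp)) i x
  have hpdF : ∀ i x, pd i F x = deriv h (x 0 ^ 2 + x 1 ^ 2) * (2 * x i) := fun i x =>
    pd_comp_sqNorm (hh.differentiable (by simp)) i x
  refine ⟨memL2_congr hΩ hf (memL2_of_hasCompactSupport Ω hF.continuous hFc), fun i => pd i F,
    fun i => isWeakDeriv_of_smooth hΩ hF hFc hf [i], φ, fun k => ⟨hφ k, ?_, ?_⟩, ?_, fun i => ?_⟩
  · exact HasCompactSupport.mul_left (f := fun x : Fin 2 → ℝ =>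
      step (((k : ℝ) + 1) * (x 0 ^ 2 + x 1 ^ 2 - R₁ ^ 2))
        * step (((k : ℝ) + 1) * (R₂ ^ 2 - (x 0 ^ 2 + x 1 ^ 2)))) hFc
  · have hcl : IsClosed {x : Fin 2 → ℝ | R₁ ^ 2 + 1 / ((k : ℝ) + 1) ≤ x 0 ^ 2 + x 1 ^ 2 ∧
        x 0 ^ 2 + x 1 ^ 2 ≤ R₂ ^ 2 - 1 / ((k : ℝ) + 1)} :=
      isClosed_Icc.preimage contDiff_sqNorm.continuous
    refine (closure_minimal (fun x hx => trunc_ne_zero hx) hcl).trans fun x hx => ?_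
    have : 0 < 1 / ((k : ℝ) + 1) := by positivity
    exact (hmem x).2 ⟨by linarith [hx.1], by linarith [hx.2]⟩
  · obtain ⟨C, hC⟩ := hc.exists_bound_of_continuous hh.continuous
    refine tendsto_eLpNorm_zero_of_bounded (C := C + C) (fun k => ?_) (fun k => ?_) ?_
    · have h1 : AEStronglyMeasurable f (volume.restrict Ω) :=
        (memL2_congr hΩ hf (memL2_of_hasCompactSupport Ω hF.continuous hFc)).1
      exact (hφ k).continuous.aestronglyMeasurable.sub h1
    · refine ae_restrict_of_forall_mem hΩ.measurableSet fun x hx => ?_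
      rw [Pi.sub_apply, hf hx]
      refine (abs_sub _ _).trans (add_le_add ?_ (hC _))
      exact (abs_trunc_le k _).trans (hC _)
    · refine ae_restrict_of_forall_mem hΩ.measurableSet fun x hx => ?_
      filter_upwards [eventually_trunc_eq (h := h) ((hmem x).1 hx)] with k hk
      rw [Pi.sub_apply, hf hx, sub_eq_zero]
      exact hk.eq_of_nhds
  · obtain ⟨C, hC⟩ := hc.deriv.exists_bound_of_continuous (hh.continuous_deriv (by simp))
    obtain ⟨C', hC'⟩ := exists_bound_deriv_trunc hh hc hA hB
    refine tendsto_eLpNorm_zero_of_bounded (C := (C' + C) * (2 * R₂)) (fun k => ?_) (fun k => ?_) ?_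
    · exact ((contDiff_pd (hφ k) i).continuous.sub
        (contDiff_pd hF i).continuous).aestronglyMeasurable
    · refine ae_restrict_of_forall_mem hΩ.measurableSet fun x hx => ?_
      simp only [Pi.sub_apply, hpdφ, hpdF]
      rw [← sub_mul, abs_mul]
      have hx2 := ((hmem x).1 hx).2
      have hxi : |x i| ≤ R₂ := by
        refine abs_le_of_sq_le_sq ?_ (hR₁.trans hR).le
        fin_cases i
        · simp only [Fin.zero_eta]; nlinarith [sq_nonneg (x 1)]
        · simp only [Fin.mk_one]; nlinarith [sq_nonneg (x 0)]
      have hC0 : 0 ≤ C := (norm_nonneg _).trans (hC 0)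
      have hC0' : 0 ≤ C' := (abs_nonneg _).trans (hC' 0 0)
      have e : |2 * x i| = 2 * |x i| := by rw [abs_mul, abs_two]
      rw [e]
      have hsub := (abs_sub (deriv (trunc (R₁ ^ 2) (R₂ ^ 2) h k) (x 0 ^ 2 + x 1 ^ 2))
        (deriv h (x 0 ^ 2 + x 1 ^ 2))).trans (add_le_add (hC' k _) (hC _))
      gcongr
    · refine ae_restrict_of_forall_mem hΩ.measurableSet fun x hx => ?_
      filter_upwards [eventually_trunc_eq (h := h) ((hmem x).1 hx)] with k hk
      simp only [Pi.sub_apply, hpdφ, hpdF, hk.deriv_eq, sub_self]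

theorem regularity_dirichlet (hR₁ : 0 < R₁) (hR : R₁ < R₂) {μ : ℝ} {V : ℝ → ℝ}
    (hV : IsSLSolution R₁ R₂ .dirichlet μ V) :
    MemH10 (planeRing R₁ R₂) (planeRadial V) ∧ MemHInfty (planeRing R₁ R₂) (planeRadial V) := by
  obtain ⟨h, hh, hc, hVh, -⟩ := hV.exists_smooth_extension hR₁ hR
  have he := eqOn_planeRadial hVh
  obtain ⟨b1, b2⟩ := hV.boundary
  simp only [bdryData, Matrix.cons_val_zero, Matrix.cons_val_one, RCLike.ofReal_real_eq_id, id,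
    one_mul, zero_mul, add_zero] at b1 b2
  rw [hVh _ (left_mem_Icc.2 hR.le)] at b1
  rw [hVh _ (right_mem_Icc.2 hR.le)] at b2
  exact ⟨memH10_comp_sqNorm hR₁ hR hh hc b1 b2 he,
    memHInfty_of_smooth (isOpen_planeRing _ _) (hh.comp contDiff_sqNorm)
      (hasCompactSupport_comp_sqNorm hc) he⟩

end

end AnnulusFlow

/-! ### Calculus of partial derivatives on an open set -/

namespace AnnulusFlow

noncomputable section

section calculus

variable {n : ℕ} {Ω : Set (Fin n → ℝ)} {f g : (Fin n → ℝ) → ℝ} {x : Fin n → ℝ}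

theorem contDiffOn_pd (hΩ : IsOpen Ω) (hf : ContDiffOn ℝ ∞ f Ω) (i : Fin n) :
    ContDiffOn ℝ ∞ (pd i f) Ω :=
  (hf.fderiv_of_isOpen hΩ (by simp)).clm_apply contDiffOn_const

theorem pd_congr (hΩ : IsOpen Ω) (h : EqOn f g Ω) (i : Fin n) : EqOn (pd i f) (pd i g) Ω := by
  intro x hx
  have he : f =ᶠ[𝓝 x] g := by
    filter_upwards [hΩ.mem_nhds hx] with y hy
    exact h hy
  rw [pd, pd, he.fderiv_eq]

theorem differentiableAt_of_contDiffOn (hΩ : IsOpen Ω) (hf : ContDiffOn ℝ ∞ f Ω) (hx : x ∈ Ω) :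
    DifferentiableAt ℝ f x :=
  (hf.contDiffAt (hΩ.mem_nhds hx)).differentiableAt (by simp)

theorem pd_add (hΩ : IsOpen Ω) (hf : ContDiffOn ℝ ∞ f Ω) (hg : ContDiffOn ℝ ∞ g Ω) (i : Fin n)
    (hx : x ∈ Ω) : pd i (fun y => f y + g y) x = pd i f x + pd i g x := by
  simp only [pd]
  rw [fderiv_fun_add (differentiableAt_of_contDiffOn hΩ hf hx)
    (differentiableAt_of_contDiffOn hΩ hg hx)]
  rfl

theorem pd_const_mul (hΩ : IsOpen Ω) (hf : ContDiffOn ℝ ∞ f Ω) (c : ℝ) (i : Fin n) (hx : x ∈ Ω) :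
    pd i (fun y => c * f y) x = c * pd i f x := by
  simp only [pd]
  rw [fderiv_const_mul (differentiableAt_of_contDiffOn hΩ hf hx)]
  rfl

theorem pd_mul (hΩ : IsOpen Ω) (hf : ContDiffOn ℝ ∞ f Ω) (hg : ContDiffOn ℝ ∞ g Ω) (i : Fin n)
    (hx : x ∈ Ω) : pd i (fun y => f y * g y) x = f x * pd i g x + g x * pd i f x := by
  simp only [pd]
  rw [fderiv_fun_mul (differentiableAt_of_contDiffOn hΩ hf hx)
    (differentiableAt_of_contDiffOn hΩ hg hx)]
  rfl

theorem pd_comm (hΩ : IsOpen Ω) (hf : ContDiffOn ℝ ∞ f Ω) (i j : Fin n) (hx : x ∈ Ω) :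
    pd i (pd j f) x = pd j (pd i f) x := by
  have hc := hf.contDiffAt (hΩ.mem_nhds hx)
  have hsymm : IsSymmSndFDerivAt ℝ f x := hc.isSymmSndFDerivAt (by simpa using ENat.LEInfty.out)
  have hd : DifferentiableAt ℝ (fderiv ℝ f) x :=
    (hc.fderiv_right (m := ∞) (by simp)).differentiableAt (by simp)
  have key : ∀ i j : Fin n, pd i (pd j f) x
      = fderiv ℝ (fderiv ℝ f) x (Pi.single i 1) (Pi.single j 1) := fun i j => by
    have : pd j f = fun y => fderiv ℝ f y (Pi.single j 1) := rfl
    rw [pd, this, fderiv_clm_apply hd (differentiableAt_const _)]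
    simp
  rw [key, key, hsymm.eq]

end calculus

/-! ### Solutions of the Helmholtz equation -/

/-- `f` is a smooth solution of `-Δ f = c f` on `Ω`. -/
structure IsHelmholtz (Ω : Set (Fin 3 → ℝ)) (c : ℝ) (f : (Fin 3 → ℝ) → ℝ) : Prop where
  smooth : ContDiffOn ℝ ∞ f Ω
  lap_eq : ∀ x ∈ Ω, lap f x = -c * f x

variable {Ω : Set (Fin 3 → ℝ)} {c : ℝ} {f g : (Fin 3 → ℝ) → ℝ}

theorem lap_congr (hΩ : IsOpen Ω) (h : EqOn f g Ω) : EqOn (lap f) (lap g) Ω := fun x hx => by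
  simp only [lap]
  exact Finset.sum_congr rfl fun i _ => pd_congr hΩ (pd_congr hΩ h i) i hx

theorem IsHelmholtz.congr (hΩ : IsOpen Ω) (hf : IsHelmholtz Ω c f) (h : EqOn g f Ω) :
    IsHelmholtz Ω c g :=
  ⟨hf.smooth.congr h, fun x hx => by rw [lap_congr hΩ h hx, hf.lap_eq x hx, h hx]⟩

theorem IsHelmholtz.add (hΩ : IsOpen Ω) (hf : IsHelmholtz Ω c f) (hg : IsHelmholtz Ω c g) :
    IsHelmholtz Ω c (fun x => f x + g x) := by
  refine ⟨hf.smooth.add hg.smooth, fun x hx => ?_⟩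
  have h1 : ∀ i, EqOn (pd i fun x => f x + g x) (fun x => pd i f x + pd i g x) Ω := fun i y hy =>
    pd_add hΩ hf.smooth hg.smooth i hy
  have h2 : lap (fun x => f x + g x) x = lap f x + lap g x := by
    simp only [lap, ← Finset.sum_add_distrib]
    refine Finset.sum_congr rfl fun i _ => ?_
    rw [pd_congr hΩ (h1 i) i hx,
      pd_add hΩ (contDiffOn_pd hΩ hf.smooth i) (contDiffOn_pd hΩ hg.smooth i) i hx]
  rw [h2, hf.lap_eq x hx, hg.lap_eq x hx]
  ring

theorem IsHelmholtz.const_mul (hΩ : IsOpen Ω) (hf : IsHelmholtz Ω c f) (b : ℝ) :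
    IsHelmholtz Ω c (fun x => b * f x) := by
  refine ⟨contDiffOn_const.mul hf.smooth, fun x hx => ?_⟩
  have h1 : ∀ i, EqOn (pd i fun x => b * f x) (fun x => b * pd i f x) Ω := fun i y hy =>
    pd_const_mul hΩ hf.smooth b i hy
  have h2 : lap (fun x => b * f x) x = b * lap f x := by
    simp only [lap, Finset.mul_sum]
    refine Finset.sum_congr rfl fun i _ => ?_
    rw [pd_congr hΩ (h1 i) i hx, pd_const_mul hΩ (contDiffOn_pd hΩ hf.smooth i) b i hx]
  rw [h2, hf.lap_eq x hx]
  ring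

theorem pd_lap (hΩ : IsOpen Ω) (hf : ContDiffOn ℝ ∞ f Ω) (i : Fin 3) {x : Fin 3 → ℝ} (hx : x ∈ Ω) :
    pd i (lap f) x = lap (pd i f) x := by
  have hs : ∀ j, ContDiffOn ℝ ∞ (pd j (pd j f)) Ω := fun j =>
    contDiffOn_pd hΩ (contDiffOn_pd hΩ hf j) j
  have e : lap f = fun y => (pd 0 (pd 0 f) y + pd 1 (pd 1 f) y) + pd 2 (pd 2 f) y := by
    funext y; simp [lap, Fin.sum_univ_three]
  have h1 : ∀ j, pd i (pd j (pd j f)) x = pd j (pd j (pd i f)) x := fun j => by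
    rw [pd_comm hΩ (contDiffOn_pd hΩ hf j) i j hx]
    exact pd_congr hΩ (fun y hy => pd_comm hΩ hf i j hy) j hx
  rw [e, pd_add hΩ ((hs 0).add (hs 1)) (hs 2) i hx, pd_add hΩ (hs 0) (hs 1) i hx, h1, h1, h1]
  simp [lap, Fin.sum_univ_three]

theorem IsHelmholtz.pd (hΩ : IsOpen Ω) (hf : IsHelmholtz Ω c f) (i : Fin 3) :
    IsHelmholtz Ω c (pd i f) := by
  refine ⟨contDiffOn_pd hΩ hf.smooth i, fun x hx => ?_⟩
  rw [← pd_lap hΩ hf.smooth i hx, pd_congr hΩ (g := fun y => -c * f y) hf.lap_eq i hx,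
    pd_const_mul hΩ hf.smooth _ i hx]

/-! ### Beltrami fields -/

/-- A smooth divergence-free field with `curl u = -lam u` and `Δ u = -lam² u` on `Ω`. -/
structure IsBeltrami (Ω : Set (Fin 3 → ℝ)) (lam : ℝ) (u : (Fin 3 → ℝ) → Fin 3 → ℝ) : Prop where
  helmholtz : ∀ i, IsHelmholtz Ω (lam ^ 2) fun y => u y i
  div_eq : ∀ x ∈ Ω, pd 0 (fun y => u y 0) x + pd 1 (fun y => u y 1) x + pd 2 (fun y => u y 2) x = 0
  curl_zero : ∀ x ∈ Ω, pd 1 (fun y => u y 2) x - pd 2 (fun y => u y 1) x = -lam * u x 0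
  curl_one : ∀ x ∈ Ω, pd 2 (fun y => u y 0) x - pd 0 (fun y => u y 2) x = -lam * u x 1
  curl_two : ∀ x ∈ Ω, pd 0 (fun y => u y 1) x - pd 1 (fun y => u y 0) x = -lam * u x 2

variable {lam : ℝ} {u w : (Fin 3 → ℝ) → Fin 3 → ℝ}

theorem IsBeltrami.add (hΩ : IsOpen Ω) (hu : IsBeltrami Ω lam u) (hw : IsBeltrami Ω lam w) :
    IsBeltrami Ω lam (u + w) := by
  have h : ∀ i j, ∀ x ∈ Ω, pd i (fun y => (u + w) y j) x
      = pd i (fun y => u y j) x + pd i (fun y => w y j) x := fun i j x hx =>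
    pd_add hΩ (hu.helmholtz j).smooth (hw.helmholtz j).smooth i hx
  refine ⟨fun i => (hu.helmholtz i).add hΩ (hw.helmholtz i), fun x hx => ?_, fun x hx => ?_,
    fun x hx => ?_, fun x hx => ?_⟩
  · simp only [h _ _ x hx]
    linear_combination hu.div_eq x hx + hw.div_eq x hx
  · rw [h _ _ x hx, h _ _ x hx]
    simp only [Pi.add_apply]
    linear_combination hu.curl_zero x hx + hw.curl_zero x hx
  · rw [h _ _ x hx, h _ _ x hx]
    simp only [Pi.add_apply]
    linear_combination hu.curl_one x hx + hw.curl_one x hx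
  · rw [h _ _ x hx, h _ _ x hx]
    simp only [Pi.add_apply]
    linear_combination hu.curl_two x hx + hw.curl_two x hx

theorem IsBeltrami.smul (hΩ : IsOpen Ω) (hu : IsBeltrami Ω lam u) (b : ℝ) :
    IsBeltrami Ω lam (b • u) := by
  have h : ∀ i j, ∀ x ∈ Ω, pd i (fun y => (b • u) y j) x = b * pd i (fun y => u y j) x :=
    fun i j x hx => pd_const_mul hΩ (hu.helmholtz j).smooth b i hx
  refine ⟨fun i => (hu.helmholtz i).const_mul hΩ b, fun x hx => ?_, fun x hx => ?_,
    fun x hx => ?_, fun x hx => ?_⟩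
  · simp only [h _ _ x hx]
    linear_combination b * hu.div_eq x hx
  · rw [h _ _ x hx, h _ _ x hx]
    simp only [Pi.smul_apply, smul_eq_mul]
    linear_combination b * hu.curl_zero x hx
  · rw [h _ _ x hx, h _ _ x hx]
    simp only [Pi.smul_apply, smul_eq_mul]
    linear_combination b * hu.curl_one x hx
  · rw [h _ _ x hx, h _ _ x hx]
    simp only [Pi.smul_apply, smul_eq_mul]
    linear_combination b * hu.curl_two x hx

theorem IsBeltrami.divergence_eq_zero (hu : IsBeltrami Ω lam u) {x : Fin 3 → ℝ} (hx : x ∈ Ω) :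
    divergence u x = 0 := by
  rw [divergence, Fin.sum_univ_three]
  exact hu.div_eq x hx

/-- Minus half the squared speed. -/
def bernoulliPressure (v : Fin 3 → ℝ) : ℝ := -(1 / 2) * (v 0 * v 0 + v 1 * v 1 + v 2 * v 2)

/-- `(u · ∇) u = ∇(|u|² / 2) - u × curl u`, and the last term vanishes because `curl u` is parallel
to `u`. -/
theorem IsBeltrami.convection_add_pd (hΩ : IsOpen Ω) (hu : IsBeltrami Ω lam u) {x : Fin 3 → ℝ}
    (hx : x ∈ Ω) (i : Fin 3) :
    convection u x i + pd i (fun y => bernoulliPressure (u y)) x = 0 := by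
  have hs := fun j => (hu.helmholtz j).smooth
  have hm := fun j => (hs j).mul (hs j)
  have hP : pd i (fun y => bernoulliPressure (u y)) x = -(u x 0 * pd i (fun y => u y 0) x
      + u x 1 * pd i (fun y => u y 1) x + u x 2 * pd i (fun y => u y 2) x) := by
    simp only [bernoulliPressure]
    rw [pd_const_mul hΩ (((hm 0).add (hm 1)).add (hm 2)) _ i hx,
      pd_add hΩ ((hm 0).add (hm 1)) (hm 2) i hx, pd_add hΩ (hm 0) (hm 1) i hx,
      pd_mul hΩ (hs 0) (hs 0) i hx, pd_mul hΩ (hs 1) (hs 1) i hx, pd_mul hΩ (hs 2) (hs 2) i hx]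
    ring
  have c0 := hu.curl_zero x hx
  have c1 := hu.curl_one x hx
  have c2 := hu.curl_two x hx
  rw [hP, convection, Fin.sum_univ_three]
  fin_cases i
  · simp only [Fin.zero_eta]
    linear_combination u x 2 * c1 - u x 1 * c2
  · simp only [Fin.mk_one]
    linear_combination u x 0 * c2 - u x 2 * c0
  · simp only [Fin.reduceFinMk]
    linear_combination u x 1 * c0 - u x 0 * c1

theorem IsBeltrami.contDiffOn (hu : IsBeltrami Ω lam u) : ContDiffOn ℝ ∞ u Ω :=
  contDiffOn_pi.2 fun i => (hu.helmholtz i).smooth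

theorem contDiff_bernoulliPressure : ContDiff ℝ ∞ bernoulliPressure := by
  unfold bernoulliPressure; fun_prop

theorem IsBeltrami.isStaticEulerSolution (hΩ : IsOpen Ω) (hu : IsBeltrami Ω lam u) :
    IsStaticEulerSolution Ω u :=
  ⟨hu.contDiffOn, fun y => bernoulliPressure (u y),
    contDiff_bernoulliPressure.comp_contDiffOn hu.contDiffOn,
    fun _ hx => ⟨hu.convection_add_pd hΩ hx, hu.divergence_eq_zero hx⟩⟩

/-- The time derivative `-ν lam² u` cancels against `ν Δ u`; at each fixed time the static Euler
equations remain. -/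
theorem IsBeltrami.isNavierStokesSolution (hΩ : IsOpen Ω) (hu : IsBeltrami Ω lam u) (ν : ℝ) :
    IsNavierStokesSolution ν Ω fun t => Real.exp (-ν * lam ^ 2 * t) • u := by
  have hsm : ContDiffOn ℝ ∞ (fun p : ℝ × (Fin 3 → ℝ) => Real.exp (-ν * lam ^ 2 * p.1) • u p.2)
      (univ ×ˢ Ω) := by
    have h1 : ContDiffOn ℝ ∞ (fun p : ℝ × (Fin 3 → ℝ) => Real.exp (-ν * lam ^ 2 * p.1))
        (univ ×ˢ Ω) := by
      have : ContDiff ℝ ∞ (fun p : ℝ × (Fin 3 → ℝ) => Real.exp (-ν * lam ^ 2 * p.1)) := by fun_prop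
      exact this.contDiffOn
    exact h1.smul (hu.contDiffOn.comp contDiff_snd.contDiffOn fun p hp => hp.2)
  refine ⟨hsm, fun t y => bernoulliPressure (Real.exp (-ν * lam ^ 2 * t) • u y),
    contDiff_bernoulliPressure.comp_contDiffOn hsm, fun t x hx => ⟨fun i => ?_, ?_⟩⟩
  · have hb := hu.smul hΩ (Real.exp (-ν * lam ^ 2 * t))
    have hconv := hb.convection_add_pd hΩ hx i
    have hlap := (hb.helmholtz i).lap_eq x hx
    have hd : HasDerivAt (fun s => (Real.exp (-ν * lam ^ 2 * s) • u) x i)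
        (Real.exp (-ν * lam ^ 2 * t) * (-ν * lam ^ 2) * u x i) t := by
      have := (((hasDerivAt_id t).const_mul (-ν * lam ^ 2)).exp).mul_const (u x i)
      simpa using this
    rw [hd.deriv, hlap]
    simp only [Pi.smul_apply, smul_eq_mul] at hconv ⊢
    linear_combination hconv
  · exact (hu.smul hΩ _).divergence_eq_zero hx

theorem eulerField_apply (a lam : ℝ) (Ψ : (Fin 3 → ℝ) → ℝ) (x : Fin 3 → ℝ) :
    eulerField ![0, 0, a] lam Ψ x
      = ![-(lam * a) * pd 1 Ψ x + a * pd 0 (pd 2 Ψ) x, lam * a * pd 0 Ψ x + a * pd 1 (pd 2 Ψ) x,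
        -a * pd 1 (pd 1 Ψ) x + -a * pd 0 (pd 0 Ψ) x] := by
  funext i
  fin_cases i <;> simp [eulerField, crossGrad, crossGradCross, crossProduct] <;> ring

/-- With `w = A × ∇Ψ` the field is `lam w - curl w`. Since `div w = 0` and `Δ w = -lam² w`, its curl
is `lam curl w + Δ w = -lam (lam w - curl w)`. Its components are constant-coefficient derivatives
of `Ψ`, hence again Helmholtz solutions. -/
theorem isBeltrami_eulerField (hΩ : IsOpen Ω) {Ψ : (Fin 3 → ℝ) → ℝ} (a : ℝ)
    (hΨ : IsHelmholtz Ω (lam ^ 2) Ψ) : IsBeltrami Ω lam (eulerField ![0, 0, a] lam Ψ) := by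
  have e0 : (fun y => eulerField ![0, 0, a] lam Ψ y 0)
      = fun y => -(lam * a) * pd 1 Ψ y + a * pd 0 (pd 2 Ψ) y := by
    funext y; rw [eulerField_apply]; rfl
  have e1 : (fun y => eulerField ![0, 0, a] lam Ψ y 1)
      = fun y => lam * a * pd 0 Ψ y + a * pd 1 (pd 2 Ψ) y := by
    funext y; rw [eulerField_apply]; rfl
  have e2 : (fun y => eulerField ![0, 0, a] lam Ψ y 2)
      = fun y => -a * pd 1 (pd 1 Ψ) y + -a * pd 0 (pd 0 Ψ) y := by
    funext y; rw [eulerField_apply]; rfl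
  have s1 := fun i => (hΨ.pd hΩ i)
  have s2 := fun i j => ((hΨ.pd hΩ j).pd hΩ i)
  have hcomb : ∀ (b d : ℝ) (p q : (Fin 3 → ℝ) → ℝ), IsHelmholtz Ω (lam ^ 2) p →
      IsHelmholtz Ω (lam ^ 2) q → ∀ i, ∀ x ∈ Ω,
      pd i (fun y => b * p y + d * q y) x = b * pd i p x + d * pd i q x :=
    fun b d p q hp hq i x hx => by
      rw [pd_add hΩ (hp.const_mul hΩ b).smooth (hq.const_mul hΩ d).smooth i hx,
        pd_const_mul hΩ hp.smooth b i hx, pd_const_mul hΩ hq.smooth d i hx]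
  have c2 : ∀ i j, ∀ x ∈ Ω, pd i (pd j Ψ) x = pd j (pd i Ψ) x := fun i j x hx =>
    pd_comm hΩ hΨ.smooth i j hx
  have c3 : ∀ i j k, ∀ x ∈ Ω, pd i (pd j (pd k Ψ)) x = pd j (pd i (pd k Ψ)) x := fun i j k x hx =>
    pd_comm hΩ (s1 k).smooth i j hx
  have c3' : ∀ i j k, ∀ x ∈ Ω, pd i (pd j (pd k Ψ)) x = pd i (pd k (pd j Ψ)) x := fun i j k x hx =>
    pd_congr hΩ (c2 j k) i hx
  have hlap : ∀ i, ∀ x ∈ Ω, pd 0 (pd 0 (pd i Ψ)) x + pd 1 (pd 1 (pd i Ψ)) x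
      + pd 2 (pd 2 (pd i Ψ)) x = -(lam ^ 2) * pd i Ψ x := fun i x hx => by
    rw [← (s1 i).lap_eq x hx, lap, Fin.sum_univ_three]
  refine ⟨fun i => ?_, fun x hx => ?_, fun x hx => ?_, fun x hx => ?_, fun x hx => ?_⟩
  · fin_cases i
    · simp only [Fin.zero_eta, e0]
      exact ((s1 1).const_mul hΩ _).add hΩ ((s2 0 2).const_mul hΩ _)
    · simp only [Fin.mk_one, e1]
      exact ((s1 0).const_mul hΩ _).add hΩ ((s2 1 2).const_mul hΩ _)
    · simp only [Fin.reduceFinMk, e2]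
      exact ((s2 1 1).const_mul hΩ _).add hΩ ((s2 0 0).const_mul hΩ _)
  · rw [e0, e1, e2, hcomb _ _ _ _ (s1 1) (s2 0 2) _ x hx, hcomb _ _ _ _ (s1 0) (s2 1 2) _ x hx,
      hcomb _ _ _ _ (s2 1 1) (s2 0 0) _ x hx, c3 2 1 1 x hx, c3 2 0 0 x hx, c3' 1 2 1 x hx,
      c3' 0 2 0 x hx, c2 1 0 x hx]
    ring
  · rw [congrFun e0 x, e1, e2, hcomb _ _ _ _ (s1 0) (s2 1 2) _ x hx,
      hcomb _ _ _ _ (s2 1 1) (s2 0 0) _ x hx]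
    -- The third derivatives are brought to a common order; the Helmholtz equation for `pd 1 Ψ` then
    -- produces the term with `lam²`. The next component uses `pd 0 Ψ` in the same way.
    have h := hlap 1 x hx
    rw [c3' 2 2 1 x hx, c3 2 1 2 x hx] at h
    rw [c3 2 1 2 x hx, c3 1 0 0 x hx, c3' 0 1 0 x hx, c2 2 0 x hx]
    linear_combination (-a) * h
  · rw [congrFun e1 x, e0, e2, hcomb _ _ _ _ (s1 1) (s2 0 2) _ x hx,
      hcomb _ _ _ _ (s2 1 1) (s2 0 0) _ x hx]
    have h := hlap 0 x hx
    rw [c3' 2 2 0 x hx, c3 2 0 2 x hx] at h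
    rw [c3 2 0 2 x hx, c3 0 1 1 x hx, c3' 1 0 1 x hx, c2 2 1 x hx]
    linear_combination a * h
  · rw [congrFun e2 x, e0, e1, hcomb _ _ _ _ (s1 1) (s2 0 2) _ x hx,
      hcomb _ _ _ _ (s1 0) (s2 1 2) _ x hx, c3 0 1 2 x hx]
    ring

/-! ### Separated solutions of the Helmholtz equation in the shell -/

variable {R₁ R₂ : ℝ}

theorem pd_separated {k T : ℝ → ℝ} (hk : ContDiff ℝ ∞ k) (hT : ContDiff ℝ ∞ T) (x : Fin 3 → ℝ) :
    (pd 0 (fun x : Fin 3 → ℝ => k (x 0 ^ 2 + x 1 ^ 2) * T (x 2)) x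
      = 2 * x 0 * (deriv k (x 0 ^ 2 + x 1 ^ 2) * T (x 2))) ∧
    (pd 1 (fun x : Fin 3 → ℝ => k (x 0 ^ 2 + x 1 ^ 2) * T (x 2)) x
      = 2 * x 1 * (deriv k (x 0 ^ 2 + x 1 ^ 2) * T (x 2))) ∧
    (pd 2 (fun x : Fin 3 → ℝ => k (x 0 ^ 2 + x 1 ^ 2) * T (x 2)) x
      = k (x 0 ^ 2 + x 1 ^ 2) * deriv T (x 2)) := by
  have h0 : ∀ j : Fin 3, HasFDerivAt (fun x : Fin 3 → ℝ => x j)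
      (ContinuousLinearMap.proj (R := ℝ) (φ := fun _ : Fin 3 => ℝ) j) x := fun j =>
    hasFDerivAt_apply j x
  have h1 := ((h0 0).pow 2).add ((h0 1).pow 2)
  have h2 := (hk.differentiable (by simp)).differentiableAt.hasDerivAt.comp_hasFDerivAt x h1
  have h3 := (hT.differentiable (by simp)).differentiableAt.hasDerivAt.comp_hasFDerivAt x (h0 2)
  have h4 : fderiv ℝ (fun x : Fin 3 → ℝ => k (x 0 ^ 2 + x 1 ^ 2) * T (x 2)) x = _ :=
    (h2.mul h3).fderiv
  simp only [pd, h4]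
  refine ⟨?_, ?_, ?_⟩ <;> simp <;> ring

theorem pd_coord_mul {k : (Fin 3 → ℝ) → ℝ} (hk : ContDiff ℝ ∞ k) (i : Fin 3) (x : Fin 3 → ℝ) :
    pd i (fun x => 2 * x i * k x) x = 2 * k x + 2 * x i * pd i k x := by
  have h1 : ContDiffOn ℝ ∞ (fun x : Fin 3 → ℝ => x i) univ := by fun_prop
  have h2 : pd i (fun x : Fin 3 → ℝ => x i) x = 1 := by
    rw [pd, (hasFDerivAt_apply i x).fderiv]
    simp
  rw [pd_mul isOpen_univ (contDiffOn_const.mul h1) hk.contDiffOn i (mem_univ x),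
    pd_const_mul isOpen_univ h1 2 i (mem_univ x), h2]
  ring

theorem isOpen_cylShell (R₁ R₂ : ℝ) : IsOpen (cylShell R₁ R₂) :=
  isOpen_Ioo.preimage (by fun_prop : Continuous fun x : Fin 3 → ℝ => √(x 0 ^ 2 + x 1 ^ 2))

/-- With `ρ = x₁² + x₂²` the Laplacian of `h(ρ) T(x₃)` is `(4 h' + 4 ρ h'') T + h T''`. Using `ρ`
instead of `r` avoids differentiating the square root. -/
theorem isHelmholtz_separated (hR₁ : 0 < R₁) (hR : R₁ < R₂) {h T : ℝ → ℝ} {μ η : ℝ}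
    (hh : ContDiff ℝ ∞ h) (hT : ContDiff ℝ ∞ T)
    (hode : ∀ s ∈ Ioo (R₁ ^ 2) (R₂ ^ 2), 4 * deriv h s + 4 * s * deriv (deriv h) s = -μ * h s)
    (hTode : ∀ t, deriv (deriv T) t = -η ^ 2 * T t) :
    IsHelmholtz (cylShell R₁ R₂) (μ + η ^ 2)
      fun x => h (x 0 ^ 2 + x 1 ^ 2) * T (x 2) := by
  have hh' : ContDiff ℝ ∞ (deriv h) := (contDiff_infty_iff_deriv.1 hh).2
  have hT' : ContDiff ℝ ∞ (deriv T) := (contDiff_infty_iff_deriv.1 hT).2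
  have hρ : ContDiff ℝ ∞ fun x : Fin 3 → ℝ => x 0 ^ 2 + x 1 ^ 2 := by fun_prop
  have hz : ContDiff ℝ ∞ fun x : Fin 3 → ℝ => x 2 := by fun_prop
  refine ⟨((hh.comp hρ).mul (hT.comp hz)).contDiffOn, fun x hx => ?_⟩
  have hs : x 0 ^ 2 + x 1 ^ 2 ∈ Ioo (R₁ ^ 2) (R₂ ^ 2) := by
    obtain ⟨h1, h2⟩ := hx
    rw [cylRadius, Real.lt_sqrt hR₁.le] at h1
    rw [cylRadius, Real.sqrt_lt' (hR₁.trans hR)] at h2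
    exact ⟨h1, h2⟩
  have hk : ContDiff ℝ ∞ fun x : Fin 3 → ℝ => deriv h (x 0 ^ 2 + x 1 ^ 2) * T (x 2) :=
    (hh'.comp hρ).mul (hT.comp hz)
  have p0 := funext fun x => (pd_separated hh hT x).1
  have p1 := funext fun x => (pd_separated hh hT x).2.1
  have p2 := funext fun x => (pd_separated hh hT x).2.2
  rw [lap, Fin.sum_univ_three, p0, p1, p2, pd_coord_mul hk 0, pd_coord_mul hk 1,
    (pd_separated hh' hT x).1, (pd_separated hh' hT x).2.1, (pd_separated hh hT' x).2.2, hTode]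
  linear_combination T (x 2) * hode _ hs

theorem deriv_trig (α β η : ℝ) : deriv (fun t => α * Real.sin (η * t) + β * Real.cos (η * t))
    = fun t => -(β * η) * Real.sin (η * t) + α * η * Real.cos (η * t) := by
  funext t
  have h1 : HasDerivAt (fun t => η * t) η t := by simpa using (hasDerivAt_id t).const_mul η
  refine (((h1.sin.const_mul α).add (h1.cos.const_mul β)).congr_deriv ?_).deriv
  ring

theorem isHelmholtz_psi (hR₁ : 0 < R₁) (hR : R₁ < R₂) {bc : BoundaryCondition} {μ : ℝ} {V : ℝ → ℝ}
    (hV : IsSLSolution R₁ R₂ bc μ V) (α β η : ℝ) :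
    IsHelmholtz (cylShell R₁ R₂) (μ + η ^ 2) (α • psiSin V η + β • psiCos V η) := by
  obtain ⟨h, hh, -, hVh, hode⟩ := hV.exists_smooth_extension hR₁ hR
  have hT : ContDiff ℝ ∞ fun t : ℝ => α * Real.sin (η * t) + β * Real.cos (η * t) := by fun_prop
  refine (isHelmholtz_separated (η := η) hR₁ hR hh hT hode fun t => ?_).congr
    (isOpen_cylShell R₁ R₂) fun x hx => ?_
  · rw [deriv_trig, deriv_trig]
    ring
  · have hx' : V (cylRadius x) = h (x 0 ^ 2 + x 1 ^ 2) := by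
      rw [hVh _ ⟨hx.1.le, hx.2.le⟩, cylRadius, Real.sq_sqrt (by positivity)]
    simp only [Pi.add_apply, Pi.smul_apply, smul_eq_mul, psiSin, psiCos, hx']
    ring

theorem isBeltrami_of_mem_eulerSpace (hR₁ : 0 < R₁) (hR : R₁ < R₂) {bc : BoundaryCondition}
    {μ η : ℝ} {V : ℝ → ℝ} (hV : IsSLSolution R₁ R₂ bc μ V) (hlam : lam ^ 2 = μ + η ^ 2) (a α β : ℝ) :
    IsBeltrami (cylShell R₁ R₂) lam (α • eulerField ![0, 0, a] lam (psiSin V η)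
      + β • eulerField ![0, 0, a] lam (psiCos V η)) := by
  have hΩ := isOpen_cylShell R₁ R₂
  have h1 := isHelmholtz_psi hR₁ hR hV 1 0 η
  have h2 := isHelmholtz_psi hR₁ hR hV 0 1 η
  simp only [one_smul, zero_smul, add_zero, zero_add, ← hlam] at h1 h2
  exact ((isBeltrami_eulerField hΩ a h1).smul hΩ α).add hΩ
    ((isBeltrami_eulerField hΩ a h2).smul hΩ β)

theorem nsField_eq (ν lam : ℝ) (A : Fin 3 → ℝ) (Ψ : (Fin 3 → ℝ) → ℝ) :
    nsField ν A lam Ψ = fun t => Real.exp (-ν * lam ^ 2 * t) • eulerField A lam Ψ := by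
  funext t x
  simp only [nsField, eulerField, Pi.smul_apply, smul_add, smul_smul, mul_comm]

end

end AnnulusFlow

/-! ### The main theorem -/

theorem mainTheorem6 (R₁ R₂ : ℝ) (hR₁ : 0 < R₁) (hR : R₁ < R₂) (bc : BoundaryCondition) :
    -- every eigenvalue is real
    (∀ μ : ℂ, eigenspace R₁ R₂ hR bc μ ≠ ⊥ → μ.im = 0) ∧
    -- every eigenvalue is geometrically simple or double
    (∀ μ : ℝ, eigenspace R₁ R₂ hR bc μ ≠ ⊥ →
      Module.finrank ℝ (eigenspace R₁ R₂ hR bc μ) = 1 ∨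
      Module.finrank ℝ (eigenspace R₁ R₂ hR bc μ) = 2) ∧
    -- all but finitely many eigenvalues are positive
    {μ : ℝ | μ ≤ 0 ∧ eigenspace R₁ R₂ hR bc μ ≠ ⊥}.Finite ∧
    -- the positive ones form an infinite sequence `ζ_j ^ 2`, with eigenfunctions `V_j`
    (∃ (ζ : ℕ → ℝ) (V : ℕ → ℝ → ℝ), IsEigenEnumeration R₁ R₂ hR bc ζ V) ∧
    -- for all such sequences (and for all real `ζ_j` whose square is an eigenvalue):
    (∀ (ζ : ℕ → ℝ) (V : ℕ → ℝ → ℝ), (∀ j, V j ∈ eigenspace R₁ R₂ hR bc (ζ j ^ 2)) →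
      -- regularity under the Dirichlet condition
      (bc = BoundaryCondition.dirichlet → ∀ j,
        MemH10 (planeRing R₁ R₂) (planeRadial (V j)) ∧
        MemHInfty (planeRing R₁ R₂) (planeRadial (V j))) ∧
      ∀ lam : ℕ → ℝ → ℝ, (∀ j η, lam j η ^ 2 = ζ j ^ 2 + η ^ 2) →
        -- `Ψ_j` solves `-ΔΨ = λ_j² Ψ`
        (∀ (j : ℕ) (α β η : ℝ),
          ContDiffOn ℝ ∞ (α • psiSin (V j) η + β • psiCos (V j) η) (cylShell R₁ R₂) ∧
          ∀ x ∈ cylShell R₁ R₂,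
            -lap (α • psiSin (V j) η + β • psiCos (V j) η) x
              = lam j η ^ 2 * (α • psiSin (V j) η + β • psiCos (V j) η) x) ∧
        -- the solution classes of the static Euler and of the Navier–Stokes equations
        ∀ a : ℝ, a ≠ 0 →
          (∀ u ∈ eulerClass ![0, 0, a] V lam, IsStaticEulerSolution (cylShell R₁ R₂) u) ∧
          ∀ ν : ℝ, 0 < ν → ∀ u ∈ nsClass ν ![0, 0, a] V lam,
            IsNavierStokesSolution ν (cylShell R₁ R₂) u) := by
  have hΩ := isOpen_cylShell R₁ R₂
  refine ⟨fun μ h => eigenvalue_im_eq_zero hR₁ hR h, fun μ h => ?_,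
    finite_nonpos_eigenvalues hR₁ hR bc, exists_isEigenEnumeration hR₁ hR bc, ?_⟩
  · have h1 := finrank_eigenspace_pos hR₁ hR h
    have h2 := finrank_eigenspace_le hR₁ hR bc μ
    omega
  intro ζ V hV
  have hV : ∀ j, IsSLSolution R₁ R₂ bc (ζ j ^ 2) (V j) := hV
  refine ⟨fun hbc j => ?_, fun lam hlam => ⟨fun j α β η => ?_, fun a _ => ⟨fun u hu => ?_,
    fun ν _ u hu => ?_⟩⟩⟩
  · subst hbc
    exact regularity_dirichlet hR₁ hR (hV j)
  · have h := isHelmholtz_psi hR₁ hR (hV j) α β η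
    refine ⟨h.smooth, fun x hx => ?_⟩
    rw [h.lap_eq x hx, hlam]
    ring
  -- Both generators are Beltrami fields with the same `λ`, so every combination is one as well,
  -- although the Euler equations are not linear.
  · simp only [eulerClass, mem_iUnion, SetLike.mem_coe, eulerSpace, Submodule.mem_span_pair] at hu
    obtain ⟨j, η, α, β, rfl⟩ := hu
    exact (isBeltrami_of_mem_eulerSpace hR₁ hR (hV j) (hlam j η) a α β).isStaticEulerSolution hΩ
  · simp only [nsClass, mem_iUnion, SetLike.mem_coe, nsSpace, Submodule.mem_span_pair] at hu
    obtain ⟨j, η, α, β, rfl⟩ := hu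
    have h := (isBeltrami_of_mem_eulerSpace hR₁ hR (hV j) (hlam j η) a α
      β).isNavierStokesSolution hΩ ν
    -- The exponential depends only on `λ_j`; it factors out of the combination and leaves a single
    -- decaying Beltrami field.
    convert h using 1
    funext t
    simp only [nsField_eq, Pi.add_apply, Pi.smul_apply, smul_add]
    rw [smul_comm α, smul_comm β]
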